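/- **Model.** Let $n\ge 1$. A dynamic $n$-node radio network has a fixed set $V$ of $n$ nodes and communication graphs $G_1,G_2,\dots$ on $V$, one for each synchronous round; it is *$\infty$-interval connected* if for every $r\ge1$ the graph on $V$ with edge set $\bigcap_{r'\ge r}E(G_{r'})$ is connected. A randomized algorithm is a collection of $n$ processes, one per node, each drawing fresh independent random coins in every round. In each round each node either transmits one packet or listens; a listening node receives the packet of a neighbor in $G_r$ if that is its only neighbor transmitting in round $r$, and otherwise it receives silence (no collision detection). The graphs are chosen by a *$0$-oblivious* (strongly adaptive) adversary: $G_r$ may depend on the algorithm, on the input and on all random choices of rounds $1,\dots,r$. In *$s$-multi-message broadcast*, $s\ge 1$ distinct broadcast messages of $B\ge1$ bits each are given to nodes, each message to one (arbitrary) source node, and all $n$ nodes have to learn all $s$ messages. The algorithm is *store-and-forward* if it treats broadcast messages as black boxes that nodes can only store and forward; the *communication capacity* is $c\ge 1$ if a packet contains at most $c$ broadcast messages plus $O(cB)$ bits of control information. The algorithm may depend on $n$, $s$, $c$ and $B$. **Theorem.** For every constant $\gamma>0$ there is a constant $C>0$, depending only on $\gamma$, such that for all $n,s,B\ge 1$ the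 following holds against every $0$-oblivious adversary whose dynamic networks are $\infty$-interval connected. 1. For communication capacity $c=1$, there is a store-and-forward algorithm that solves $s$-multi-message broadcast with probability at least $1-n^{-\gamma}$ within $C\, n\, s\, \log^2 n$ rounds. 2. For every communication capacity $c\ge 1$, there is a store-and-forward algorithm that solves $s$-multi-message broadcast with probability at least $1-n^{-\gamma}$ within $C\left(1+\frac sc\right) n\log^4 n$ rounds. In both parts the algorithm does not depend on the adversary or the input, and the constant in the $O(cB)$ bound on the control information is absolute. -/

import Mathlib

open MeasureTheory

namespace RadioNetwork

/-- The content of one transmission: a list of broadcast messages and a string of control bits.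
On the network, `M` is the type of broadcast messages; inside a process, which treats broadcast
messages as black boxes, `M = ℕ` and the entries are local handles (see `Algorithm`). -/
structure Packet (M : Type) where
  msgs : List M
  ctrl : List Bool

/-- A randomized store-and-forward algorithm for `n` nodes: a collection of `n` processes, one for
each node, which is also the identifier of the node. The broadcast messages are black boxes. Each
node keeps the list of the broadcast messages it knows, in the order in which it got them, and its
process refers to a broadcast message only by its position (its handle) in that list; it never
sees the content. In every round each process draws a fresh coin according to `law`, and then

* `send v st x` is its action in state `st` with coin `x`: `none` means to listen, `some p` means to
  transmit the broadcast messages with handles `p.msgs` and the control bits `p.ctrl`;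
* `next v st x y` is the state after the round, where `y` is what it received (`none` is silence,
  broadcast messages in `y` are again given by handles).

`init v k` is the initial state of the process of `v` if `k` broadcast messages are given to `v`. -/
structure Algorithm (n : ℕ) where
  Coin : Type
  coinFintype : Fintype Coin
  law : PMF Coin
  State : Type
  init : Fin n → ℕ → State
  send : Fin n → State → Coin → Option (Packet ℕ)
  next : Fin n → State → Coin → Option (Packet ℕ) → State

/-- Every transmission contains at most `c` broadcast messages and at most `b` control bits. -/
def Algorithm.HasCapacity {n : ℕ} (A : Algorithm n) (c b : ℕ) : Prop :=
  ∀ (v : Fin n) (st : A.State) (x : A.Coin) (p : Packet ℕ),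
    A.send v st x = some p → p.msgs.length ≤ c ∧ p.ctrl.length ≤ b

/-- The local configuration of a node: the broadcast messages it knows and the state of its
process. -/
structure NodeConfig (σ M : Type) where
  known : List M
  st : σ

/-- Append to the list `known` those entries of the second list that are new. -/
def learn {M : Type} [DecidableEq M] (known : List M) : List M → List M
  | [] => known
  | m :: ms => learn (if m ∈ known then known else known ++ [m]) ms

section Execution

variable {n : ℕ} {M : Type} [DecidableEq M] (A : Algorithm n)

/-- What node `v` puts on the channel. Handles that are out of range are dropped, so a node can
only transmit broadcast messages that it knows. -/
def transmission (cfg : Fin n → NodeConfig A.State M) (x : Fin n → A.Coin) (v : Fin n) :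
    Option (Packet M) :=
  (A.send v (cfg v).st (x v)).map fun p =>
    { msgs := p.msgs.filterMap fun i => (cfg v).known[i]?
      ctrl := p.ctrl }

open Classical in
/-- What node `v` receives in communication graph `G` if `tr u` is the transmission of node `u`:
if `v` listens and exactly one neighbor transmits, the packet of that neighbor, else silence. -/
noncomputable def reception (G : SimpleGraph (Fin n)) (tr : Fin n → Option (Packet M))
    (v : Fin n) : Option (Packet M) :=
  if h : tr v = none ∧ ∃! u, G.Adj v u ∧ tr u ≠ none then tr h.2.choose else none

/-- The configuration of node `v` after it received `y` in a round with coin `x`. -/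
def updateNode (v : Fin n) (nc : NodeConfig A.State M) (x : A.Coin) :
    Option (Packet M) → NodeConfig A.State M
  | none => { known := nc.known, st := A.next v nc.st x none }
  | some p =>
    { known := learn nc.known p.msgs
      st := A.next v nc.st x (some
        { msgs := p.msgs.map fun m => (learn nc.known p.msgs).idxOf m
          ctrl := p.ctrl }) }

/-- The configuration after `r` rounds, where `inp v` is the list of the broadcast messages given
to `v`, `G r` is the communication graph and `ω r v` the coin of node `v` in the round with index
`r` (so `G 0` belongs to the first round). -/
noncomputable def run (inp : Fin n → List M) (G : ℕ → SimpleGraph (Fin n))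
    (ω : ℕ → Fin n → A.Coin) : ℕ → Fin n → NodeConfig A.State M
  | 0 => fun v => { known := inp v, st := A.init v (inp v).length }
  | r + 1 => fun v =>
    updateNode A v (run inp G ω r v) (ω r v)
      (reception (G r) (transmission A (run inp G ω r) (ω r)) v)

/-- The law of all the coins: they are independent with law `A.law`. -/
noncomputable def coinMeasure : @Measure (ℕ → Fin n → A.Coin)
    (@MeasurableSpace.pi ℕ (fun _ => Fin n → A.Coin)
      fun _ => @MeasurableSpace.pi (Fin n) (fun _ => A.Coin) fun _ => ⊤) :=
  letI : MeasurableSpace A.Coin := ⊤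
  Measure.infinitePi fun _ : ℕ => Measure.pi fun _ : Fin n => A.law.toMeasure

end Execution

/-- The graph of the edges that are present in all the rounds `r, …, r + T - 1`. -/
def stableGraph {V : Type} (G : ℕ → SimpleGraph V) (r : ℕ) (T : ℕ∞) : SimpleGraph V where
  Adj u v := u ≠ v ∧ ∀ r' : ℕ, r ≤ r' → (r' : ℕ∞) < r + T → (G r').Adj u v
  symm := ⟨fun _ _ h => ⟨h.1.symm, fun r' h₁ h₂ => (h.2 r' h₁ h₂).symm⟩⟩
  loopless := ⟨fun _ h => h.1 rfl⟩

/-- The dynamic graph `G` is `T`-interval connected. -/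
def IntervalConnected {V : Type} (G : ℕ → SimpleGraph V) (T : ℕ∞) : Prop :=
  ∀ r : ℕ, (stableGraph G r T).Connected

/-- An adversary determines a dynamic graph from the random choices of the algorithm. It is
`τ`-oblivious if the graph of each round `r = 1, 2, …` is determined by the random choices of the
rounds `1, …, r - τ` (rounds are indexed from `0` here). -/
def IsOblivious {n : ℕ} {R : Type} (adv : (ℕ → Fin n → R) → ℕ → SimpleGraph (Fin n)) (τ : ℕ) :
    Prop :=
  ∀ (ω ω' : ℕ → Fin n → R) (r : ℕ),
    (∀ r' : ℕ, r' + τ ≤ r → ω r' = ω' r') → adv ω r = adv ω' r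

/-- An input of the `s`-multi-message broadcast problem: `s` distinct broadcast messages, each of
which is given to one node. -/
structure IsInput {n : ℕ} {M : Type} (inp : Fin n → List M) (s : ℕ) : Prop where
  nodup : ∀ v, (inp v).Nodup
  disjoint : ∀ u v, u ≠ v → (inp u).Disjoint (inp v)
  card : ∑ v, (inp v).length = s

/-- All nodes know all the broadcast messages. -/
def Disseminated {n : ℕ} {σ M : Type} (inp : Fin n → List M) (cfg : Fin n → NodeConfig σ M) :
    Prop :=
  ∀ u v : Fin n, ∀ m ∈ inp u, m ∈ (cfg v).known

/-- In every `T`-interval connected network controlled by a `τ`-oblivious adversary, `A` solves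
`s`-multi-message broadcast with messages of `B` bits within `t` rounds with probability at
least `p`. -/
def Solves {n : ℕ} (A : Algorithm n) (T : ℕ∞) (τ s B t : ℕ) (p : ℝ) : Prop :=
  ∀ (inp : Fin n → List (BitVec B)) (adv : (ℕ → Fin n → A.Coin) → ℕ → SimpleGraph (Fin n)),
    IsInput inp s → IsOblivious adv τ → (∀ ω, IntervalConnected (adv ω) T) →
      p ≤ ((coinMeasure A) {ω | Disseminated inp (run A inp (adv ω) ω t)}).toReal

end RadioNetwork

/-!
In a harmonic broadcast every informed node transmits with probability `1 / (1 + ⌊a / Θ⌋)`, where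
`a` is the number of rounds since it was informed. Its transmissions have expected number about
`Θ log a` over time, so that few rounds are busy in the sense that more than `1 / 2` transmissions
are expected in them. In a free round a node that transmits is alone with constant probability,
whatever the graph of the round is. If at least half of the rounds since the wake-up of `v` are
free, then their number is so large that `v` is alone at some point, up to probability
`exp (-Θ / 8)`; from then on its stable neighbors are informed. Hence as long as some node of the
connected stable graph is not informed, at least half of the rounds are busy, and since they are
few, the broadcast ends after `O(k log² n)` rounds with at least `k` informed nodes.

For unit capacity, run the broadcasts of all `s` messages in parallel: the `n * s` pairs of a node
and a message are the agents that compete for the channel, which takes `O(n s log² n)` rounds. If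
`s` is at least `c * n`, the deterministic round robin is already fast enough.

For larger capacities, run many broadcasts one after the other, with every node a source with
probability `1 / (2 n + 1)`. If the messages of a class are known to `k` nodes, then a broadcast has
a lone source that knows them with probability about `k / n`, and `O(n log n / k)` broadcasts of
length `O(k log² n)` suffice to double `k`. All classes double in the same `O(n log³ n)` rounds, and
there are `log n` doublings. Messages that do not fit in one packet are split into random chunks or
into epochs, which costs the factor `1 + s / c`.

The adversary sees the coins of a round before it chooses the graph, but being the only node to
transmit depends on the coins alone. Its success probabilities depend on the history through the
wake-up rounds, and an exponential supermartingale bounds the probability that there is no success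
although they add up to a large number.
-/

namespace RadioNetwork

section Resampling

variable {ι : Type*} [DecidableEq ι] {X : ι → Type*} [∀ i, MeasurableSpace (X i)]
  (μ : ∀ i, Measure (X i)) [∀ i, IsProbabilityMeasure (μ i)]

theorem map_update_infinitePi_prod (j : ι) :
    ((Measure.infinitePi μ).prod (μ j)).map (fun p => Function.update p.1 j p.2) =
      Measure.infinitePi μ := by
  refine Measure.eq_infinitePi _ fun s t ht => ?_
  rw [Measure.map_apply measurable_update' (.pi s.countable_toSet fun i _ => ht i)]
  have hpreimage : (fun p : (∀ i, X i) × X j => Function.update p.1 j p.2) ⁻¹' (s : Set ι).pi t =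
      ((s.erase j : Finset ι) : Set ι).pi t ×ˢ {x | j ∈ s → x ∈ t j} := by
    ext p
    simp only [Set.mem_preimage, Set.mem_pi, Finset.mem_coe, Set.mem_prod, Finset.mem_erase,
      Set.mem_ofPred_eq]
    rw [← Function.forall_update_iff (f := p.1) (a := j) (b := p.2)
      (p := fun i x => i ∈ s → x ∈ t i) |>.trans and_comm |>.trans (and_congr_left' ?_)]
    grind
  rw [hpreimage, Measure.prod_prod, Measure.infinitePi_pi _ fun i _ => ht i]
  by_cases hj : j ∈ s
  · simp only [hj, true_imp_iff]
    rw [mul_comm]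
    exact Finset.mul_prod_erase s (fun i => μ i (t i)) hj
  · simp [hj]

theorem lintegral_infinitePi_update (j : ι) {f : (∀ i, X i) → ENNReal} (hf : Measurable f) :
    ∫⁻ ω, f ω ∂Measure.infinitePi μ =
      ∫⁻ ω, ∫⁻ x, f (Function.update ω j x) ∂μ j ∂Measure.infinitePi μ := by
  conv_lhs => rw [← map_update_infinitePi_prod μ j]
  rw [lintegral_map hf measurable_update']
  exact lintegral_prod _ (hf.comp measurable_update').aemeasurable

end Resampling

section PartialSums

variable {a : ℕ → ℝ} {b : ℝ}

theorem monotone_sum_range (ha : ∀ r, 0 ≤ a r) : Monotone fun t => ∑ r ∈ Finset.range t, a r :=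
  fun _ _ h => Finset.sum_le_sum_of_subset_of_nonneg (Finset.range_mono h) fun _ _ _ => ha _

theorem le_sum_range_ite_sum_range_lt (ha : ∀ r, 0 ≤ a r) {t T : ℕ} (htT : t ≤ T)
    (h : b ≤ ∑ r ∈ Finset.range t, a r) :
    b ≤ ∑ r ∈ Finset.range T, if ∑ i ∈ Finset.range r, a i < b then a r else 0 := by
  have hex : ∃ t, b ≤ ∑ r ∈ Finset.range t, a r := ⟨t, h⟩
  calc b ≤ ∑ r ∈ Finset.range (Nat.find hex), a r := Nat.find_spec hex
    _ = ∑ r ∈ Finset.range (Nat.find hex), if ∑ i ∈ Finset.range r, a i < b then a r else 0 :=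
        Finset.sum_congr rfl fun r hr =>
          (if_pos (not_le.1 (Nat.find_min hex (Finset.mem_range.1 hr)))).symm
    _ ≤ _ := monotone_sum_range (fun r => by split_ifs <;> simp [ha])
        ((Nat.find_min' hex h).trans htT)

end PartialSums

section AdaptedSuccess

variable {X : ℕ → Type*} {q : (∀ r, X r) → ℕ → ℝ} {S : (∀ r, X r) → ℕ → Prop}

theorem measurable_of_dependsOn {ι β : Type*} {X : ι → Type*} [∀ i, MeasurableSpace (X i)]
    [∀ i, Countable (X i)] [∀ i, MeasurableSingletonClass (X i)] [MeasurableSpace β] [Nonempty β]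
    {f : (∀ i, X i) → β} {s : Set ι} [Finite s] (hf : DependsOn f s) : Measurable f := by
  obtain ⟨g, rfl⟩ := dependsOn_iff_exists_comp.1 hf
  exact (measurable_of_countable g).comp (measurable_pi_lambda _ fun i => measurable_pi_apply _)

theorem dependsOn_sum_range (hq : ∀ r, DependsOn (fun ω => q ω r) (Set.Iio r)) (t : ℕ) :
    DependsOn (fun ω => ∑ r ∈ Finset.range t, q ω r) (Set.Iio t) := fun _ _ h =>
  Finset.sum_congr rfl fun r hr => hq r fun i hi => h i (lt_trans hi (Finset.mem_range.1 hr))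

/-- The event that there is no success in the rounds `0, …, t - 1`. -/
def noSuccessBefore (S : (∀ r, X r) → ℕ → Prop) (t : ℕ) : Set (∀ r, X r) :=
  {ω | ∀ r < t, ¬ S ω r}

theorem mem_noSuccessBefore_congr (hS : ∀ r, DependsOn (fun ω => S ω r) (Set.Iic r)) {t : ℕ}
    {ω ω' : ∀ r, X r} (h : ∀ i ∈ Set.Iio t, ω i = ω' i) :
    ω ∈ noSuccessBefore S t ↔ ω' ∈ noSuccessBefore S t :=
  forall₂_congr fun r hr => not_congr <| iff_of_eq <| hS r fun i hi => h i (lt_of_le_of_lt hi hr)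

/-- The exponential supermartingale of a process of successes `S` whose conditional probabilities
are at least `q`: it is `exp (q 0 + ⋯ + q (t - 1))` as long as there has been no success, and `0`
afterwards. -/
noncomputable def survivalWeight (q : (∀ r, X r) → ℕ → ℝ) (S : (∀ r, X r) → ℕ → Prop) (t : ℕ) :
    (∀ r, X r) → ENNReal :=
  (noSuccessBefore S t).indicator fun ω => ENNReal.ofReal (Real.exp (∑ r ∈ Finset.range t, q ω r))

theorem dependsOn_survivalWeight (hq : ∀ r, DependsOn (fun ω => q ω r) (Set.Iio r))
    (hS : ∀ r, DependsOn (fun ω => S ω r) (Set.Iic r)) (t : ℕ) :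
    DependsOn (survivalWeight q S t) (Set.Iio t) := fun ω ω' h => by
  have hsum : ∑ r ∈ Finset.range t, q ω r = ∑ r ∈ Finset.range t, q ω' r :=
    dependsOn_sum_range hq t h
  classical
  simp only [survivalWeight, Set.indicator_apply, hsum]
  exact if_congr (mem_noSuccessBefore_congr hS h) rfl rfl

theorem survivalWeight_succ_update (hq : ∀ r, DependsOn (fun ω => q ω r) (Set.Iio r))
    (hS : ∀ r, DependsOn (fun ω => S ω r) (Set.Iic r)) (t : ℕ) (ω : ∀ r, X r) (x : X t) :
    survivalWeight q S (t + 1) (Function.update ω t x) =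
      survivalWeight q S t ω * ENNReal.ofReal (Real.exp (q ω t)) *
        Set.indicator {x | ¬ S (Function.update ω t x) t} 1 x := by
  have hpast : ∀ i ∈ Set.Iio t, Function.update ω t x i = ω i := fun i hi =>
    Function.update_of_ne (Set.mem_Iio.1 hi).ne _ _
  have hsum : ∑ r ∈ Finset.range t, q (Function.update ω t x) r = ∑ r ∈ Finset.range t, q ω r :=
    dependsOn_sum_range hq t hpast
  have hlast : q (Function.update ω t x) t = q ω t := hq t hpast
  have hmem : Function.update ω t x ∈ noSuccessBefore S (t + 1) ↔
      ω ∈ noSuccessBefore S t ∧ ¬ S (Function.update ω t x) t :=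
    Nat.forall_lt_succ_right.trans (and_congr_left' (mem_noSuccessBefore_congr hS hpast))
  by_cases h₁ : ω ∈ noSuccessBefore S t <;> by_cases h₂ : S (Function.update ω t x) t <;>
    simp [survivalWeight, Set.indicator, hmem, h₁, h₂, Finset.sum_range_succ, hsum, hlast,
      Real.exp_add, ENNReal.ofReal_mul (Real.exp_pos _).le]

variable [∀ r, MeasurableSpace (X r)] [∀ r, Countable (X r)] [∀ r, MeasurableSingletonClass (X r)]
  (μ : ∀ r, Measure (X r)) [∀ r, IsProbabilityMeasure (μ r)]

theorem measurable_survivalWeight (hq : ∀ r, DependsOn (fun ω => q ω r) (Set.Iio r))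
    (hS : ∀ r, DependsOn (fun ω => S ω r) (Set.Iic r)) (t : ℕ) :
    Measurable (survivalWeight q S t) :=
  measurable_of_dependsOn (dependsOn_survivalWeight hq hS t)

theorem ofReal_exp_mul_measure_compl_le_one {Ω : Type*} [MeasurableSpace Ω] (ν : Measure Ω)
    [IsProbabilityMeasure ν] {s : Set Ω} (hs : MeasurableSet s) {p : ℝ}
    (hp : ENNReal.ofReal p ≤ ν s) : ENNReal.ofReal (Real.exp p) * ν sᶜ ≤ 1 := by
  have hcompl : ν sᶜ ≤ ENNReal.ofReal (1 - p) := by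
    rw [prob_compl_eq_one_sub hs]
    rcases le_or_gt 0 p with h | h
    · rw [ENNReal.ofReal_sub _ h, ENNReal.ofReal_one]
      exact tsub_le_tsub_left hp _
    · exact tsub_le_self.trans (ENNReal.one_le_ofReal.2 (by linarith))
  calc ENNReal.ofReal (Real.exp p) * ν sᶜ
      ≤ ENNReal.ofReal (Real.exp p) * ENNReal.ofReal (Real.exp (-p)) := by
        gcongr
        exact hcompl.trans (ENNReal.ofReal_le_ofReal (Real.one_sub_le_exp_neg p))
    _ = 1 := by rw [← ENNReal.ofReal_mul (Real.exp_pos _).le, ← Real.exp_add]; simp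

theorem lintegral_survivalWeight_le_one (hq : ∀ r, DependsOn (fun ω => q ω r) (Set.Iio r))
    (hS : ∀ r, DependsOn (fun ω => S ω r) (Set.Iic r))
    (hle : ∀ ω r, ENNReal.ofReal (q ω r) ≤ μ r {x | S (Function.update ω r x) r}) (t : ℕ) :
    ∫⁻ ω, survivalWeight q S t ω ∂Measure.infinitePi μ ≤ 1 := by
  induction t with
  | zero => simp [survivalWeight, noSuccessBefore]
  | succ t ih =>
    refine le_trans ?_ ih
    rw [lintegral_infinitePi_update μ t (measurable_survivalWeight hq hS (t + 1))]
    refine lintegral_mono fun ω => ?_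
    have hmeas (s : Set (X t)) : MeasurableSet s := s.to_countable.measurableSet
    simp_rw [survivalWeight_succ_update hq hS]
    rw [lintegral_const_mul _ (measurable_one.indicator (hmeas _)),
      lintegral_indicator_one (hmeas _), mul_assoc]
    exact mul_le_of_le_one_right' (ofReal_exp_mul_measure_compl_le_one (μ t) (hmeas _) (hle ω t))

theorem measure_no_success_le_of_fixed_time (hq : ∀ r, DependsOn (fun ω => q ω r) (Set.Iio r))
    (hS : ∀ r, DependsOn (fun ω => S ω r) (Set.Iic r))
    (hle : ∀ ω r, ENNReal.ofReal (q ω r) ≤ μ r {x | S (Function.update ω r x) r})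
    (lam : ℝ) (T : ℕ) :
    Measure.infinitePi μ {ω | ω ∈ noSuccessBefore S T ∧ lam ≤ ∑ r ∈ Finset.range T, q ω r} ≤
      ENNReal.ofReal (Real.exp (-lam)) := by
  have hsub : {ω | ω ∈ noSuccessBefore S T ∧ lam ≤ ∑ r ∈ Finset.range T, q ω r} ⊆
      {ω | ENNReal.ofReal (Real.exp lam) ≤ survivalWeight q S T ω} := by
    rintro ω ⟨hnone, hsum⟩
    rw [Set.mem_ofPred_eq, survivalWeight, Set.indicator_of_mem hnone]
    exact ENNReal.ofReal_le_ofReal (Real.exp_le_exp.2 hsum)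
  rw [Real.exp_neg, ENNReal.ofReal_inv_of_pos (Real.exp_pos _), ENNReal.le_inv_iff_mul_le, mul_comm]
  calc ENNReal.ofReal (Real.exp lam) * _
      ≤ ENNReal.ofReal (Real.exp lam) *
          Measure.infinitePi μ {ω | ENNReal.ofReal (Real.exp lam) ≤ survivalWeight q S T ω} := by
        gcongr
    _ ≤ _ := mul_meas_ge_le_lintegral (measurable_survivalWeight hq hS T) _
    _ ≤ 1 := lintegral_survivalWeight_le_one μ hq hS hle T

-- The process is stopped when the values of `q` have added up to `lam`.
theorem measure_no_success_le (hq : ∀ r, DependsOn (fun ω => q ω r) (Set.Iio r))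
    (hS : ∀ r, DependsOn (fun ω => S ω r) (Set.Iic r)) (hq0 : ∀ ω r, 0 ≤ q ω r)
    (hle : ∀ ω r, ENNReal.ofReal (q ω r) ≤ μ r {x | S (Function.update ω r x) r})
    (lam : ℝ) (T : ℕ) :
    Measure.infinitePi μ
        {ω | ∃ t ≤ T, ω ∈ noSuccessBefore S t ∧ lam ≤ ∑ r ∈ Finset.range t, q ω r} ≤
      ENNReal.ofReal (Real.exp (-lam)) := by
  classical
  have hsum := dependsOn_sum_range hq
  refine (measure_mono ?_).trans (measure_no_success_le_of_fixed_time μ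
    (q := fun ω r => if ∑ i ∈ Finset.range r, q ω i < lam then q ω r else 0)
    (S := fun ω r => S ω r ∧ ∑ i ∈ Finset.range r, q ω i < lam)
    (fun r ω ω' h => ?_) (fun r ω ω' h => ?_) (fun ω r => ?_) lam T)
  · rintro ω ⟨t, htT, hnone, hlam⟩
    have hlt {r : ℕ} (hr : ∑ i ∈ Finset.range r, q ω i < lam) : r < t :=
      (monotone_sum_range (hq0 ω)).reflect_lt (hr.trans_le hlam)
    exact ⟨fun r _ hr => hnone r (hlt hr.2) hr.1,
      le_sum_range_ite_sum_range_lt (hq0 ω) htT hlam⟩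
  · simp only [hsum r h, hq r h]
  · simp only [hsum r fun i hi => h i (Set.mem_Iio.1 hi).le, hS r h]
  · have hupdate : ∀ x, ∑ i ∈ Finset.range r, q (Function.update ω r x) i =
        ∑ i ∈ Finset.range r, q ω i := fun x =>
      hsum r fun i hi => Function.update_of_ne (Set.mem_Iio.1 hi).ne _ _
    simp only [hupdate]
    split_ifs with h
    · simpa [h] using hle ω r
    · simp

end AdaptedSuccess

section ProductInequalities

theorem one_sub_sum_le_prod_one_sub {ι : Type*} (s : Finset ι) (f : ι → ℝ)
    (h0 : ∀ i ∈ s, 0 ≤ f i) (h1 : ∀ i ∈ s, f i ≤ 1) :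
    1 - ∑ i ∈ s, f i ≤ ∏ i ∈ s, (1 - f i) := by
  classical
  induction s using Finset.induction_on with
  | empty => simp
  | insert a s ha ih =>
    rw [Finset.forall_mem_insert] at h0 h1
    rw [Finset.sum_insert ha, Finset.prod_insert ha]
    have hsum : 0 ≤ ∑ i ∈ s, f i := Finset.sum_nonneg h0.2
    nlinarith [mul_le_mul_of_nonneg_left (ih h0.2 h1.2) (sub_nonneg.2 h1.1), h0.1,
      mul_nonneg h0.1 hsum]

theorem mul_one_sub_sum_le_prod_ite {ι : Type*} [Fintype ι] [DecidableEq ι] (f : ι → ℝ) (i : ι)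
    (h0 : ∀ j, 0 ≤ f j) (h1 : ∀ j, f j ≤ 1) :
    f i * (1 - ∑ j, f j) ≤ ∏ j, if j = i then f j else 1 - f j := by
  rw [← Finset.mul_prod_erase Finset.univ _ (Finset.mem_univ i), if_pos rfl]
  refine mul_le_mul_of_nonneg_left ?_ (h0 i)
  calc 1 - ∑ j, f j ≤ 1 - ∑ j ∈ Finset.univ.erase i, f j := by
        rw [← Finset.add_sum_erase Finset.univ f (Finset.mem_univ i)]
        linarith [h0 i]
    _ ≤ ∏ j ∈ Finset.univ.erase i, (1 - f j) :=
        one_sub_sum_le_prod_one_sub _ _ (fun j _ => h0 j) fun j _ => h1 j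
    _ = _ := Finset.prod_congr rfl fun j hj => (if_neg (Finset.ne_of_mem_erase hj)).symm

theorem half_le_one_sub_inv_pow (n : ℕ) : (1 : ℝ) / 2 ≤ (1 - 1 / (2 * n + 1)) ^ (n - 1) := by
  have hinv : 1 / (2 * n + 1 : ℝ) ≤ 1 := by
    rw [div_le_one (by positivity)]
    linarith [(Nat.cast_nonneg n : (0 : ℝ) ≤ n)]
  have hpred : ((n - 1 : ℕ) : ℝ) ≤ n := by exact_mod_cast Nat.sub_le n 1
  calc (1 : ℝ) / 2 ≤ 1 + ((n - 1 : ℕ) : ℝ) * (-(1 / (2 * n + 1))) := by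
        rw [mul_neg, mul_one_div, ← sub_eq_add_neg, le_sub_comm, div_le_iff₀ (by positivity)]
        linarith
    _ ≤ (1 + -(1 / (2 * n + 1))) ^ (n - 1) := one_add_mul_le_pow (by linarith) _
    _ = _ := by rw [← sub_eq_add_neg]

end ProductInequalities

section RoundProb

/-- The probability of an event `S` that is determined by the coins of a single round of `n` nodes,
each of which draws its coin according to `law`. -/
noncomputable def roundProb {C : Type} (law : PMF C) (n : ℕ) (S : Set (Fin n → C)) : ℝ :=
  letI : MeasurableSpace C := ⊤
  (Measure.pi fun _ : Fin n => law.toMeasure).real S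

theorem coinMeasure_no_success_le {n : ℕ} (A : Algorithm n)
    {q : (ℕ → Fin n → A.Coin) → ℕ → ℝ} {S : (ℕ → Fin n → A.Coin) → ℕ → Prop}
    (hq : ∀ r, DependsOn (fun ω => q ω r) (Set.Iio r))
    (hS : ∀ r, DependsOn (fun ω => S ω r) (Set.Iic r)) (hq0 : ∀ ω r, 0 ≤ q ω r)
    (hle : ∀ ω r, q ω r ≤ roundProb A.law n {x | S (Function.update ω r x) r})
    (lam : ℝ) (T : ℕ) :
    coinMeasure A
        {ω | ∃ t ≤ T, ω ∈ noSuccessBefore S t ∧ lam ≤ ∑ r ∈ Finset.range t, q ω r} ≤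
      ENNReal.ofReal (Real.exp (-lam)) := by
  let _ : MeasurableSpace A.Coin := ⊤
  have : MeasurableSingletonClass A.Coin := ⟨fun _ => trivial⟩
  have := A.coinFintype
  refine measure_no_success_le (fun _ => Measure.pi fun _ : Fin n => A.law.toMeasure) hq hS hq0
    (fun ω r => (ENNReal.ofReal_le_ofReal (hle ω r)).trans ?_) lam T
  rw [roundProb, measureReal_def, ENNReal.ofReal_toReal (measure_ne_top _ _)]

variable {C : Type}

theorem roundProb_mono [Finite C] (law : PMF C) (n : ℕ) {S S' : Set (Fin n → C)} (h : S ⊆ S') :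
    roundProb law n S ≤ roundProb law n S' := by
  let _ : MeasurableSpace C := ⊤
  exact measureReal_mono h

theorem roundProb_nonneg (law : PMF C) (n : ℕ) (S : Set (Fin n → C)) : 0 ≤ roundProb law n S := by
  let _ : MeasurableSpace C := ⊤
  exact measureReal_nonneg

theorem roundProb_biUnion [Finite C] (law : PMF C) (n : ℕ) {ι : Type*} (s : Finset ι)
    (S : ι → Set (Fin n → C)) (h : (s : Set ι).PairwiseDisjoint S) :
    roundProb law n (⋃ i ∈ s, S i) = ∑ i ∈ s, roundProb law n (S i) := by
  let _ : MeasurableSpace C := ⊤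
  have : MeasurableSingletonClass C := ⟨fun _ => trivial⟩
  exact measureReal_biUnion_finset h fun i _ => (Set.toFinite _).measurableSet

variable [Fintype C] [Nonempty C]

theorem roundProb_uniform_forall_mem {n : ℕ} (B : Fin n → Finset C) :
    roundProb (PMF.uniformOfFintype C) n {x | ∀ v, x v ∈ B v} =
      ∏ v, ((B v).card : ℝ) / Fintype.card C := by
  let _ : MeasurableSpace C := ⊤
  have : MeasurableSingletonClass C := ⟨fun _ => trivial⟩
  have hpi : {x | ∀ v, x v ∈ B v} = Set.univ.pi fun v => (B v : Set C) := by
    ext x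
    simp
  rw [hpi, roundProb, measureReal_def, Measure.pi_pi, ENNReal.toReal_prod]
  refine Finset.prod_congr rfl fun v _ => ?_
  rw [PMF.toMeasure_uniformOfFintype_apply _ (Set.toFinite _).measurableSet, ENNReal.toReal_div,
    ENNReal.toReal_natCast, ENNReal.toReal_natCast]
  simp

theorem roundProb_uniform_exists_lone {n : ℕ} (s : Finset (Fin n)) {E : Finset C}
    {F : Fin n → Finset C} (hF : ∀ v, F v ⊆ E) :
    roundProb (PMF.uniformOfFintype C) n {x | ∃ v ∈ s, x v ∈ F v ∧ ∀ u, u ≠ v → x u ∉ E} =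
      ∑ v ∈ s, ((F v).card : ℝ) / Fintype.card C *
        (1 - (E.card : ℝ) / Fintype.card C) ^ (n - 1) := by
  classical
  let B (v u : Fin n) : Finset C := if u = v then F v else Eᶜ
  have hB (v : Fin n) (x : Fin n → C) :
      (∀ u, x u ∈ B v u) ↔ x v ∈ F v ∧ ∀ u, u ≠ v → x u ∉ E := by
    refine ⟨fun h => ⟨by simpa [B] using h v, fun u hu => by simpa [B, hu] using h u⟩, ?_⟩
    rintro ⟨hv, hne⟩ u
    by_cases hu : u = v
    · simpa [B, hu] using hv
    · simpa [B, hu] using hne u hu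
  have hunion : {x : Fin n → C | ∃ v ∈ s, x v ∈ F v ∧ ∀ u, u ≠ v → x u ∉ E} =
      ⋃ v ∈ s, {x | ∀ u, x u ∈ B v u} := by
    ext x
    simp only [Set.mem_ofPred_eq, Set.mem_iUnion, exists_prop, hB]
  have hdisjoint : (s : Set (Fin n)).PairwiseDisjoint fun v => {x : Fin n → C | ∀ u, x u ∈ B v u} :=
    fun v _ w _ hvw => Set.disjoint_left.2 fun x hv hw =>
      ((hB w x).1 hw).2 v hvw (hF v ((hB v x).1 hv).1)
  rw [hunion, roundProb_biUnion _ _ _ _ hdisjoint]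
  refine Finset.sum_congr rfl fun v _ => ?_
  have hcompl : ∀ u ∈ Finset.univ.erase v, ((B v u).card : ℝ) / Fintype.card C =
      1 - (E.card : ℝ) / Fintype.card C := fun u hu => by
    have hC : (Fintype.card C : ℝ) ≠ 0 := by exact_mod_cast Fintype.card_ne_zero
    rw [show B v u = Eᶜ from if_neg (Finset.ne_of_mem_erase hu), Finset.card_compl,
      Nat.cast_sub (Finset.card_le_univ E), sub_div, div_self hC]
  rw [roundProb_uniform_forall_mem, ← Finset.mul_prod_erase Finset.univ _ (Finset.mem_univ v),
    Finset.prod_congr rfl hcompl, Finset.prod_const, Finset.card_erase_of_mem (Finset.mem_univ v),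
    Finset.card_fin, show B v v = F v from if_pos rfl]

end RoundProb

section SlotCoin

/-- The coin of a node in the algorithms below: a number from `Fin N` for each of `σ` slots, which
decides whether the slot transmits, and an element of `D` for all other purposes. -/
abbrev SlotCoin (σ N : ℕ) (D : Type) : Type := (Fin σ → Fin N) × D

theorem card_univ_product_div {α β : Type*} [Fintype α] [Nonempty α] [Fintype β] (E : Finset β) :
    (((Finset.univ : Finset α) ×ˢ E).card : ℝ) / Fintype.card (α × β) =
      (E.card : ℝ) / Fintype.card β := by
  rw [Finset.card_product, Finset.card_univ, Fintype.card_prod, Nat.cast_mul, Nat.cast_mul,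
    mul_div_mul_left _ _ (by exact_mod_cast Fintype.card_ne_zero)]

theorem card_product_univ_div {α β : Type*} [Fintype α] [Fintype β] [Nonempty β] (E : Finset α) :
    ((E ×ˢ (Finset.univ : Finset β)).card : ℝ) / Fintype.card (α × β) =
      (E.card : ℝ) / Fintype.card α := by
  rw [Finset.card_product, Finset.card_univ, Fintype.card_prod, Nat.cast_mul, Nat.cast_mul,
    mul_div_mul_right _ _ (by exact_mod_cast Fintype.card_ne_zero)]

theorem card_filter_lt_iff_div {N t : ℕ} [NeZero N] (ht : t ≤ N) (p : Prop) [Decidable p] :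
    ((Finset.univ.filter fun y : Fin N => y.val < t ↔ p).card : ℝ) / N =
      if p then (t : ℝ) / N else 1 - (t : ℝ) / N := by
  have hlt : (Finset.univ.filter fun y : Fin N => y.val < t).card = t := by
    rw [Fin.card_filter_val_lt, min_eq_right ht]
  split_ifs with hp
  · simp only [hp, iff_true, hlt]
  · have hN : (N : ℝ) ≠ 0 := by exact_mod_cast NeZero.ne N
    simp only [hp, iff_false]
    rw [Finset.filter_not, Finset.card_sdiff_of_subset (Finset.filter_subset _ _), hlt,
      Finset.card_fin, Nat.cast_sub ht, sub_div, div_self hN]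

variable {σ N : ℕ} [NeZero N]

theorem le_roundProb_only_slot {D : Type} [Fintype D] [Nonempty D] {n : ℕ}
    {th : Fin n → Fin σ → ℕ} (hth : ∀ u i, th u i ≤ N) (v : Fin n) (k : Fin σ) :
    (th v k : ℝ) / N * (1 - ∑ u, ∑ i, (th u i : ℝ) / N) ≤
      roundProb (PMF.uniformOfFintype (SlotCoin σ N D)) n
        {x | ∀ u i, ((x u).1 i).val < th u i ↔ u = v ∧ i = k} := by
  have hN : (0 : ℝ) < N := by exact_mod_cast Nat.pos_of_ne_zero (NeZero.ne N)
  let F (u : Fin n) (i : Fin σ) : Finset (Fin N) :=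
    Finset.univ.filter fun y => y.val < th u i ↔ (u, i) = (v, k)
  have hevent : {x : Fin n → SlotCoin σ N D | ∀ u i, ((x u).1 i).val < th u i ↔ u = v ∧ i = k} =
      {x | ∀ u, x u ∈ Fintype.piFinset (F u) ×ˢ (Finset.univ : Finset D)} := by
    ext x
    simp [F]
  have hprob (u : Fin n) : ((Fintype.piFinset (F u)).card : ℝ) / Fintype.card (Fin σ → Fin N) =
      ∏ i, if (u, i) = (v, k) then (th u i : ℝ) / N else 1 - (th u i : ℝ) / N := by
    rw [Fintype.card_piFinset, Fintype.card_pi, Nat.cast_prod, Nat.cast_prod,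
      ← Finset.prod_div_distrib]
    exact Finset.prod_congr rfl fun i _ => by
      rw [Fintype.card_fin, card_filter_lt_iff_div (hth u i)]
  rw [hevent, roundProb_uniform_forall_mem]
  simp only [card_product_univ_div, hprob]
  rw [← Fintype.prod_prod_type', ← Fintype.sum_prod_type' (f := fun u i => (th u i : ℝ) / N)]
  exact mul_one_sub_sum_le_prod_ite (fun a : Fin n × Fin σ => (th a.1 a.2 : ℝ) / N) (v, k)
    (fun a => by positivity) fun a => div_le_one_of_le₀ (by exact_mod_cast hth _ _) hN.le

theorem le_roundProb_lone_source (n g : ℕ) (s : Finset (Fin n)) (j : Fin n → Fin (g + 1)) :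
    (s.card : ℝ) / (2 * (2 * n + 1) * (g + 1)) ≤
      roundProb (PMF.uniformOfFintype (SlotCoin σ N (Fin (2 * n + 1) × Fin (g + 1)))) n
        {x | ∃ v ∈ s, (x v).2 = (0, j v) ∧ ∀ u, u ≠ v → (x u).2.1 ≠ 0} := by
  let F (v : Fin n) : Finset (SlotCoin σ N (Fin (2 * n + 1) × Fin (g + 1))) :=
    Finset.univ ×ˢ {(0, j v)}
  let E : Finset (SlotCoin σ N (Fin (2 * n + 1) × Fin (g + 1))) :=
    Finset.univ ×ˢ ({0} ×ˢ Finset.univ)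
  have hevent : {x : Fin n → SlotCoin σ N (Fin (2 * n + 1) × Fin (g + 1)) |
        ∃ v ∈ s, (x v).2 = (0, j v) ∧ ∀ u, u ≠ v → (x u).2.1 ≠ 0} =
      {x | ∃ v ∈ s, x v ∈ F v ∧ ∀ u, u ≠ v → x u ∉ E} := by
    simp only [F, E, Finset.mem_product, Finset.mem_univ, Finset.mem_singleton, true_and, and_true,
      ne_eq]
  have hF (v : Fin n) : F v ⊆ E := by
    simp only [F, E]
    exact Finset.product_subset_product_right (by simp)
  rw [hevent, roundProb_uniform_exists_lone s hF, ← nsmul_one, ← Finset.sum_const, Finset.sum_div]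
  refine Finset.sum_le_sum fun v _ => ?_
  rw [card_univ_product_div, card_univ_product_div, card_product_univ_div]
  simp only [Finset.card_singleton, Fintype.card_prod, Fintype.card_fin, Nat.cast_one]
  push_cast
  calc 1 / (2 * (2 * n + 1) * (g + 1) : ℝ) = 1 / ((2 * n + 1) * (g + 1)) * (1 / 2) := by
        field_simp
    _ ≤ _ := mul_le_mul_of_nonneg_left (half_le_one_sub_inv_pow n) (by positivity)

end SlotCoin

section Learn

variable {M : Type} [DecidableEq M]

theorem prefix_learn (l ms : List M) : l <+: learn l ms := by
  induction ms generalizing l with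
  | nil => exact List.prefix_rfl
  | cons m ms ih =>
    rw [learn]
    split_ifs
    · exact ih l
    · exact (List.prefix_append l [m]).trans (ih _)

theorem mem_learn {l ms : List M} {m : M} : m ∈ learn l ms ↔ m ∈ l ∨ m ∈ ms := by
  induction ms generalizing l with
  | nil => simp [learn]
  | cons a ms ih =>
    rw [learn, ih, List.mem_cons]
    split_ifs with ha
    · refine ⟨Or.imp_right Or.inr, ?_⟩
      rintro (hm | rfl | hm)
      exacts [Or.inl hm, Or.inl ha, Or.inr hm]
    · simp [or_assoc]

theorem nodup_learn {l : List M} (hl : l.Nodup) (ms : List M) : (learn l ms).Nodup := by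
  induction ms generalizing l with
  | nil => exact hl
  | cons a ms ih =>
    rw [learn]
    split_ifs with h
    exacts [ih hl, ih (by simpa using hl.concat h)]

theorem getElem?_of_prefix {α : Type*} {l l' : List α} (h : l <+: l') {i : ℕ} {m : α}
    (hi : l[i]? = some m) : l'[i]? = some m := by
  have hlt : i < l.length := (List.getElem?_eq_some_iff.1 hi).1
  rw [← hi, List.prefix_iff_getElem?.1 h i hlt, List.getElem?_eq_getElem hlt]

end Learn

section Reception

variable {n : ℕ} {M : Type} {G : SimpleGraph (Fin n)} {tr : Fin n → Option (Packet M)}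

theorem reception_of_sole_transmitter {u v : Fin n} {p : Packet M} (hv : tr v = some p)
    (hu : ∀ u, u ≠ v → tr u = none) (huv : G.Adj u v) : reception G tr u = some p := by
  have hsole (w : Fin n) (hw : tr w ≠ none) : w = v := not_imp_comm.1 (hu w) hw
  have hlistens : tr u = none ∧ ∃! w, G.Adj u w ∧ tr w ≠ none :=
    ⟨hu u huv.ne, v, ⟨huv, by simp [hv]⟩, fun w hw => hsole w hw.2⟩
  rw [reception, dif_pos hlistens, hsole _ hlistens.2.choose_spec.1.2, hv]

theorem exists_transmitter_of_reception {v : Fin n} {p : Packet M}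
    (h : reception G tr v = some p) : ∃ u, G.Adj v u ∧ tr u = some p := by
  rw [reception] at h
  split_ifs at h with hlistens
  exact ⟨_, hlistens.2.choose_spec.1.1, h⟩

end Reception

section Execution

variable {n : ℕ} {M : Type} (A : Algorithm n)

theorem transmission_eq_some {cfg : Fin n → NodeConfig A.State M} {x : Fin n → A.Coin} {v : Fin n}
    {p : Packet M} : transmission A cfg x v = some p ↔ ∃ p', A.send v (cfg v).st (x v) = some p' ∧
      p = { msgs := p'.msgs.filterMap fun i => (cfg v).known[i]?, ctrl := p'.ctrl } := by
  rw [transmission, Option.map_eq_some_iff]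
  exact exists_congr fun _ => and_congr_right fun _ => eq_comm

theorem transmission_eq_none {cfg : Fin n → NodeConfig A.State M} {x : Fin n → A.Coin}
    {v : Fin n} : transmission A cfg x v = none ↔ A.send v (cfg v).st (x v) = none := by
  rw [transmission, Option.map_eq_none_iff]

theorem mem_transmission_msgs {cfg : Fin n → NodeConfig A.State M} {x : Fin n → A.Coin}
    {v : Fin n} {p : Packet M} (h : transmission A cfg x v = some p) {m : M} (hm : m ∈ p.msgs) :
    m ∈ (cfg v).known := by
  obtain ⟨p', _, rfl⟩ := (transmission_eq_some A).1 h
  obtain ⟨i, _, hi⟩ := List.mem_filterMap.1 hm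
  exact List.mem_of_getElem? hi

theorem stableGraph_adj {V : Type} {G : ℕ → SimpleGraph V} {u v : V}
    (h : (stableGraph G 0 ⊤).Adj u v) (r : ℕ) : (G r).Adj u v :=
  h.2 r (Nat.zero_le r) (by simp)

theorem length_le_of_subset_inp {inp : Fin n → List M} {s : ℕ} (hinp : IsInput inp s) {l : List M}
    (hl : l.Nodup) (hsub : ∀ m ∈ l, ∃ u, m ∈ inp u) : l.length ≤ s := by
  classical
  have hunion : l.toFinset ⊆ Finset.univ.biUnion fun u => (inp u).toFinset := by
    simpa [Finset.subset_iff] using hsub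
  calc l.length = l.toFinset.card := (List.toFinset_card_of_nodup hl).symm
    _ ≤ _ := Finset.card_le_card hunion
    _ ≤ ∑ u, (inp u).toFinset.card := Finset.card_biUnion_le
    _ ≤ ∑ u, (inp u).length := Finset.sum_le_sum fun u _ => List.toFinset_card_le _
    _ = s := hinp.card

variable [DecidableEq M]

theorem updateNode_known_prefix (v : Fin n) (nc : NodeConfig A.State M) (x : A.Coin)
    (y : Option (Packet M)) : nc.known <+: (updateNode A v nc x y).known := by
  cases y with
  | none => exact List.prefix_rfl
  | some p => exact prefix_learn _ _

variable (inp : Fin n → List M) (G : ℕ → SimpleGraph (Fin n)) (ω : ℕ → Fin n → A.Coin)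

theorem run_succ (r : ℕ) (v : Fin n) : run A inp G ω (r + 1) v =
    updateNode A v (run A inp G ω r v) (ω r v)
      (reception (G r) (transmission A (run A inp G ω r) (ω r)) v) := rfl

theorem run_known_prefix {r r' : ℕ} (h : r ≤ r') (v : Fin n) :
    (run A inp G ω r v).known <+: (run A inp G ω r' v).known := by
  induction r', h using Nat.le_induction with
  | base => exact List.prefix_rfl
  | succ r' _ ih => exact ih.trans (updateNode_known_prefix A v _ _ _)

theorem run_known_nodup (h : ∀ v, (inp v).Nodup) (r : ℕ) (v : Fin n) :
    (run A inp G ω r v).known.Nodup := by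
  induction r with
  | zero => exact h v
  | succ r ih =>
    rw [run_succ]
    rcases reception (G r) (transmission A (run A inp G ω r) (ω r)) v with _ | p
    exacts [ih, nodup_learn ih _]

theorem exists_source_of_mem_known (r : ℕ) (v : Fin n) {m : M}
    (hm : m ∈ (run A inp G ω r v).known) : ∃ u, m ∈ inp u := by
  induction r generalizing v with
  | zero => exact ⟨v, hm⟩
  | succ r ih =>
    rw [run_succ] at hm
    cases hy : reception (G r) (transmission A (run A inp G ω r) (ω r)) v with
    | none =>
      rw [hy] at hm
      exact ih v hm
    | some p =>
      rw [hy] at hm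
      rcases mem_learn.1 hm with hknown | hnew
      · exact ih v hknown
      · obtain ⟨u, _, hu⟩ := exists_transmitter_of_reception hy
        exact ih u (mem_transmission_msgs A hu hnew)

theorem run_known_length_le {s : ℕ} (hinp : IsInput inp s) (r : ℕ) (v : Fin n) :
    (run A inp G ω r v).known.length ≤ s :=
  length_le_of_subset_inp hinp (run_known_nodup A inp G ω hinp.nodup r v)
    fun _ hm => exists_source_of_mem_known A inp G ω r v hm

theorem run_dependsOn {adv : (ℕ → Fin n → A.Coin) → ℕ → SimpleGraph (Fin n)}
    (hadv : IsOblivious adv 0) (r : ℕ) :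
    DependsOn (fun ω => run A inp (adv ω) ω r) (Set.Iio r) := by
  induction r with
  | zero => exact fun ω ω' _ => rfl
  | succ r ih =>
    intro ω ω' hω
    have hrun : run A inp (adv ω) ω r = run A inp (adv ω') ω' r :=
      ih fun i hi => hω i (hi.trans r.lt_succ_self)
    have hgraph : adv ω r = adv ω' r := hadv ω ω' r fun i hi => hω i (Nat.lt_succ_of_le hi)
    funext v
    simp only [run_succ, hrun, hgraph, hω r r.lt_succ_self]

theorem le_coinMeasure_of_compl_subset {S bad : Set (ℕ → Fin n → A.Coin)} {ε : ℝ} (hε : 0 ≤ ε)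
    (hsub : badᶜ ⊆ S) (hbad : coinMeasure A bad ≤ ENNReal.ofReal ε) :
    1 - ε ≤ (coinMeasure A S).toReal := by
  let _ : MeasurableSpace A.Coin := ⊤
  have hP : IsProbabilityMeasure (coinMeasure A) :=
    inferInstanceAs (IsProbabilityMeasure
      (Measure.infinitePi fun _ : ℕ => Measure.pi fun _ : Fin n => A.law.toMeasure))
  have hbad' : (coinMeasure A).real bad ≤ ε := ENNReal.toReal_le_of_le_ofReal hε hbad
  have hcover : (coinMeasure A).real Set.univ ≤ (coinMeasure A).real (S ∪ bad) :=
    measureReal_mono fun ω _ => (Classical.em (ω ∈ bad)).symm.imp_left fun h => hsub h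
  rw [probReal_univ] at hcover
  linarith [measureReal_union_le S bad (μ := coinMeasure A), measureReal_def (coinMeasure A) S]

end Execution

section Wake

/-- In the rounds `t₀, …, T - 1`, `f` is the wake-up round of an agent, and `none` until then. -/
def IsWake (f : ℕ → Option ℕ) (t₀ T : ℕ) : Prop :=
  ∃ w, t₀ ≤ w ∧ ∀ r, t₀ ≤ r → r < T → f r = if w ≤ r then some w else none

variable {f : ℕ → Option ℕ} {t₀ T : ℕ}

theorem isWake_of_step (hstart : f t₀ = none ∨ f t₀ = some t₀)
    (hstep : ∀ r, t₀ ≤ r → r + 1 < T →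
      f (r + 1) = f r ∨ f r = none ∧ f (r + 1) = some (r + 1)) : IsWake f t₀ T := by
  induction T with
  | zero => exact ⟨t₀, le_rfl, fun r _ hr => absurd hr r.not_lt_zero⟩
  | succ T ih =>
    rcases lt_trichotomy T t₀ with hT | rfl | hT
    · exact ⟨t₀, le_rfl, fun r _ _ => by omega⟩
    · rcases hstart with h | h
      · refine ⟨T + 1, T.le_succ, fun r _ _ => ?_⟩
        rw [if_neg (by omega), ← h, show r = T by omega]
      · refine ⟨T, le_rfl, fun r _ _ => ?_⟩
        rw [if_pos (by omega), ← h, show r = T by omega]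
    obtain ⟨w, hw, hf⟩ := ih fun r hr hrT => hstep r hr (hrT.trans T.lt_succ_self)
    obtain ⟨t, rfl⟩ : ∃ t, T = t + 1 := ⟨T - 1, by omega⟩
    have hlast := hf t (by omega) t.lt_succ_self
    rcases hstep t (by omega) (by omega) with hkeep | ⟨hnone, hnew⟩
    · rcases le_or_gt w t with hwt | hwt
      · refine ⟨w, hw, fun r hr hrT => ?_⟩
        rcases Nat.lt_succ_iff_lt_or_eq.1 hrT with h | rfl
        · exact hf r hr h
        · rw [hkeep, hlast, if_pos hwt, if_pos (by omega)]
      · refine ⟨t + 2, by omega, fun r hr hrT => ?_⟩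
        rw [if_neg (by omega)]
        rcases Nat.lt_succ_iff_lt_or_eq.1 hrT with h | rfl
        · rw [hf r hr h, if_neg (by omega)]
        · rw [hkeep, hlast, if_neg (by omega)]
    · have hwt : t < w := by
        by_contra hwt
        rw [hnone, if_pos (by omega)] at hlast
        cases hlast
      refine ⟨t + 1, by omega, fun r hr hrT => ?_⟩
      rcases Nat.lt_succ_iff_lt_or_eq.1 hrT with h | rfl
      · rw [hf r hr h, if_neg (by omega), if_neg (by omega)]
      · rw [hnew, if_pos le_rfl]

theorem IsWake.eq_some_of_le (h : IsWake f t₀ T) {w r : ℕ} (hw : t₀ ≤ w) (hwr : w ≤ r) (hr : r < T)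
    (hf : f w = some w) : f r = some w := by
  obtain ⟨w', -, hw'⟩ := h
  rw [hw' w hw (by omega), Option.ite_none_right_eq_some, Option.some.injEq] at hf
  rw [hw' r (by omega) hr, if_pos (by omega), hf.2]

theorem IsWake.eq_none_of_lt (h : IsWake f t₀ T) {w r : ℕ} (hr : t₀ ≤ r) (hrw : r < w) (hw : w < T)
    (hf : f w = some w) : f r = none := by
  obtain ⟨w', -, hw'⟩ := h
  rw [hw' w (by omega) hw, Option.ite_none_right_eq_some, Option.some.injEq] at hf
  rw [hw' r hr (by omega), if_neg (by omega)]

theorem IsWake.ne_none_mono (h : IsWake f t₀ T) {r r' : ℕ} (hr : t₀ ≤ r) (hrr' : r ≤ r')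
    (hr' : r' < T) (hf : f r ≠ none) : f r' ≠ none := by
  obtain ⟨w, -, hw⟩ := h
  have hwr : w ≤ r := by
    by_contra hlt
    exact hf (by rw [hw r hr (by omega), if_neg hlt])
  rw [hw r' (by omega) hr', if_pos (by omega)]
  exact Option.some_ne_none w

theorem IsWake.eq_some_self (h : IsWake f t₀ T) {r : ℕ} (hr : t₀ ≤ r) (hrT : r < T)
    (hf : f r ≠ none) (hfirst : ∀ r', t₀ ≤ r' → r' < r → f r' = none) : f r = some r := by
  obtain ⟨w, hw, hf'⟩ := h
  have hwr : w ≤ r := by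
    by_contra hlt
    exact hf (by rw [hf' r hr hrT, if_neg hlt])
  obtain rfl : w = r := by
    refine hwr.antisymm (not_lt.1 fun hlt => ?_)
    have := hfirst w hw hlt
    rw [hf' w hw (by omega), if_pos le_rfl] at this
    cases this
  rw [hf' w hr hrT, if_pos le_rfl]

end Wake

section Spread

variable {V : Type*}

/-- `v` enters the growing set `I` in round `w` of a window of rounds that begins with `t₀`. -/
structure Joins (I : ℕ → Set V) (t₀ : ℕ) (v : V) (w : ℕ) : Prop where
  le : t₀ ≤ w
  mem : v ∈ I w
  notMem : ∀ r, t₀ ≤ r → r < w → v ∉ I r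

theorem exists_joins_of_mem {I : ℕ → Set V} {t₀ r : ℕ} {v : V} (hr : t₀ ≤ r) (hv : v ∈ I r) :
    ∃ w ≤ r, Joins I t₀ v w := by
  classical
  have hex : ∃ w, t₀ ≤ w ∧ v ∈ I w := ⟨r, hr, hv⟩
  exact ⟨Nat.find hex, Nat.find_min' hex ⟨hr, hv⟩, (Nat.find_spec hex).1, (Nat.find_spec hex).2,
    fun r' hr' hlt hmem => Nat.find_min hex hlt ⟨hr', hmem⟩⟩

theorem exists_adj_boundary {H : SimpleGraph V} (hH : H.Connected) {s : Set V} (hs : s.Nonempty)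
    (hne : s ≠ Set.univ) : ∃ v ∈ s, ∃ u ∉ s, H.Adj v u := by
  obtain ⟨a, ha⟩ := hs
  obtain ⟨b, hb⟩ := (Set.ne_univ_iff_exists_notMem _).1 hne
  obtain ⟨p⟩ := hH.preconnected a b
  obtain ⟨d, -, hfst, hsnd⟩ := p.exists_boundary_dart s ha hb
  exact ⟨d.fst, hfst, d.snd, hsnd, d.adj⟩

-- Let `v` be adjacent to a node outside `I r`, and let `v` have joined in round `w`. The rounds
-- before `w` have a nonnegative sum by induction, and those from `w` on have one because `v` would
-- otherwise have reached its neighbors.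
theorem sum_nonneg_of_spread {H : SimpleGraph V} (hH : H.Connected) {I : ℕ → Set V} {t₀ T : ℕ}
    (hI : MonotoneOn I (Set.Ico t₀ T)) (h0 : (I t₀).Nonempty) {sc : ℕ → ℤ} (hsc : ∀ r, -1 ≤ sc r)
    (hnew : ∀ v w, w < T → Joins I t₀ v w → 0 ≤ sc w)
    (hspread : ∀ v w e, Joins I t₀ v w → w < e → e < T → ∑ r ∈ Finset.Ico w e, sc r ≤ 0 →
      ∀ u, H.Adj v u → u ∈ I e)
    {r : ℕ} (hr : t₀ ≤ r) (hrT : r < T) (hne : I r ≠ Set.univ) :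
    0 ≤ ∑ i ∈ Finset.Ico t₀ (r + 1), sc i := by
  induction r using Nat.strong_induction_on with
  | _ r ih =>
    have hnonempty : (I r).Nonempty := h0.mono (hI ⟨le_rfl, hr.trans_lt hrT⟩ ⟨hr, hrT⟩ hr)
    obtain ⟨v, hv, u, hu, hadj⟩ := exists_adj_boundary hH hnonempty hne
    obtain ⟨w, hwr, hjoin⟩ := exists_joins_of_mem hr hv
    have hbefore : 0 ≤ ∑ i ∈ Finset.Ico t₀ w, sc i := by
      rcases hjoin.le.eq_or_lt with rfl | hlt
      · simp
      obtain ⟨w', rfl⟩ : ∃ w', w = w' + 1 := ⟨w - 1, by omega⟩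
      exact ih w' (by omega) (by omega) (by omega) fun huniv =>
        hjoin.notMem w' (by omega) w'.lt_succ_self (huniv ▸ Set.mem_univ v)
    have hafter : 0 ≤ ∑ i ∈ Finset.Ico w (r + 1), sc i := by
      rw [Finset.sum_Ico_succ_top hwr]
      rcases hwr.eq_or_lt with rfl | hlt
      · simpa using hnew v w hrT hjoin
      · have : 0 < ∑ i ∈ Finset.Ico w r, sc i :=
          not_le.1 fun hle => hu (hspread v w r hjoin hlt hrT hle u hadj)
        linarith [hsc r]
    rw [← Finset.sum_Ico_consecutive _ hjoin.le (by omega : w ≤ r + 1)]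
    exact add_nonneg hbefore hafter

end Spread

section Harmonic

/-- The threshold below which the number drawn from `Fin N` has to be for a transmission in
round `r` by an agent that is awake since round `w`: the draw is that small with probability
`1 / (1 + ⌊(r - w) / Θ⌋)` if the denominator divides `N`. An agent that is not awake never
transmits. -/
def threshold (N Θ : ℕ) (w : Option ℕ) (r : ℕ) : ℕ :=
  w.elim 0 fun w => N / (1 + (r - w) / Θ)

theorem threshold_none (N Θ r : ℕ) : threshold N Θ none r = 0 := rfl

theorem threshold_some (N Θ w r : ℕ) : threshold N Θ (some w) r = N / (1 + (r - w) / Θ) := rfl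

theorem threshold_le (N Θ : ℕ) (w : Option ℕ) (r : ℕ) : threshold N Θ w r ≤ N := by
  cases w with
  | none => exact Nat.zero_le _
  | some w => exact Nat.div_le_self _ _

theorem threshold_some_div_le (N Θ w r : ℕ) :
    (threshold N Θ (some w) r : ℝ) / N ≤ 1 / ((1 + (r - w) / Θ : ℕ) : ℝ) := by
  rw [threshold_some]
  refine (div_le_div_of_nonneg_right Nat.cast_div_le N.cast_nonneg).trans ?_
  rw [div_right_comm]
  gcongr
  exact div_self_le_one _

variable {n σ N Θ : ℕ}

/-- The expected number of transmissions in round `r`, where `W u i` is the wake-up round of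
agent `i` of node `u`. -/
noncomputable def mass (N Θ : ℕ) (W : Fin n → Fin σ → Option ℕ) (r : ℕ) : ℝ :=
  ∑ u, ∑ i, (threshold N Θ (W u i) r : ℝ) / N

/-- Round `r` is busy, as opposed to free, if collisions are likely in it. -/
def Busy (N Θ : ℕ) (W : Fin n → Fin σ → Option ℕ) (r : ℕ) : Prop := 1 / 2 < mass N Θ W r

open Classical in
/-- The contribution of round `r` to the number of busy rounds minus the number of free rounds. -/
noncomputable def score (N Θ : ℕ) (W : Fin n → Fin σ → Option ℕ) (r : ℕ) : ℤ :=
  if Busy N Θ W r then 1 else -1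

theorem neg_one_le_score (N Θ : ℕ) (W : Fin n → Fin σ → Option ℕ) (r : ℕ) :
    -1 ≤ score N Θ W r := by
  rw [score]
  split_ifs <;> norm_num

theorem mass_nonneg (N Θ : ℕ) (W : Fin n → Fin σ → Option ℕ) (r : ℕ) : 0 ≤ mass N Θ W r :=
  Finset.sum_nonneg fun _ _ => Finset.sum_nonneg fun _ _ => by positivity

theorem le_mass (N Θ : ℕ) (W : Fin n → Fin σ → Option ℕ) (r : ℕ) (v : Fin n) (k : Fin σ) :
    (threshold N Θ (W v k) r : ℝ) / N ≤ mass N Θ W r := by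
  rw [mass, ← Fintype.sum_prod_type' (f := fun u i => (threshold N Θ (W u i) r : ℝ) / N)]
  exact Finset.single_le_sum (f := fun a : Fin n × Fin σ => (threshold N Θ (W a.1 a.2) r : ℝ) / N)
    (fun _ _ => by positivity) (Finset.mem_univ (v, k))

theorem score_le (N Θ : ℕ) (W : Fin n → Fin σ → Option ℕ) (r : ℕ) :
    (score N Θ W r : ℝ) ≤ 4 * mass N Θ W r - 1 := by
  have := mass_nonneg N Θ W r
  rw [score]
  split_ifs with h
  · rw [Busy] at h
    push_cast
    linarith
  · push_cast
    linarith

theorem score_eq_one_of_recent (hN : N ≠ 0) {W : Fin n → Fin σ → Option ℕ} {r : ℕ}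
    {v : Fin n} {k : Fin σ} {w : ℕ} (hw : W v k = some w) (hr : r < w + Θ) (hwr : w ≤ r) :
    score N Θ W r = 1 := by
  have hle := le_mass N Θ W r v k
  rw [hw, threshold_some, Nat.div_eq_of_lt (by omega : r - w < Θ), add_zero, Nat.div_one,
    div_self (by exact_mod_cast hN)] at hle
  exact if_pos (one_half_lt_one.trans_le hle)

section Free

variable (W : ℕ → Fin n → Fin σ → Option ℕ) {w e : ℕ}

open Classical in
theorem sum_score_eq (s : Finset ℕ) : ∑ r ∈ s, score N Θ (W r) r =
    s.card - 2 * (s.filter fun r => ¬ Busy N Θ (W r) r).card := by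
  have hterm (r : ℕ) : score N Θ (W r) r = 1 - 2 * (if ¬ Busy N Θ (W r) r then 1 else 0) := by
    rw [score]
    split_ifs <;> rfl
  simp only [hterm]
  rw [Finset.sum_sub_distrib, ← Finset.mul_sum, Finset.sum_boole, Finset.sum_const, nsmul_one]

theorem add_lt_of_sum_score_nonpos (hN : N ≠ 0) {v : Fin n} {k : Fin σ} (hwe : w < e)
    (hW : ∀ r, w ≤ r → r < e → W r v k = some w)
    (hs : ∑ r ∈ Finset.Ico w e, score N Θ (W r) r ≤ 0) : w + Θ < e := by
  by_contra hle
  have hone : ∀ r ∈ Finset.Ico w e, score N Θ (W r) r = 1 := fun r hr => by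
    rw [Finset.mem_Ico] at hr
    exact score_eq_one_of_recent hN (hW r hr.1 hr.2) (by omega) hr.1
  rw [Finset.sum_congr rfl hone, Finset.sum_const, Nat.card_Ico, nsmul_one] at hs
  omega

theorem div_le_threshold_div (hN : N ≠ 0) {T : ℕ} (hdvd : ∀ j, 1 ≤ j → j ≤ T → j ∣ N) (heT : e ≤ T)
    (hlen : w + Θ < e) {r : ℕ} (hwr : w ≤ r) (hre : r < e) :
    (Θ : ℝ) / (2 * (e - w : ℕ)) ≤ (threshold N Θ (some w) r : ℝ) / N := by
  have hquot : (r - w) / Θ ≤ r - w := Nat.div_le_self _ _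
  have hbound : (Θ : ℝ) * (1 + (r - w) / Θ : ℕ) ≤ 2 * (e - w : ℕ) := by
    have : Θ * (1 + (r - w) / Θ) ≤ 2 * (e - w) := by
      have := Nat.mul_div_le (r - w) Θ
      rw [mul_add, mul_one]
      omega
    exact_mod_cast this
  have hpos : (0 : ℝ) < (e - w : ℕ) := by exact_mod_cast (by omega : 0 < e - w)
  rw [threshold_some, Nat.cast_div (hdvd _ (Nat.le_add_right 1 _) (by omega)) (by positivity),
    div_div_cancel_left' (by exact_mod_cast hN), inv_eq_one_div,
    div_le_div_iff₀ (by positivity) (by positivity), one_mul]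
  exact hbound

open Classical in
/-- A lower bound for the probability that agent `k` of node `v` is the only one to transmit in
round `r`; it is nonzero in the free rounds only. -/
noncomputable def soloWeight (N Θ : ℕ) (W : Fin n → Fin σ → Option ℕ) (r : ℕ) (v : Fin n)
    (k : Fin σ) : ℝ :=
  if ¬ Busy N Θ W r then (threshold N Θ (W v k) r : ℝ) / N / 2 else 0

theorem soloWeight_nonneg (W : Fin n → Fin σ → Option ℕ) (r : ℕ) (v : Fin n) (k : Fin σ) :
    0 ≤ soloWeight N Θ W r v k := by
  rw [soloWeight]
  split_ifs <;> positivity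

theorem le_sum_soloWeight_of_sum_score_nonpos (hN : N ≠ 0) {T : ℕ}
    (hdvd : ∀ j, 1 ≤ j → j ≤ T → j ∣ N) {v : Fin n} {k : Fin σ}
    (hwe : w < e) (heT : e ≤ T) (hW : ∀ r, w ≤ r → r < e → W r v k = some w)
    (hs : ∑ r ∈ Finset.Ico w e, score N Θ (W r) r ≤ 0) :
    (Θ : ℝ) / 8 ≤ ∑ r ∈ Finset.Ico w e, soloWeight N Θ (W r) r v k := by
  classical
  have hlen := add_lt_of_sum_score_nonpos W hN hwe hW hs
  rw [sum_score_eq, Nat.card_Ico] at hs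
  simp only [soloWeight]
  rw [← Finset.sum_filter]
  set F := (Finset.Ico w e).filter fun r => ¬ Busy N Θ (W r) r
  have hcount : ((e - w : ℕ) : ℝ) ≤ 2 * F.card := by
    exact_mod_cast (by linarith : ((e - w : ℕ) : ℤ) ≤ 2 * F.card)
  have hpos : (0 : ℝ) < (e - w : ℕ) := by exact_mod_cast (by omega : 0 < e - w)
  calc (Θ : ℝ) / 8 = (e - w : ℕ) / 2 * (Θ / (2 * (e - w : ℕ)) / 2) := by
        field_simp
        norm_num
    _ ≤ F.card * (Θ / (2 * (e - w : ℕ)) / 2) := by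
        gcongr
        linarith
    _ = F.card • ((Θ : ℝ) / (2 * (e - w : ℕ)) / 2) := (nsmul_eq_mul _ _).symm
    _ ≤ _ := Finset.card_nsmul_le_sum F _ _ fun r hr => by
        rw [Finset.mem_filter, Finset.mem_Ico] at hr
        rw [hW r hr.1.1 hr.1.2]
        exact div_le_div_of_nonneg_right
          (div_le_threshold_div hN hdvd heT hlen hr.1.1 hr.1.2) zero_le_two

end Free

section Starvation

variable {D : Type}

/-- In round `r`, agent `k` of node `v` is the only one to transmit. -/
def OnlyFires (Θ : ℕ) (W : Fin n → Fin σ → Option ℕ) (r : ℕ) (v : Fin n) (k : Fin σ)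
    (x : Fin n → SlotCoin σ N D) : Prop :=
  ∀ u i, ((x u).1 i).val < threshold N Θ (W u i) r ↔ u = v ∧ i = k

theorem OnlyFires.ne_none {W : Fin n → Fin σ → Option ℕ} {r : ℕ} {v : Fin n} {k : Fin σ}
    {x : Fin n → SlotCoin σ N D} (h : OnlyFires Θ W r v k x) : W v k ≠ none := fun hnone => by
  have := (h v k).2 ⟨rfl, rfl⟩
  rw [hnone, threshold_none] at this
  exact Nat.not_lt_zero _ this

/-- Agent `k` of node `v` wakes up in the window `[t₀, T)`, and from then on at least half of the
rounds up to some time in the window are free although in none of them it is the only one to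
transmit. -/
def Starves (Θ t₀ T : ℕ) (W : ℕ → Fin n → Fin σ → Option ℕ) (ω : ℕ → Fin n → SlotCoin σ N D)
    (v : Fin n) (k : Fin σ) : Prop :=
  ∃ w e, t₀ ≤ w ∧ w < e ∧ e ≤ T ∧ (∀ r, w ≤ r → r < e → W r v k = some w) ∧
    (∀ r, t₀ ≤ r → r < w → W r v k = none) ∧
    ∑ r ∈ Finset.Ico w e, score N Θ (W r) r ≤ 0 ∧
    ∀ r, w ≤ r → r < e → ¬ OnlyFires Θ (W r) r v k (ω r)

theorem exists_onlyFires_of_not_starves {t₀ T : ℕ} {W : ℕ → Fin n → Fin σ → Option ℕ}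
    {ω : ℕ → Fin n → SlotCoin σ N D} {v : Fin n} {k : Fin σ} (h : ¬ Starves Θ t₀ T W ω v k)
    (hwake : IsWake (fun r => W r v k) t₀ T) {w e : ℕ} (hw : t₀ ≤ w) (hwe : w < e) (heT : e ≤ T)
    (hself : W w v k = some w) (hs : ∑ r ∈ Finset.Ico w e, score N Θ (W r) r ≤ 0) :
    ∃ r, w ≤ r ∧ r < e ∧ OnlyFires Θ (W r) r v k (ω r) := by
  by_contra! hno
  exact h ⟨w, e, hw, hwe, heT,
    fun r hwr hre => hwake.eq_some_of_le hw hwr (hre.trans_le heT) hself,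
    fun r hr hrw => hwake.eq_none_of_lt hr hrw (hwe.trans_le heT) hself, hs, hno⟩

/-- An algorithm for slot coins that are uniformly distributed. -/
noncomputable abbrev slotAlgorithm (n σ N : ℕ) (D : Type) [NeZero N] [Fintype D] [Nonempty D]
    (State : Type) (init : Fin n → ℕ → State)
    (send : Fin n → State → SlotCoin σ N D → Option (Packet ℕ))
    (next : Fin n → State → SlotCoin σ N D → Option (Packet ℕ) → State) : Algorithm n where
  Coin := SlotCoin σ N D
  coinFintype := inferInstance
  law := PMF.uniformOfFintype _
  State := State
  init := init
  send := send
  next := next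

variable [NeZero N] [Fintype D] [Nonempty D]

theorem soloWeight_le_roundProb_onlyFires (Θ : ℕ) (W : Fin n → Fin σ → Option ℕ) (r : ℕ)
    (v : Fin n) (k : Fin σ) : soloWeight N Θ W r v k ≤
      roundProb (PMF.uniformOfFintype (SlotCoin σ N D)) n {x | OnlyFires Θ W r v k x} := by
  rw [soloWeight]
  split_ifs with hbusy
  · exact roundProb_nonneg _ _ _
  · refine le_trans ?_ (le_roundProb_only_slot (fun u i => threshold_le N Θ (W u i) r) v k)
    rw [Busy, not_lt, mass] at hbusy
    rw [div_eq_mul_one_div _ (2 : ℝ)]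
    exact mul_le_mul_of_nonneg_left (by linarith) (by positivity)

variable {State : Type} {init : Fin n → ℕ → State}
  {send : Fin n → State → SlotCoin σ N D → Option (Packet ℕ)}
  {next : Fin n → State → SlotCoin σ N D → Option (Packet ℕ) → State}

theorem coinMeasure_starves_le (Θ t₀ : ℕ) {T : ℕ} (hdvd : ∀ j, 1 ≤ j → j ≤ T → j ∣ N)
    {W : (ℕ → Fin n → SlotCoin σ N D) → ℕ → Fin n → Fin σ → Option ℕ}
    (hW : ∀ r, DependsOn (fun ω => W ω r) (Set.Iio r)) (v : Fin n) (k : Fin σ) :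
    coinMeasure (slotAlgorithm n σ N D State init send next) {ω | Starves Θ t₀ T (W ω) ω v k} ≤
      ENNReal.ofReal (Real.exp (-(Θ / 8))) := by
  let S (ω : ℕ → Fin n → SlotCoin σ N D) (r : ℕ) : Prop :=
    t₀ ≤ r ∧ OnlyFires Θ (W ω r) r v k (ω r)
  let q (ω : ℕ → Fin n → SlotCoin σ N D) (r : ℕ) : ℝ :=
    if t₀ ≤ r then soloWeight N Θ (W ω r) r v k else 0
  have hq (r : ℕ) : DependsOn (fun ω => q ω r) (Set.Iio r) := fun ω ω' h => by
    simp only [q, show W ω r = W ω' r from hW r h]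
  have hS (r : ℕ) : DependsOn (fun ω => S ω r) (Set.Iic r) := fun ω ω' h => by
    have hpast : W ω r = W ω' r := hW r fun i hi => h i (Set.mem_Iic.2 (Set.mem_Iio.1 hi).le)
    simp only [S, hpast, h r Set.self_mem_Iic]
  have hq0 (ω : ℕ → Fin n → SlotCoin σ N D) (r : ℕ) : 0 ≤ q ω r := by
    simp only [q]
    split_ifs
    exacts [soloWeight_nonneg _ _ _ _, le_rfl]
  have hle (ω : ℕ → Fin n → SlotCoin σ N D) (r : ℕ) : q ω r ≤
      roundProb (PMF.uniformOfFintype (SlotCoin σ N D)) n {x | S (Function.update ω r x) r} := by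
    have hpast (x : Fin n → SlotCoin σ N D) : W (Function.update ω r x) r = W ω r :=
      hW r fun i hi => Function.update_of_ne (Set.mem_Iio.1 hi).ne _ _
    simp only [q, S, hpast, Function.update_self]
    split_ifs with htr
    · simpa only [htr, true_and] using soloWeight_le_roundProb_onlyFires Θ (W ω r) r v k
    · exact roundProb_nonneg _ _ _
  refine (measure_mono ?_).trans (coinMeasure_no_success_le
    (slotAlgorithm n σ N D State init send next) hq hS hq0 hle (Θ / 8) T)
  rintro ω ⟨w, e, htw, hwe, heT, hawake, hnone, hs, hno⟩
  refine ⟨e, heT, fun r hr ⟨htr, hfire⟩ => ?_, ?_⟩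
  · rcases le_or_gt w r with hwr | hrw
    exacts [hno r hwr hr hfire, hfire.ne_none (hnone r htr hrw)]
  · calc (Θ : ℝ) / 8 ≤ ∑ r ∈ Finset.Ico w e, soloWeight N Θ (W ω r) r v k :=
          le_sum_soloWeight_of_sum_score_nonpos (W ω) (NeZero.ne N) hdvd hwe heT hawake hs
      _ = ∑ r ∈ Finset.Ico w e, q ω r := Finset.sum_congr rfl fun r hr =>
          (if_pos (htw.trans (Finset.mem_Ico.1 hr).1)).symm
      _ ≤ ∑ r ∈ Finset.range e, q ω r :=
          Finset.sum_le_sum_of_subset_of_nonneg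
            (fun r hr => Finset.mem_range.2 (Finset.mem_Ico.1 hr).2) fun r _ _ => hq0 ω r

end Starvation

section LongWindow

theorem sum_range_one_div_one_add_div (hΘ : 0 < Θ) (m : ℕ) :
    ∑ d ∈ Finset.range (Θ * m), 1 / ((1 + d / Θ : ℕ) : ℝ) = Θ * (harmonic m : ℚ) := by
  induction m with
  | zero => simp
  | succ m ih =>
    have hblock : ∀ d ∈ Finset.range Θ, 1 / ((1 + (Θ * m + d) / Θ : ℕ) : ℝ) =
        ((m + 1 : ℕ) : ℝ)⁻¹ := fun d hd => by
      rw [Nat.mul_add_div hΘ, Nat.div_eq_of_lt (Finset.mem_range.1 hd), add_zero, add_comm, one_div]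
    rw [Nat.mul_succ, Finset.sum_range_add, ih, harmonic_succ, Finset.sum_congr rfl hblock,
      Finset.sum_const, Finset.card_range, nsmul_eq_mul]
    push_cast
    ring

variable {t₀ T m : ℕ}

theorem sum_threshold_div_le (N : ℕ) (hΘ : 0 < Θ) (hT : T ≤ t₀ + Θ * m) {f : ℕ → Option ℕ}
    (hf : IsWake f t₀ T) :
    ∑ r ∈ Finset.Ico t₀ T, (threshold N Θ (f r) r : ℝ) / N ≤ Θ * (harmonic m : ℚ) := by
  obtain ⟨w, hw, hf⟩ := hf
  have hterm : ∀ r ∈ Finset.Ico t₀ T, (threshold N Θ (f r) r : ℝ) / N ≤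
      if w ≤ r then 1 / ((1 + (r - w) / Θ : ℕ) : ℝ) else 0 := fun r hr => by
    rw [Finset.mem_Ico] at hr
    rw [hf r hr.1 hr.2]
    split_ifs
    · exact threshold_some_div_le N Θ w r
    · rw [threshold_none, Nat.cast_zero, zero_div]
  have hfilter : (Finset.Ico t₀ T).filter (w ≤ ·) = Finset.Ico w T := by
    ext r
    simp only [Finset.mem_filter, Finset.mem_Ico]
    omega
  calc ∑ r ∈ Finset.Ico t₀ T, (threshold N Θ (f r) r : ℝ) / N
      ≤ ∑ r ∈ Finset.Ico w T, 1 / ((1 + (r - w) / Θ : ℕ) : ℝ) := by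
        rw [← hfilter, Finset.sum_filter]
        exact Finset.sum_le_sum hterm
    _ = ∑ d ∈ Finset.range (T - w), 1 / ((1 + d / Θ : ℕ) : ℝ) := by
        simp only [Finset.sum_Ico_eq_sum_range, Nat.add_sub_cancel_left]
    _ ≤ ∑ d ∈ Finset.range (Θ * m), 1 / ((1 + d / Θ : ℕ) : ℝ) :=
        Finset.sum_le_sum_of_subset_of_nonneg (Finset.range_mono (by omega))
          fun _ _ _ => by positivity
    _ = Θ * (harmonic m : ℚ) := sum_range_one_div_one_add_div hΘ m

theorem sum_mass_le (N : ℕ) (hΘ : 0 < Θ) (hT : T ≤ t₀ + Θ * m) {W : ℕ → Fin n → Fin σ → Option ℕ}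
    (hwake : ∀ u i, IsWake (fun r => W r u i) t₀ T) {s : Finset (Fin n × Fin σ)}
    (hs : ∀ u i, (u, i) ∉ s → ∀ r, t₀ ≤ r → r < T → W r u i = none) :
    ∑ r ∈ Finset.Ico t₀ T, mass N Θ (W r) r ≤ s.card * (Θ * (harmonic m : ℚ)) := by
  have hmass : ∀ r ∈ Finset.Ico t₀ T, mass N Θ (W r) r =
      ∑ a ∈ s, (threshold N Θ (W r a.1 a.2) r : ℝ) / N := fun r hr => by
    rw [Finset.mem_Ico] at hr
    rw [mass, ← Fintype.sum_prod_type' (f := fun u i => (threshold N Θ (W r u i) r : ℝ) / N)]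
    refine (Finset.sum_subset (Finset.subset_univ s) fun a _ ha => ?_).symm
    rw [hs a.1 a.2 ha r hr.1 hr.2, threshold_none, Nat.cast_zero, zero_div]
  rw [Finset.sum_congr rfl hmass, Finset.sum_comm, ← nsmul_eq_mul]
  exact Finset.sum_le_card_nsmul s _ _ fun a _ => sum_threshold_div_le N hΘ hT (hwake a.1 a.2)

theorem informed_eq_univ_of_long_window {D : Type} (hN : N ≠ 0) (hΘ : 0 < Θ) (htT : t₀ ≤ T)
    (hT : T < t₀ + Θ * m) {H : SimpleGraph (Fin n)} (hH : H.Connected) {I : ℕ → Set (Fin n)}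
    (hI : MonotoneOn I (Set.Icc t₀ T)) (h0 : (I t₀).Nonempty)
    {W : ℕ → Fin n → Fin σ → Option ℕ} {ω : ℕ → Fin n → SlotCoin σ N D} (k : Fin n → Fin σ)
    (hwake : ∀ u i, IsWake (fun r => W r u i) t₀ (T + 1))
    (hself : ∀ v w, w ≤ T → Joins I t₀ v w → W w v (k v) = some w)
    (hspread : ∀ v r, t₀ ≤ r → r < T → v ∈ I r → OnlyFires Θ (W r) r v (k v) (ω r) →
      ∀ u, H.Adj v u → u ∈ I (r + 1))
    (hprogress : ∀ v, ¬ Starves Θ t₀ (T + 1) W ω v (k v))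
    {s : Finset (Fin n × Fin σ)}
    (hs : ∀ u i, (u, i) ∉ s → ∀ r, t₀ ≤ r → r < T + 1 → W r u i = none)
    (hlong : 4 * (s.card * (Θ * (harmonic m : ℚ))) < ((T + 1 - t₀ : ℕ) : ℝ)) :
    I T = Set.univ := by
  by_contra hne
  have hscore : 0 ≤ ∑ r ∈ Finset.Ico t₀ (T + 1), score N Θ (W r) r := by
    refine sum_nonneg_of_spread hH (T := T + 1)
      (hI.mono fun r hr => ⟨hr.1, Nat.lt_succ_iff.1 hr.2⟩) h0
      (fun r => neg_one_le_score N Θ _ r) (fun v w hwT hjoin => ?_) ?_ htT T.lt_succ_self hne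
    · rw [score_eq_one_of_recent hN (hself v w (by omega) hjoin) (by omega) le_rfl]
      exact zero_le_one
    · intro v w e hjoin hwe heT hle u hadj
      obtain ⟨r, hwr, hre, hfire⟩ := exists_onlyFires_of_not_starves (hprogress v) (hwake v _)
        hjoin.le hwe heT.le (hself v w (by omega) hjoin) hle
      have := hjoin.le
      have hvr : v ∈ I r := hI ⟨by omega, by omega⟩ ⟨by omega, by omega⟩ hwr hjoin.mem
      exact hI ⟨by omega, by omega⟩ ⟨by omega, by omega⟩ hre
        (hspread v r (by omega) (by omega) hvr hfire u hadj)
  have hsum := Finset.sum_le_sum fun r (_ : r ∈ Finset.Ico t₀ (T + 1)) => score_le N Θ (W r) r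
  rw [Finset.sum_sub_distrib, ← Finset.mul_sum, Finset.sum_const, Nat.card_Ico, nsmul_one] at hsum
  have hscore' : (0 : ℝ) ≤ ∑ r ∈ Finset.Ico t₀ (T + 1), (score N Θ (W r) r : ℝ) := by
    exact_mod_cast hscore
  linarith [sum_mass_le N hΘ hT hwake hs]

end LongWindow

end Harmonic

section Count

theorem foldr_max_le {l : List ℕ} {a b : ℕ} : l.foldr max a ≤ b ↔ a ≤ b ∧ ∀ x ∈ l, x ≤ b := by
  induction l with
  | nil => simp
  | cons x l ih =>
    simp only [List.foldr_cons, max_le_iff, ih, List.mem_cons, forall_eq_or_imp]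
    tauto

variable {M : Type} [DecidableEq M]

theorem length_le_of_idxOf_lt {l l' : List M} (hl' : l'.Nodup) {b : ℕ} (hlen : l.length ≤ b)
    (hidx : ∀ m ∈ l', m ∉ l → l'.idxOf m < b) (hpre : l <+: l') : l'.length ≤ b := by
  by_contra! hlt
  have hnotMem : l'[b] ∉ l := fun hmem => by
    obtain ⟨i, hi, heq⟩ := List.getElem_of_mem hmem
    have := hl'.getElem_inj_iff.1 ((hpre.getElem hi).symm.trans heq)
    omega
  have := hidx _ (List.getElem_mem hlt) hnotMem
  rw [hl'.idxOf_getElem] at this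
  exact lt_irrefl _ this

-- A process is not told how many broadcast messages its node knows; this is how it keeps count.
theorem foldr_max_idxOf_learn {l : List M} (hl : l.Nodup) (ms : List M) :
    ((ms.map fun m => (learn l ms).idxOf m).map (· + 1)).foldr max l.length =
      (learn l ms).length := by
  apply le_antisymm
  · refine foldr_max_le.2 ⟨(prefix_learn l ms).length_le, ?_⟩
    simp only [List.map_map, List.forall_mem_map, Function.comp_apply]
    exact fun m hm => List.idxOf_lt_length_of_mem (mem_learn.2 (Or.inr hm))
  · obtain ⟨hlen, hidx⟩ := foldr_max_le.1 (le_refl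
      (((ms.map fun m => (learn l ms).idxOf m).map (· + 1)).foldr max l.length))
    simp only [List.map_map, List.forall_mem_map, Function.comp_apply] at hlen hidx ⊢
    exact length_le_of_idxOf_lt (nodup_learn hl ms) hlen
      (fun m hm hml => hidx m ((mem_learn.1 hm).resolve_left hml)) (prefix_learn l ms)

end Count

section Pipeline

/-- The state of a process of `pipeline`: the number of the round, the number of broadcast messages
that are known, and the number of those that have been sent. -/
structure PipelineState where
  round : ℕ
  count : ℕ
  sent : ℕ

/-- Round robin: in its turn, a node sends the next `c` messages that it has not sent. -/
noncomputable abbrev pipeline (n c : ℕ) : Algorithm n where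
  Coin := Unit
  coinFintype := inferInstance
  law := PMF.pure ()
  State := PipelineState
  init _ k := ⟨0, k, 0⟩
  send v st _ :=
    if st.round % n = v then some ⟨(List.range c).map (st.sent + ·), []⟩ else none
  next v st _ y :=
    { round := st.round + 1
      count := y.elim st.count fun p => (p.msgs.map (· + 1)).foldr max st.count
      sent := if st.round % n = v then min (st.sent + c) st.count else st.sent }

theorem pipeline_send {n c : ℕ} (v : Fin n) (st : PipelineState) (x : Unit) :
    (pipeline n c).send v st x =
      if st.round % n = v then some ⟨(List.range c).map (st.sent + ·), []⟩ else none := rfl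

theorem pipeline_hasCapacity (n c b : ℕ) : (pipeline n c).HasCapacity c b := by
  intro v st x p hsend
  rw [pipeline_send] at hsend
  split_ifs at hsend
  obtain rfl := Option.some.inj hsend
  simp

theorem mem_take_or_mem_filterMap_of_mem_take_add {α : Type*} {l : List α} {a c : ℕ} {m : α}
    (hm : m ∈ l.take (a + c)) :
    m ∈ l.take a ∨ m ∈ ((List.range c).map (a + ·)).filterMap fun i => l[i]? := by
  rw [List.take_add, List.mem_append] at hm
  refine hm.imp_right fun hm => ?_
  obtain ⟨i, hi, rfl⟩ := List.getElem_of_mem hm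
  have hic := List.length_take_le c (l.drop a)
  simp only [List.mem_filterMap, List.mem_map, List.mem_range, exists_exists_and_eq_and]
  refine ⟨i, hi.trans_le hic, ?_⟩
  rw [List.getElem_take, List.getElem_drop, List.getElem?_eq_getElem]

theorem take_subset_take {α : Type*} {l l' : List α} (h : l <+: l') {a b : ℕ} (hab : a ≤ b) :
    l.take a ⊆ l'.take b :=
  ((List.take_prefix_take_left hab).trans (h.take b)).subset

variable {n c : ℕ} {M : Type} [DecidableEq M] (inp : Fin n → List M)
  (G : ℕ → SimpleGraph (Fin n)) (ω : ℕ → Fin n → (pipeline n c).Coin)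

local notation "cfg" => run (pipeline n c) inp G ω

theorem pipeline_round (r : ℕ) (v : Fin n) : (cfg r v).st.round = r := by
  induction r with
  | zero => rfl
  | succ r ih =>
    rw [run_succ]
    rcases reception (G r) (transmission (pipeline n c) (cfg r) (ω r)) v with _ | _ <;>
      exact congrArg (· + 1) ih

theorem pipeline_count (hinp : ∀ v, (inp v).Nodup) (r : ℕ) (v : Fin n) :
    (cfg r v).st.count = (cfg r v).known.length := by
  induction r with
  | zero => rfl
  | succ r ih =>
    rw [run_succ]
    rcases reception (G r) (transmission (pipeline n c) (cfg r) (ω r)) v with _ | p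
    · exact ih
    · refine Eq.trans ?_ (foldr_max_idxOf_learn (run_known_nodup _ inp G ω hinp r v) p.msgs)
      rw [← ih]
      rfl

theorem pipeline_sent_succ (hinp : ∀ v, (inp v).Nodup) (r : ℕ) (v : Fin n) :
    (cfg (r + 1) v).st.sent = if r % n = v then
      min ((cfg r v).st.sent + c) (cfg r v).known.length else (cfg r v).st.sent := by
  have hnext : (cfg (r + 1) v).st.sent = if (cfg r v).st.round % n = v then
      min ((cfg r v).st.sent + c) (cfg r v).st.count else (cfg r v).st.sent := by
    rw [run_succ]
    rcases reception (G r) (transmission (pipeline n c) (cfg r) (ω r)) v with _ | p <;> rfl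
  rw [hnext, pipeline_round, pipeline_count inp G ω hinp]

theorem pipeline_sent_le (hinp : ∀ v, (inp v).Nodup) (r : ℕ) (v : Fin n) :
    (cfg r v).st.sent ≤ (cfg r v).known.length := by
  induction r with
  | zero => exact Nat.zero_le _
  | succ r ih =>
    have := (run_known_prefix (pipeline n c) inp G ω (Nat.le_add_right r 1) v).length_le
    rw [pipeline_sent_succ inp G ω hinp]
    split_ifs <;> omega

theorem pipeline_sent_mono (hinp : ∀ v, (inp v).Nodup) (v : Fin n) :
    Monotone fun r => (cfg r v).st.sent := by
  refine monotone_nat_of_le_succ fun r => ?_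
  have := pipeline_sent_le inp G ω hinp r v
  rw [pipeline_sent_succ inp G ω hinp]
  split_ifs <;> omega

theorem pipeline_reception {u v : Fin n} {r : ℕ} (huv : (G r).Adj v u) (hturn : r % n = u) :
    reception (G r) (transmission (pipeline n c) (cfg r) (ω r)) v =
      some ⟨((List.range c).map ((cfg r u).st.sent + ·)).filterMap
        fun i => (cfg r u).known[i]?, []⟩ := by
  refine reception_of_sole_transmitter ((transmission_eq_some _).2
    ⟨⟨(List.range c).map ((cfg r u).st.sent + ·), []⟩, ?_, rfl⟩) (fun w hw => ?_) huv
  · rw [pipeline_send, pipeline_round, if_pos hturn]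
  · rw [transmission_eq_none, pipeline_send, pipeline_round, hturn]
    exact if_neg fun h => hw (Fin.ext h.symm)

theorem pipeline_sent_subset_known (hinp : ∀ v, (inp v).Nodup) {u v : Fin n}
    (huv : ∀ r, (G r).Adj v u) (r : ℕ) :
    (cfg r u).known.take (cfg r u).st.sent ⊆ (cfg r v).known := by
  induction r with
  | zero => exact List.nil_subset _
  | succ r ih =>
    have hpre (v : Fin n) := run_known_prefix (pipeline n c) inp G ω (Nat.le_add_right r 1) v
    have htake {a : ℕ} (ha : a ≤ (cfg r u).known.length) :
        (cfg (r + 1) u).known.take a = (cfg r u).known.take a := by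
      obtain ⟨l, hl⟩ := hpre u
      rw [← hl, List.take_append_of_le_length ha]
    rw [pipeline_sent_succ inp G ω hinp]
    split_ifs with hturn
    · rw [htake (min_le_right _ _), ← List.take_take, List.take_length]
      intro m hm
      rcases mem_take_or_mem_filterMap_of_mem_take_add hm with hold | hnew
      · exact (hpre v).subset (ih hold)
      · rw [run_succ, pipeline_reception inp G ω (huv r) hturn]
        exact mem_learn.2 (Or.inr hnew)
    · rw [htake (pipeline_sent_le inp G ω hinp r u)]
      exact List.Subset.trans ih (hpre v).subset

theorem pipeline_sent_le_known_length (hinp : ∀ v, (inp v).Nodup) {u v : Fin n}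
    (huv : ∀ r, (G r).Adj v u) (r : ℕ) : (cfg r u).st.sent ≤ (cfg r v).known.length := by
  have hnodup := (run_known_nodup (pipeline n c) inp G ω hinp r u).sublist
    (List.take_sublist (cfg r u).st.sent _)
  have hle := (hnodup.subperm (pipeline_sent_subset_known inp G ω hinp huv r)).length_le
  rwa [List.length_take, min_eq_left (pipeline_sent_le inp G ω hinp _ _)] at hle

theorem le_pipeline_sent_phase (hinp : ∀ v, (inp v).Nodup) (τ : ℕ) (v : Fin n) :
    min ((cfg (n * τ) v).st.sent + c) (cfg (n * τ) v).known.length ≤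
      (cfg (n * (τ + 1)) v).st.sent := by
  have hturn := pipeline_sent_succ inp G ω hinp (n * τ + v) v
  rw [Nat.mul_add_mod, Nat.mod_eq_of_lt v.2, if_pos rfl] at hturn
  have hlast : n * τ + v + 1 ≤ n * (τ + 1) := by
    rw [Nat.mul_succ]
    exact Nat.add_le_add_left v.2 _
  calc min ((cfg (n * τ) v).st.sent + c) (cfg (n * τ) v).known.length
      ≤ min ((cfg (n * τ + v) v).st.sent + c) (cfg (n * τ + v) v).known.length :=
        min_le_min
          (Nat.add_le_add_right (pipeline_sent_mono inp G ω hinp v (Nat.le_add_right _ _)) c)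
          (run_known_prefix (pipeline n c) inp G ω (Nat.le_add_right _ _) v).length_le
    _ = (cfg (n * τ + v + 1) v).st.sent := hturn.symm
    _ ≤ _ := pipeline_sent_mono inp G ω hinp v hlast

theorem pipeline_sent_progress (hinp : ∀ v, (inp v).Nodup) {X : List M} {d : ℕ} (v : Fin n)
    (hknown : ∀ τ, X ⊆ (cfg (n * τ) v).known ∨ c * (τ + 1) ≤ (cfg (n * τ) v).known.length + d)
    (τ : ℕ) : X ⊆ (cfg (n * τ) v).known.take (cfg (n * τ) v).st.sent ∨
      c * τ ≤ (cfg (n * τ) v).st.sent + d := by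
  induction τ with
  | zero => exact Or.inr (Nat.zero_le _)
  | succ τ ih =>
    have hphase := le_pipeline_sent_phase inp G ω hinp τ v
    have hτ : n * τ ≤ n * (τ + 1) := Nat.mul_le_mul_left n τ.le_succ
    have hpre := run_known_prefix (pipeline n c) inp G ω hτ v
    rcases ih with hX | hle
    · exact Or.inl (List.Subset.trans hX
        (take_subset_take hpre (pipeline_sent_mono inp G ω hinp v hτ)))
    rcases le_total ((cfg (n * τ) v).st.sent + c) (cfg (n * τ) v).known.length with hmore | hall
    · rw [min_eq_left hmore] at hphase
      exact Or.inr (by rw [Nat.mul_add_one]; omega)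
    rw [min_eq_right hall] at hphase
    rcases hknown τ with hX | hle'
    · refine Or.inl (List.Subset.trans hX ?_)
      simpa only [List.take_length] using take_subset_take hpre hphase
    · exact Or.inr (by omega)

theorem pipeline_known_progress (hinp : ∀ v, (inp v).Nodup) {H : SimpleGraph (Fin n)}
    (hH : ∀ r u v, H.Adj u v → (G r).Adj u v) {u v : Fin n} (p : H.Walk v u) (τ : ℕ) :
    inp u ⊆ (cfg (n * τ) v).known ∨
      c * (τ + 1) ≤ (cfg (n * τ) v).known.length + c * p.length := by
  induction p generalizing τ with
  | nil => exact Or.inl (run_known_prefix (pipeline n c) inp G ω (Nat.zero_le _) _).subset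
  | @cons v w u hvw p ih =>
    have hadj (r : ℕ) : (G r).Adj v w := hH r v w hvw
    refine (pipeline_sent_progress inp G ω hinp w ih τ).imp
      (fun hsent => List.Subset.trans hsent (pipeline_sent_subset_known inp G ω hinp hadj _))
      fun hle => ?_
    have := pipeline_sent_le_known_length inp G ω hinp hadj (n * τ)
    rw [SimpleGraph.Walk.length_cons, Nat.mul_succ, Nat.mul_succ]
    omega

theorem pipeline_disseminated {s : ℕ} (hc : 1 ≤ c) (hinp : IsInput inp s) {H : SimpleGraph (Fin n)}
    (hconn : H.Connected) (hH : ∀ r u v, H.Adj u v → (G r).Adj u v) :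
    Disseminated inp (cfg (n * (n + s / c))) := by
  intro u v m hm
  obtain ⟨p, hp⟩ := (hconn.preconnected v u).exists_isPath
  have hlen : p.length < n := by simpa using hp.length_lt
  refine (pipeline_known_progress inp G ω hinp.nodup hH p (n + s / c)).elim (fun h => h hm)
    fun hle => absurd hle (not_le.2 ?_)
  calc (cfg (n * (n + s / c)) v).known.length + c * p.length
      ≤ s + c * p.length :=
        Nat.add_le_add_right (run_known_length_le (pipeline n c) inp G ω hinp _ v) _
    _ < c * (s / c + 1) + c * n :=
        Nat.add_lt_add_of_lt_of_le (Nat.lt_mul_div_succ s hc) (Nat.mul_le_mul_left c hlen.le)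
    _ = c * (n + s / c + 1) := by ring

theorem pipeline_solves {s B : ℕ} {p : ℝ} (hc : 1 ≤ c) (hp : p ≤ 1) :
    Solves (pipeline n c) ⊤ 0 s B (n * (n + s / c)) p := by
  intro inp adv hinp _ hconn
  refine (hp.trans (sub_zero 1).ge).trans (le_coinMeasure_of_compl_subset _ le_rfl (bad := ∅)
    (fun ω _ => ?_) (by simp only [measure_empty, zero_le]))
  exact pipeline_disseminated inp (adv ω) ω hc hinp (hconn ω 0) fun r u v h => stableGraph_adj h r

end Pipeline

section Slots

variable {n s : ℕ} {M : Type} [DecidableEq M] (A : Algorithm n) (inp : Fin n → List M)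
  (G : ℕ → SimpleGraph (Fin n)) (ω : ℕ → Fin n → A.Coin)

theorem exists_slot_of_mem_inp (hinp : IsInput inp s) {a : Fin n} {msg : M} (hmsg : msg ∈ inp a)
    (R : ℕ) : ∃ k : Fin n → Fin s, ∀ v, ∀ r ≤ R, msg ∈ (run A inp G ω r v).known →
      (run A inp G ω r v).known[(k v).val]? = some msg := by
  have hlt {r : ℕ} {v : Fin n} (hmem : msg ∈ (run A inp G ω r v).known) :
      (run A inp G ω r v).known.idxOf msg < s :=
    (List.idxOf_lt_length_of_mem hmem).trans_le (run_known_length_le A inp G ω hinp r v)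
  have hs : 0 < s := (Nat.zero_le _).trans_lt (hlt (r := 0) (v := a) hmsg)
  refine ⟨fun v => if h : (run A inp G ω R v).known.idxOf msg < s then ⟨_, h⟩ else ⟨0, hs⟩,
    fun v r hr hmem => ?_⟩
  obtain ⟨l, hl⟩ := run_known_prefix A inp G ω hr v
  have hidx : (run A inp G ω R v).known.idxOf msg = (run A inp G ω r v).known.idxOf msg := by
    rw [← hl, List.idxOf_append_of_mem hmem]
  simp only [hidx, hlt hmem, dite_true]
  exact List.getElem?_idxOf hmem

theorem known_length_le_of_getElem?_eq_some {r r' : ℕ} (hr : r' ≤ r) {v : Fin n} {i : ℕ} {msg : M}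
    (hi : (run A inp G ω r v).known[i]? = some msg) (hnot : msg ∉ (run A inp G ω r' v).known) :
    (run A inp G ω r' v).known.length ≤ i := by
  by_contra! hlt
  have hi' := getElem?_of_prefix (run_known_prefix A inp G ω hr v) (List.getElem?_eq_getElem hlt)
  exact hnot (Option.some.inj (hi'.symm.trans hi) ▸ List.getElem_mem hlt)

end Slots

section UnionBound

theorem measure_iUnion_le_ofReal {Ω ι : Type*} {_ : MeasurableSpace Ω} {μ : Measure Ω} [Fintype ι]
    {S : ι → Set Ω} {δ ε : ℝ} (hS : ∀ i, μ (S i) ≤ ENNReal.ofReal δ)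
    (hε : Fintype.card ι * δ ≤ ε) : μ (⋃ i, S i) ≤ ENNReal.ofReal ε := by
  calc μ (⋃ i, S i) ≤ ∑ i, μ (S i) := measure_iUnion_fintype_le μ S
    _ ≤ Fintype.card ι • ENNReal.ofReal δ := Finset.sum_le_card_nsmul _ _ _ fun i _ => hS i
    _ = ENNReal.ofReal (Fintype.card ι * δ) := by
        rw [nsmul_eq_mul, ENNReal.ofReal_mul (Nat.cast_nonneg _), ENNReal.ofReal_natCast]
    _ ≤ ENNReal.ofReal ε := ENNReal.ofReal_le_ofReal hε

end UnionBound

section Multi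

/-- The state of a process of `harmonicMulti`: the number of the round, and for each known broadcast
message the round in which it became known. -/
structure MultiState where
  round : ℕ
  wake : List ℕ

/-- The wake-up rounds of the agents, where the agent `i` of a node handles the message with
handle `i`. -/
abbrev multiWake {n s : ℕ} {M : Type} (conf : Fin n → NodeConfig MultiState M) (u : Fin n)
    (i : Fin s) : Option ℕ :=
  (conf u).st.wake[i.val]?

open Classical in
/-- Harmonic broadcast of all messages in parallel: each known message of a node is an agent of
its own. -/
noncomputable abbrev harmonicMulti (n s N Θ : ℕ) [NeZero N] : Algorithm n :=
  slotAlgorithm n s N Unit MultiState (fun _ k => ⟨0, List.replicate k 0⟩)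
    (fun _ st x =>
      if h : ∃ i, (x.1 i).val < threshold N Θ st.wake[i.val]? st.round then
        some ⟨[h.choose.val], []⟩ else none)
    (fun _ st _ y =>
      { round := st.round + 1
        wake := st.wake ++ List.replicate
          ((y.elim st.wake.length fun p => (p.msgs.map (· + 1)).foldr max st.wake.length) -
            st.wake.length) (st.round + 1) })

theorem harmonicMulti_hasCapacity (n s N Θ b : ℕ) [NeZero N] :
    (harmonicMulti n s N Θ).HasCapacity 1 b := by
  intro v st x p hsend
  simp only at hsend
  split_ifs at hsend
  obtain rfl := Option.some.inj hsend
  simp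

variable {n s N Θ : ℕ} [NeZero N] {M : Type} [DecidableEq M] (inp : Fin n → List M)
  (G : ℕ → SimpleGraph (Fin n)) (ω : ℕ → Fin n → SlotCoin s N Unit)

local notation "cfg" => run (harmonicMulti n s N Θ) inp G ω

theorem multi_round (r : ℕ) (v : Fin n) : (cfg r v).st.round = r := by
  induction r with
  | zero => rfl
  | succ r ih =>
    rw [run_succ]
    rcases reception (G r) (transmission (harmonicMulti n s N Θ) (cfg r) (ω r)) v with _ | _ <;>
      exact congrArg (· + 1) ih

theorem multi_wake_succ_of_length (hinp : ∀ v, (inp v).Nodup) (r : ℕ) (v : Fin n)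
    (hlen : (cfg r v).st.wake.length = (cfg r v).known.length) :
    (cfg (r + 1) v).st.wake = (cfg r v).st.wake ++ List.replicate
      ((cfg (r + 1) v).known.length - (cfg r v).known.length) (r + 1) := by
  have hround := multi_round (Θ := Θ) inp G ω r v
  rw [run_succ]
  rcases reception (G r) (transmission (harmonicMulti n s N Θ) (cfg r) (ω r)) v with _ | p
  · simp only [updateNode, Option.elim_none, Nat.sub_self, List.replicate_zero]
  · have hcount := foldr_max_idxOf_learn
      (run_known_nodup (harmonicMulti n s N Θ) inp G ω hinp r v) p.msgs
    simp only [updateNode, Option.elim_some]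
    rw [← hcount, ← hlen, hround]

theorem multi_wake_length (hinp : ∀ v, (inp v).Nodup) (r : ℕ) (v : Fin n) :
    (cfg r v).st.wake.length = (cfg r v).known.length := by
  induction r with
  | zero => simp [run]
  | succ r ih =>
    have := (run_known_prefix (harmonicMulti n s N Θ) inp G ω (Nat.le_add_right r 1) v).length_le
    rw [multi_wake_succ_of_length inp G ω hinp r v ih, List.length_append, List.length_replicate]
    omega

theorem multi_isWake (hinp : ∀ v, (inp v).Nodup) (T : ℕ) (v : Fin n) (i : ℕ) :
    IsWake (fun r => (cfg r v).st.wake[i]?) 0 T := by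
  refine isWake_of_step ?_ fun r _ _ => ?_
  · simp only [run, List.getElem?_replicate]
    split_ifs
    exacts [Or.inr rfl, Or.inl rfl]
  · rw [multi_wake_succ_of_length inp G ω hinp r v (multi_wake_length inp G ω hinp r v)]
    rcases lt_or_ge i (cfg r v).st.wake.length with hi | hi
    · exact Or.inl (List.getElem?_append_left hi)
    · rw [List.getElem?_append_right hi, List.getElem?_replicate, List.getElem?_eq_none hi]
      split_ifs
      exacts [Or.inr ⟨rfl, rfl⟩, Or.inl rfl]

theorem multi_wake_eq_none_iff (hinp : ∀ v, (inp v).Nodup) {r : ℕ} {v : Fin n} {i : ℕ} :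
    (cfg r v).st.wake[i]? = none ↔ (cfg r v).known.length ≤ i := by
  rw [List.getElem?_eq_none_iff, multi_wake_length inp G ω hinp]

theorem multi_transmission_of_onlyFires {r : ℕ} {v : Fin n} {k : Fin s}
    (hfire : OnlyFires Θ (multiWake (cfg r)) r v k (ω r)) :
    transmission (harmonicMulti n s N Θ) (cfg r) (ω r) v =
      some ⟨[k.val].filterMap fun i => (cfg r v).known[i]?, []⟩ := by
  have hround := multi_round (Θ := Θ) inp G ω r v
  refine (transmission_eq_some _).2 ⟨⟨[k.val], []⟩, ?_, rfl⟩
  have hex : ∃ i : Fin s, ((ω r v).1 i).val <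
      threshold N Θ (cfg r v).st.wake[i.val]? (cfg r v).st.round := by
    rw [hround]
    exact ⟨k, (hfire v k).2 ⟨rfl, rfl⟩⟩
  have hchoose : hex.choose = k :=
    ((hfire v _).1 (hex.choose_spec.trans_eq (congrArg (threshold N Θ _) hround))).2
  refine (dif_pos hex).trans ?_
  rw [hchoose]

theorem multi_transmission_eq_none_of_onlyFires {r : ℕ} {u v : Fin n} {k : Fin s}
    (hfire : OnlyFires Θ (multiWake (cfg r)) r v k (ω r)) (huv : u ≠ v) :
    transmission (harmonicMulti n s N Θ) (cfg r) (ω r) u = none := by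
  refine (transmission_eq_none _).2 (dif_neg ?_)
  rintro ⟨i, hi⟩
  rw [multi_round] at hi
  exact huv ((hfire u i).1 hi).1

theorem multi_mem_known_of_onlyFires {r : ℕ} {u v : Fin n} {k : Fin s} {msg : M}
    (hfire : OnlyFires Θ (multiWake (cfg r)) r v k (ω r))
    (hk : (cfg r v).known[k.val]? = some msg) (huv : (G r).Adj u v) :
    msg ∈ (cfg (r + 1) u).known := by
  rw [run_succ, reception_of_sole_transmitter (multi_transmission_of_onlyFires inp G ω hfire)
    (fun w hw => multi_transmission_eq_none_of_onlyFires inp G ω hfire hw) huv]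
  exact mem_learn.2 (Or.inr (List.mem_filterMap.2 ⟨k.val, List.mem_singleton_self _, hk⟩))

theorem multi_disseminated {H : SimpleGraph (Fin n)} (hH : H.Connected)
    (hHG : ∀ r u v, H.Adj u v → (G r).Adj u v) (hinp : IsInput inp s) (hΘ : 0 < Θ) {m : ℕ}
    (hm : 0 < m) (hlong : 4 * (n * s * (harmonic m : ℚ)) < (m : ℝ))
    (hprogress : ∀ v k, ¬ Starves Θ 0 (Θ * m) (fun r => multiWake (cfg r)) ω v k) :
    Disseminated inp (cfg (Θ * m)) := by
  intro a b msg hmsg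
  obtain ⟨T, hT⟩ : ∃ T, Θ * m = T + 1 := Nat.exists_eq_add_one.2 (Nat.mul_pos hΘ hm)
  obtain ⟨k, hk⟩ := exists_slot_of_mem_inp (harmonicMulti n s N Θ) inp G ω hinp hmsg T
  have hmono {r r' : ℕ} (h : r ≤ r') (v : Fin n) (hv : msg ∈ (cfg r v).known) :
      msg ∈ (cfg r' v).known :=
    (run_known_prefix (harmonicMulti n s N Θ) inp G ω h v).subset hv
  have hall : {v | msg ∈ (cfg T v).known} = Set.univ := by
    refine informed_eq_univ_of_long_window (m := m) (I := fun r => {v | msg ∈ (cfg r v).known})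
      (NeZero.ne N) hΘ T.zero_le (by omega) hH (fun r _ r' _ h v => hmono h v) ⟨a, hmsg⟩ k
      (fun u i => multi_isWake inp G ω hinp.nodup (T + 1) u i) (fun v w hw hjoin => ?_)
      (fun v r _ hr hv hfire u hvu =>
        multi_mem_known_of_onlyFires inp G ω hfire (hk v r hr.le hv) (hHG r u v hvu.symm))
      (hT ▸ fun v => hprogress v (k v)) (s := Finset.univ) (by simp) ?_
    · have hslot := hk v w hw hjoin.mem
      refine (multi_isWake inp G ω hinp.nodup (T + 1) v (k v)).eq_some_self w.zero_le (by omega)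
        ?_ fun r hr hrw => ?_
      · rw [ne_eq, multi_wake_eq_none_iff inp G ω hinp.nodup, not_le]
        exact (List.getElem?_eq_some_iff.1 hslot).1
      · exact (multi_wake_eq_none_iff inp G ω hinp.nodup).2
          (known_length_le_of_getElem?_eq_some (harmonicMulti n s N Θ) inp G ω hrw.le hslot
            (hjoin.notMem r hr hrw))
    · rw [Finset.card_univ, Fintype.card_prod, Fintype.card_fin, Fintype.card_fin, Nat.sub_zero,
        ← hT]
      push_cast
      have hΘ' : (0 : ℝ) < Θ := by exact_mod_cast hΘ
      nlinarith
  exact hmono (by omega) b (hall ▸ Set.mem_univ b : b ∈ {v | msg ∈ (cfg T v).known})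

theorem harmonicMulti_solves {B : ℕ} {ε : ℝ} (hΘ : 0 < Θ) {m : ℕ} (hm : 0 < m)
    (hdvd : ∀ j, 1 ≤ j → j ≤ Θ * m → j ∣ N) (hlong : 4 * (n * s * (harmonic m : ℚ)) < (m : ℝ))
    (hε : n * s * Real.exp (-(Θ / 8)) ≤ ε) :
    Solves (harmonicMulti n s N Θ) ⊤ 0 s B (Θ * m) (1 - ε) := by
  intro inp adv hinp hobl hconn
  let W (ω : ℕ → Fin n → SlotCoin s N Unit) (r : ℕ) : Fin n → Fin s → Option ℕ :=
    multiWake (run (harmonicMulti n s N Θ) inp (adv ω) ω r)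
  have hW (r : ℕ) : DependsOn (fun ω => W ω r) (Set.Iio r) := fun ω ω' h => by
    have hrun := run_dependsOn (harmonicMulti n s N Θ) inp hobl r h
    simp only at hrun
    simp only [W, hrun]
  refine le_coinMeasure_of_compl_subset _ (le_trans (by positivity) hε)
    (bad := ⋃ a : Fin n × Fin s, {ω | Starves Θ 0 (Θ * m) (W ω) ω a.1 a.2}) (fun ω hω => ?_)
    (measure_iUnion_le_ofReal (fun a => coinMeasure_starves_le Θ 0 hdvd hW a.1 a.2)
      (by simpa using hε))
  simp only [Set.mem_compl_iff, Set.mem_iUnion, Prod.exists, not_exists] at hω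
  exact multi_disseminated inp (adv ω) ω (hconn ω 0) (fun r u v h => stableGraph_adj h r) hinp hΘ
    hm hlong hω

end Multi

section Handles

variable {M : Type} {known known' : List M} {l l' : List ℕ} {X : Set M}

/-- All messages in `X` are among the known messages with handles in `l`. -/
def Covers (known : List M) (l : List ℕ) (X : Set M) : Prop :=
  ∀ m ∈ X, ∃ i ∈ l, known[i]? = some m

theorem Covers.mono (h : Covers known l X) (hk : known <+: known') (hl : l ⊆ l') :
    Covers known' l' X := fun m hm =>
  let ⟨i, hi, him⟩ := h m hm
  ⟨i, hl hi, getElem?_of_prefix hk him⟩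

theorem covers_map_idxOf [DecidableEq M] {ms : List M} (hms : ms ⊆ known) (hX : ∀ m ∈ X, m ∈ ms) :
    Covers known (ms.map fun m => known.idxOf m) X := fun m hm =>
  ⟨known.idxOf m, List.mem_map.2 ⟨m, hX m hm, rfl⟩, List.getElem?_idxOf (hms (hX m hm))⟩

/-- `i` is the handle of a message in `X`. -/
def IsHandleOf (known : List M) (X : Set M) (i : ℕ) : Prop :=
  ∃ m ∈ X, known[i]? = some m

theorem IsHandleOf.mono {i : ℕ} (h : IsHandleOf known X i) (hk : known <+: known') :
    IsHandleOf known' X i :=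
  let ⟨m, hm, him⟩ := h
  ⟨m, hm, getElem?_of_prefix hk him⟩

theorem length_le_encard_of_isHandleOf (hknown : known.Nodup) (hl : l.Nodup)
    (hX : ∀ i ∈ l, IsHandleOf known X i) : (l.length : ℕ∞) ≤ X.encard := by
  rw [← List.toFinset_card_of_nodup hl, ← Set.encard_coe_eq_coe_finsetCard,
    ← (Option.some_injective M).encard_image]
  refine Set.encard_le_encard_of_injOn (f := fun i => known[i]?) (fun i hi => ?_)
    fun i hi j _ hij => ?_
  · obtain ⟨m, hm, him⟩ := hX i (List.mem_toFinset.1 hi)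
    exact ⟨m, hm, him.symm⟩
  · obtain ⟨m, -, him⟩ := hX i (List.mem_toFinset.1 hi)
    exact (List.getElem?_inj (List.getElem?_eq_some_iff.1 him).1 hknown).1 hij

/-- The entries of a list at the positions `j * c, …, j * c + c - 1`. -/
def chunk (c j : ℕ) (l : List ℕ) : List ℕ :=
  (l.drop (j * c)).take c

theorem chunk_subset (c j : ℕ) (l : List ℕ) : chunk c j l ⊆ l := fun _ hi =>
  List.mem_of_mem_drop (List.mem_of_mem_take hi)

theorem take_chunk (c j : ℕ) (l : List ℕ) : (chunk c j l).take c = chunk c j l := by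
  rw [chunk, List.take_take, min_self]

theorem getElem_mem_chunk {c a : ℕ} (hc : 0 < c) (ha : a < l.length) :
    l[a] ∈ chunk c (a / c) l := by
  have hdiv := Nat.div_add_mod' a c
  have hmod := Nat.mod_lt a hc
  refine List.mem_iff_getElem.2 ⟨a % c, ?_, ?_⟩
  · rw [chunk, List.length_take, List.length_drop]
    omega
  · simp only [chunk, List.getElem_take, List.getElem_drop, hdiv]

theorem Covers.exists_chunk {c g : ℕ} (h : Covers known l X) (hl : l.length ≤ c * (g + 1))
    (hX : g = 0 ∨ X.Subsingleton) : ∃ j : Fin (g + 1), Covers known (chunk c j l) X := by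
  rcases X.eq_empty_or_nonempty with rfl | ⟨m, hm⟩
  · exact ⟨0, fun m hm => absurd hm (Set.notMem_empty m)⟩
  rcases hX with rfl | hX
  · refine ⟨0, ?_⟩
    rw [chunk, List.take_of_length_le (by simpa using hl)]
    simpa using h
  · obtain ⟨i, hi, him⟩ := h m hm
    obtain ⟨a, ha, rfl⟩ := List.getElem_of_mem hi
    have hc : 0 < c := Nat.pos_of_mul_pos_right (ha.pos.trans_le hl)
    have hac : a / c < g + 1 := by rw [Nat.div_lt_iff_lt_mul hc, mul_comm]; omega
    exact ⟨⟨a / c, hac⟩, fun m' hm' => ⟨l[a], getElem_mem_chunk hc ha, hX hm' hm ▸ him⟩⟩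

end Handles

section Sampling

/-- State of a process of `samplingBroadcast`: `count` is the number of its initial messages, `pool`
the handles of the known messages of the current epoch, `bundle` the handles of the messages that
it spreads in the current broadcast if it is awake, `act` the round in which it woke up. -/
structure SamplingState where
  round : ℕ
  count : ℕ
  pool : List ℕ
  act : Option ℕ
  bundle : List ℕ

/-- The pool at the start of a round. Every `P` rounds a new epoch starts, and in epoch `e` the pool
starts with the initial messages whose handle is `e` modulo `E`. -/
def SamplingState.currentPool (P E : ℕ) (st : SamplingState) : List ℕ :=
  if P ∣ st.round then (List.range st.count).filter fun i => i % E = st.round / P else st.pool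

/-- The random choices of a node in a selection round: it is a source if the first component is
`0`, and then the second component is the number of the chunk that it spreads. -/
abbrev SelectionCoin (n g : ℕ) : Type := Fin (2 * n + 1) × Fin (g + 1)

open Classical in
/-- In a selection round each node becomes a source with probability `1 / (2 * n + 1)`. A source
wakes up and chooses a chunk of its pool. In the other rounds the awake nodes spread their
bundles by a harmonic broadcast. -/
noncomputable def samplingNext (n c g P E : ℕ) (sel : ℕ → Prop) (st : SamplingState)
    (d : SelectionCoin n g) (y : Option (Packet ℕ)) : SamplingState :=
  if sel st.round then
    { round := st.round + 1
      count := st.count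
      pool := st.currentPool P E
      act := if d.1 = 0 then some (st.round + 1) else none
      bundle := chunk c d.2 (st.currentPool P E) }
  else
    { round := st.round + 1
      count := st.count
      pool := y.elim st.pool fun p => learn st.pool p.msgs
      act := y.elim st.act fun _ => some (st.act.getD (st.round + 1))
      bundle := y.elim st.bundle fun p => if st.act = none then p.msgs else st.bundle }

open Classical in
/-- A sequence of broadcasts from random sources: in the course of an epoch, the messages of the
epoch spread to more and more nodes. -/
noncomputable abbrev samplingBroadcast (n c g P E N Θ : ℕ) [NeZero N] (sel : ℕ → Prop) :
    Algorithm n :=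
  slotAlgorithm n 1 N (SelectionCoin n g) SamplingState
    (fun _ k => ⟨0, k, [], none, []⟩)
    (fun _ st x =>
      if ¬ sel st.round ∧ (x.1 0).val < threshold N Θ st.act st.round then
        some ⟨st.bundle.take c, []⟩ else none)
    (fun _ st x y => samplingNext n c g P E sel st x.2 y)

theorem samplingBroadcast_hasCapacity (n c g P E N Θ b : ℕ) [NeZero N] (sel : ℕ → Prop) :
    (samplingBroadcast n c g P E N Θ sel).HasCapacity c b := by
  intro v st x p hsend
  simp only at hsend
  split_ifs at hsend
  obtain rfl := Option.some.inj hsend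
  simp

variable {n c g P E N Θ : ℕ} [NeZero N] {sel : ℕ → Prop} {M : Type} [DecidableEq M]
  (inp : Fin n → List M) (G : ℕ → SimpleGraph (Fin n))
  (ω : ℕ → Fin n → SlotCoin 1 N (SelectionCoin n g))

local notation "alg" => samplingBroadcast n c g P E N Θ sel

local notation "cfg" => run (samplingBroadcast n c g P E N Θ sel) inp G ω

theorem sampling_st_succ (r : ℕ) (v : Fin n) :
    ∃ y, (cfg (r + 1) v).st = samplingNext n c g P E sel (cfg r v).st (ω r v).2 y := by
  rw [run_succ]
  rcases reception (G r) (transmission alg (cfg r) (ω r)) v with _ | p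
  exacts [⟨none, rfl⟩, ⟨some _, rfl⟩]

theorem sampling_round (r : ℕ) (v : Fin n) : (cfg r v).st.round = r := by
  induction r with
  | zero => rfl
  | succ r ih =>
    obtain ⟨y, hy⟩ := sampling_st_succ (c := c) (P := P) (E := E) (Θ := Θ) (sel := sel) inp G ω r v
    rw [hy, samplingNext]
    split_ifs <;> exact congrArg (· + 1) ih

theorem sampling_count (r : ℕ) (v : Fin n) : (cfg r v).st.count = (inp v).length := by
  induction r with
  | zero => rfl
  | succ r ih =>
    obtain ⟨y, hy⟩ := sampling_st_succ (c := c) (P := P) (E := E) (Θ := Θ) (sel := sel) inp G ω r v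
    rw [hy, samplingNext]
    split_ifs <;> exact ih

theorem sampling_currentPool_of_dvd {r : ℕ} (hr : P ∣ r) (v : Fin n) :
    (cfg r v).st.currentPool P E =
      (List.range (inp v).length).filter fun i => i % E = r / P := by
  rw [SamplingState.currentPool, sampling_round, sampling_count, if_pos hr]

theorem sampling_currentPool_of_not_dvd {r : ℕ} (hr : ¬ P ∣ r) (v : Fin n) :
    (cfg r v).st.currentPool P E = (cfg r v).st.pool := by
  rw [SamplingState.currentPool, sampling_round, if_neg hr]

theorem sampling_of_transmission {r : ℕ} {v : Fin n} {p : Packet M}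
    (h : transmission alg (cfg r) (ω r) v = some p) :
    ¬ sel r ∧ (cfg r v).st.act ≠ none ∧
      p.msgs = ((cfg r v).st.bundle.take c).filterMap fun i => (cfg r v).known[i]? := by
  obtain ⟨p', hsend, rfl⟩ := (transmission_eq_some _).1 h
  simp only at hsend
  split_ifs at hsend with hfires
  obtain rfl := Option.some.inj hsend
  rw [sampling_round] at hfires
  refine ⟨hfires.1, fun hnone => ?_, rfl⟩
  rw [hnone] at hfires
  exact absurd hfires.2 (by simp [threshold])

theorem exists_awake_sender_of_reception {r : ℕ} {v : Fin n} {p : Packet M}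
    (h : reception (G r) (transmission alg (cfg r) (ω r)) v = some p) :
    ∃ u, (cfg r u).st.act ≠ none ∧
      p.msgs = ((cfg r u).st.bundle.take c).filterMap fun i => (cfg r u).known[i]? :=
  let ⟨u, _, hu⟩ := exists_transmitter_of_reception h
  ⟨u, (sampling_of_transmission inp G ω hu).2⟩

theorem sampling_succ_of_sel {r : ℕ} (hr : sel r) (v : Fin n) :
    cfg (r + 1) v =
      { known := (cfg r v).known
        st :=
          { round := r + 1
            count := (cfg r v).st.count
            pool := (cfg r v).st.currentPool P E
            act := if (ω r v).2.1 = 0 then some (r + 1) else none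
            bundle := chunk c (ω r v).2.2 ((cfg r v).st.currentPool P E) } } := by
  have hrec : reception (G r) (transmission alg (cfg r) (ω r)) v = none := by
    by_contra hne
    obtain ⟨p, hp⟩ := Option.ne_none_iff_exists'.1 hne
    obtain ⟨u, -, hu⟩ := exists_transmitter_of_reception hp
    exact (sampling_of_transmission inp G ω hu).1 hr
  have hsel : sel (cfg r v).st.round := by rwa [sampling_round]
  rw [run_succ, hrec]
  simp only [updateNode, samplingNext, if_pos hsel, sampling_round]

theorem sampling_succ_of_silence {r : ℕ} (hr : ¬ sel r) {v : Fin n}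
    (h : reception (G r) (transmission alg (cfg r) (ω r)) v = none) :
    cfg (r + 1) v =
      { known := (cfg r v).known
        st := { (cfg r v).st with round := r + 1 } } := by
  have hsel : ¬ sel (cfg r v).st.round := by rwa [sampling_round]
  rw [run_succ, h]
  simp only [updateNode, samplingNext, if_neg hsel, sampling_round, Option.elim_none]

theorem sampling_succ_of_packet {r : ℕ} (hr : ¬ sel r) {v : Fin n} {p : Packet M}
    (h : reception (G r) (transmission alg (cfg r) (ω r)) v = some p) :
    cfg (r + 1) v =
      let handles := p.msgs.map fun m => (learn (cfg r v).known p.msgs).idxOf m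
      { known := learn (cfg r v).known p.msgs
        st :=
          { round := r + 1
            count := (cfg r v).st.count
            pool := learn (cfg r v).st.pool handles
            act := some ((cfg r v).st.act.getD (r + 1))
            bundle := if (cfg r v).st.act = none then handles else (cfg r v).st.bundle } } := by
  have hsel : ¬ sel (cfg r v).st.round := by rwa [sampling_round]
  rw [run_succ, h]
  simp only [updateNode, samplingNext, if_neg hsel, sampling_round, Option.elim_some]

theorem sampling_pool_subset {r : ℕ} (hr : ¬ sel r) (v : Fin n) :
    (cfg r v).st.pool ⊆ (cfg (r + 1) v).st.pool := by
  rcases hy : reception (G r) (transmission alg (cfg r) (ω r)) v with _ | p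
  · rw [sampling_succ_of_silence inp G ω hr hy]
    exact List.Subset.refl _
  · rw [sampling_succ_of_packet inp G ω hr hy]
    exact (prefix_learn _ _).subset

end Sampling

section Epochs

variable {n c g P E N Θ : ℕ} [NeZero N] {sel : ℕ → Prop} {M : Type} [DecidableEq M]
  (inp : Fin n → List M) (G : ℕ → SimpleGraph (Fin n))
  (ω : ℕ → Fin n → SlotCoin 1 N (SelectionCoin n g))

local notation "alg" => samplingBroadcast n c g P E N Θ sel

local notation "cfg" => run (samplingBroadcast n c g P E N Θ sel) inp G ω

/-- The messages of epoch `e`. -/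
def epochMessages {M : Type} (E : ℕ) (inp : Fin n → List M) (e : ℕ) : Set M :=
  {m | ∃ u j, (inp u)[j]? = some m ∧ j % E = e}

/-- The pool and the bundle of a node hold only handles of messages in `X`. -/
structure HoldsOnly {M : Type} (X : Set M) (nc : NodeConfig SamplingState M) : Prop where
  nodup : nc.st.pool.Nodup
  pool : ∀ i ∈ nc.st.pool, IsHandleOf nc.known X i
  bundle : ∀ i ∈ nc.st.bundle, IsHandleOf nc.known X i

theorem sampling_currentPool_isHandleOf {r : ℕ} {v : Fin n}
    (h : ¬ P ∣ r → HoldsOnly (epochMessages E inp (r / P)) (cfg r v)) :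
    ((cfg r v).st.currentPool P E).Nodup ∧ ∀ i ∈ (cfg r v).st.currentPool P E,
      IsHandleOf (cfg r v).known (epochMessages E inp (r / P)) i := by
  by_cases hP : P ∣ r
  · rw [sampling_currentPool_of_dvd inp G ω hP]
    refine ⟨List.nodup_range.filter _, fun i hi => ?_⟩
    simp only [List.mem_filter, List.mem_range, decide_eq_true_eq] at hi
    have hget := List.getElem?_eq_getElem hi.1
    exact ⟨_, ⟨v, i, hget, hi.2⟩,
      getElem?_of_prefix (run_known_prefix alg inp G ω r.zero_le v) hget⟩
  · rw [sampling_currentPool_of_not_dvd inp G ω hP]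
    exact ⟨(h hP).nodup, (h hP).pool⟩

theorem holdsOnly_succ_of_not_sel {r : ℕ} (hr : ¬ sel r) {X : Set M}
    (h : ∀ v, HoldsOnly X (cfg r v)) (v : Fin n) : HoldsOnly X (cfg (r + 1) v) := by
  rcases hy : reception (G r) (transmission alg (cfg r) (ω r)) v with _ | p
  · rw [sampling_succ_of_silence inp G ω hr hy]
    exact ⟨(h v).nodup, (h v).pool, (h v).bundle⟩
  have hold {i : ℕ} (hi : IsHandleOf (cfg r v).known X i) :
      IsHandleOf (learn (cfg r v).known p.msgs) X i :=
    hi.mono (prefix_learn _ _)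
  have hnew {i : ℕ} (hi : i ∈ p.msgs.map fun m => (learn (cfg r v).known p.msgs).idxOf m) :
      IsHandleOf (learn (cfg r v).known p.msgs) X i := by
    obtain ⟨m, hm, rfl⟩ := List.mem_map.1 hi
    refine ⟨m, ?_, List.getElem?_idxOf (mem_learn.2 (Or.inr hm))⟩
    obtain ⟨u, -, hu⟩ := exists_awake_sender_of_reception inp G ω hy
    rw [hu] at hm
    obtain ⟨j, hj, hjm⟩ := List.mem_filterMap.1 hm
    obtain ⟨m', hm', hjm'⟩ := (h u).bundle j (List.mem_of_mem_take hj)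
    exact Option.some.inj (hjm'.symm.trans hjm) ▸ hm'
  rw [sampling_succ_of_packet inp G ω hr hy]
  refine ⟨nodup_learn (h v).nodup _, fun i hi => ?_, fun i hi => ?_⟩
  · exact (mem_learn.1 hi).elim (fun hi => hold ((h v).pool i hi)) hnew
  · simp only at hi
    split_ifs at hi
    exacts [hnew hi, hold ((h v).bundle i hi)]

theorem sampling_holdsOnly (hsel : ∀ r, P ∣ r → sel r) (r : ℕ) (hr : ¬ P ∣ r) (v : Fin n) :
    HoldsOnly (epochMessages E inp (r / P)) (cfg r v) := by
  induction r generalizing v with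
  | zero => exact absurd (dvd_zero P) hr
  | succ r ih =>
    have hdiv : (r + 1) / P = r / P := by rw [Nat.succ_div, if_neg hr, add_zero]
    rw [hdiv]
    by_cases hs : sel r
    · obtain ⟨hnodup, hhandle⟩ := sampling_currentPool_isHandleOf (c := c) (Θ := Θ) (sel := sel)
        inp G ω fun hP => ih hP v
      rw [sampling_succ_of_sel inp G ω hs]
      exact ⟨hnodup, hhandle, fun i hi => hhandle i (chunk_subset _ _ _ hi)⟩
    · exact holdsOnly_succ_of_not_sel inp G ω hs (ih fun h => hs (hsel r h)) v

theorem sampling_currentPool_length_le (hsel : ∀ r, P ∣ r → sel r) (hinp : ∀ v, (inp v).Nodup)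
    (r : ℕ) (v : Fin n) :
    (((cfg r v).st.currentPool P E).length : ℕ∞) ≤ (epochMessages E inp (r / P)).encard :=
  let ⟨hnodup, hhandle⟩ := sampling_currentPool_isHandleOf inp G ω fun hP =>
    sampling_holdsOnly inp G ω hsel r hP v
  length_le_encard_of_isHandleOf (run_known_nodup alg inp G ω hinp r v) hnodup hhandle

/-- The nodes whose pool covers `X`. -/
def coveredBy (P E : ℕ) (X : Set M) (conf : Fin n → NodeConfig SamplingState M) : Set (Fin n) :=
  {v | Covers (conf v).known ((conf v).st.currentPool P E) X}

theorem sampling_coveredBy_succ (hsel : ∀ r, P ∣ r → sel r) {r : ℕ} (hr : ¬ P ∣ r + 1)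
    (X : Set M) : coveredBy P E X (cfg r) ⊆ coveredBy P E X (cfg (r + 1)) := by
  intro v hv
  have hpre := run_known_prefix alg inp G ω (Nat.le_add_right r 1) v
  rw [coveredBy, Set.mem_ofPred_eq, sampling_currentPool_of_not_dvd inp G ω hr]
  refine Covers.mono hv hpre ?_
  by_cases hs : sel r
  · rw [sampling_succ_of_sel inp G ω hs v]
    exact List.Subset.refl _
  · rw [sampling_currentPool_of_not_dvd inp G ω fun h => hs (hsel r h)]
    exact sampling_pool_subset inp G ω hs v

theorem sampling_coveredBy_mono (hsel : ∀ r, P ∣ r → sel r) {r r' : ℕ} (hrr : r ≤ r')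
    (hr : ∀ a, r < a → a ≤ r' → ¬ P ∣ a) (X : Set M) :
    coveredBy P E X (cfg r) ⊆ coveredBy P E X (cfg r') := by
  induction r', hrr using Nat.le_induction with
  | base => exact subset_rfl
  | succ r' hrr ih =>
    exact (ih fun a ha ha' => hr a ha (by omega)).trans
      (sampling_coveredBy_succ inp G ω hsel (hr _ (by omega) le_rfl) X)

theorem mem_coveredBy_epoch_start {e : ℕ} (hP : 0 < P) {X : Set M} {u : Fin n}
    (hX : ∀ m ∈ X, ∃ j, (inp u)[j]? = some m ∧ j % E = e) :
    u ∈ coveredBy P E X (cfg (e * P)) := by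
  intro m hm
  obtain ⟨j, hj, hje⟩ := hX m hm
  refine ⟨j, ?_, getElem?_of_prefix (run_known_prefix alg inp G ω (Nat.zero_le _) u) hj⟩
  rw [sampling_currentPool_of_dvd inp G ω (Nat.dvd_mul_left P e), Nat.mul_div_cancel _ hP]
  simp only [List.mem_filter, List.mem_range, decide_eq_true_eq]
  exact ⟨(List.getElem?_eq_some_iff.1 hj).1, hje⟩

end Epochs

section SingleBroadcast

variable {n c g P E N Θ : ℕ} [NeZero N] {sel : ℕ → Prop} {M : Type} [DecidableEq M]
  (inp : Fin n → List M) (G : ℕ → SimpleGraph (Fin n))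
  (ω : ℕ → Fin n → SlotCoin 1 N (SelectionCoin n g))

local notation "alg" => samplingBroadcast n c g P E N Θ sel

local notation "cfg" => run (samplingBroadcast n c g P E N Θ sel) inp G ω

/-- The wake-up rounds of the agents of `samplingBroadcast`, one per node. -/
abbrev samplingWake {M : Type} (conf : Fin n → NodeConfig SamplingState M) (u : Fin n)
    (_ : Fin 1) : Option ℕ :=
  (conf u).st.act

/-- In a selection round with coins `x`, the node `u` is the only source, and the chunk that it
chooses covers `X`. -/
structure IsLoneSource {M : Type} (c P E : ℕ) (X : Set M)
    (conf : Fin n → NodeConfig SamplingState M) (x : Fin n → SlotCoin 1 N (SelectionCoin n g))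
    (u : Fin n) : Prop where
  selected : (x u).2.1 = 0
  sole : ∀ v, v ≠ u → (x v).2.1 ≠ 0
  covers : Covers (conf u).known (chunk c (x u).2.2 ((conf u).st.currentPool P E)) X

/-- The packets of the node and its pool cover `X`. -/
structure Carries {M : Type} (c : ℕ) (X : Set M) (nc : NodeConfig SamplingState M) : Prop where
  bundle : Covers nc.known (nc.st.bundle.take c) X
  pool : Covers nc.known nc.st.pool X

theorem carries_of_isLoneSource {t₀ : ℕ} (hs : sel t₀) {X : Set M} {u v : Fin n}
    (hu : IsLoneSource c P E X (cfg t₀) (ω t₀) u) (hv : (cfg (t₀ + 1) v).st.act ≠ none) :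
    Carries c X (cfg (t₀ + 1) v) := by
  rw [sampling_succ_of_sel inp G ω hs] at hv ⊢
  obtain rfl : v = u := by
    by_contra hne
    exact hv (if_neg (hu.sole v hne))
  exact ⟨(take_chunk c _ _).symm ▸ hu.covers,
    hu.covers.mono (List.prefix_refl _) (chunk_subset _ _ _)⟩

theorem carries_succ {r : ℕ} (hr : ¬ sel r) {X : Set M}
    (h : ∀ v, (cfg r v).st.act ≠ none → Carries c X (cfg r v)) {v : Fin n}
    (hv : (cfg (r + 1) v).st.act ≠ none) : Carries c X (cfg (r + 1) v) := by
  rcases hy : reception (G r) (transmission alg (cfg r) (ω r)) v with _ | p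
  · rw [sampling_succ_of_silence inp G ω hr hy] at hv ⊢
    exact ⟨(h v hv).bundle, (h v hv).pool⟩
  rw [sampling_succ_of_packet inp G ω hr hy]
  by_cases hact : (cfg r v).st.act = none
  · obtain ⟨u, hu, hmsgs⟩ := exists_awake_sender_of_reception inp G ω hy
    have hXp (m : M) (hm : m ∈ X) : m ∈ p.msgs := by
      rw [hmsgs]
      exact List.mem_filterMap.2 ((h u hu).bundle m hm)
    have hlen : p.msgs.length ≤ c := by
      rw [hmsgs]
      exact (List.length_filterMap_le _ _).trans (List.length_take_le _ _)
    have hcov := covers_map_idxOf (fun m hm => mem_learn.2 (Or.inr hm) :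
      p.msgs ⊆ learn (cfg r v).known p.msgs) hXp
    refine ⟨?_, hcov.mono (List.prefix_refl _) fun i hi => mem_learn.2 (Or.inr hi)⟩
    simp only [if_pos hact]
    rwa [List.take_of_length_le (by rwa [List.length_map])]
  · refine ⟨?_, (h v hact).pool.mono (prefix_learn _ _) (prefix_learn _ _).subset⟩
    simp only [if_neg hact]
    exact (h v hact).bundle.mono (prefix_learn _ _) (List.Subset.refl _)

theorem carries_of_awake {t₀ r : ℕ} (hs : sel t₀) (htr : t₀ < r)
    (hns : ∀ r', t₀ < r' → r' < r → ¬ sel r') {X : Set M} {u : Fin n}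
    (hu : IsLoneSource c P E X (cfg t₀) (ω t₀) u) {v : Fin n} (hv : (cfg r v).st.act ≠ none) :
    Carries c X (cfg r v) := by
  induction r, Nat.succ_le_of_lt htr using Nat.le_induction generalizing v with
  | base => exact carries_of_isLoneSource inp G ω hs hu hv
  | succ r hr ih =>
    exact carries_succ inp G ω (hns r hr r.lt_succ_self)
      (fun v hv => ih hr (fun r' h h' => hns r' h (by omega)) hv) hv

theorem sampling_isWake {t₀ T : ℕ} (hs : sel t₀) (hns : ∀ r, t₀ < r → r ≤ T → ¬ sel r)
    (v : Fin n) : IsWake (fun r => (cfg r v).st.act) (t₀ + 1) (T + 1) := by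
  refine isWake_of_step ?_ fun r hr hrT => ?_
  · simp only [sampling_succ_of_sel inp G ω hs]
    split_ifs
    exacts [Or.inr rfl, Or.inl rfl]
  · have hnr := hns r (by omega) (by omega)
    rcases hy : reception (G r) (transmission alg (cfg r) (ω r)) v with _ | p
    · exact Or.inl (by rw [sampling_succ_of_silence inp G ω hnr hy])
    · rw [sampling_succ_of_packet inp G ω hnr hy]
      rcases (cfg r v).st.act with _ | w
      exacts [Or.inr ⟨rfl, rfl⟩, Or.inl rfl]

theorem awake_of_onlyFires {r : ℕ} (hr : ¬ sel r) {u v : Fin n}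
    (hfire : OnlyFires Θ (samplingWake (cfg r)) r v 0 (ω r)) (huv : (G r).Adj u v) :
    (cfg (r + 1) u).st.act ≠ none := by
  have hsend : transmission alg (cfg r) (ω r) v =
      some ⟨((cfg r v).st.bundle.take c).filterMap fun i => (cfg r v).known[i]?, []⟩ := by
    refine (transmission_eq_some _).2 ⟨⟨(cfg r v).st.bundle.take c, []⟩, if_pos ?_, rfl⟩
    rw [sampling_round]
    exact ⟨hr, (hfire v 0).2 ⟨rfl, rfl⟩⟩
  have hsilent (w : Fin n) (hw : w ≠ v) : transmission alg (cfg r) (ω r) w = none := by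
    refine (transmission_eq_none _).2 (if_neg ?_)
    rw [sampling_round]
    rintro ⟨-, hi⟩
    exact hw ((hfire w 0).1 hi).1
  rw [sampling_succ_of_packet inp G ω hr (reception_of_sole_transmitter hsend hsilent huv)]
  exact Option.some_ne_none _

theorem forall_awake_of_long_window {H : SimpleGraph (Fin n)} (hH : H.Connected)
    (hHG : ∀ r u v, H.Adj u v → (G r).Adj u v) (hΘ : 0 < Θ) {t₀ T m : ℕ} (hs : sel t₀)
    (hns : ∀ r, t₀ < r → r ≤ T → ¬ sel r) (htT : t₀ < T) (hTm : T ≤ t₀ + Θ * m) {u : Fin n}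
    (hu : (ω t₀ u).2.1 = 0)
    (hprogress : ∀ v, ¬ Starves Θ (t₀ + 1) (T + 1) (fun r => samplingWake (cfg r)) ω v 0)
    {awake : Finset (Fin n)} (hawake : ∀ v, v ∈ awake ↔ (cfg T v).st.act ≠ none)
    (hlong : 4 * (awake.card * (Θ * (harmonic m : ℚ))) < ((T - t₀ : ℕ) : ℝ)) :
    awake = Finset.univ := by
  have hwake := sampling_isWake (c := c) (P := P) (E := E) (Θ := Θ) inp G ω hs hns
  have hall : {v | (cfg T v).st.act ≠ none} = Set.univ := by
    refine informed_eq_univ_of_long_window (I := fun r => {v | (cfg r v).st.act ≠ none})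
      (NeZero.ne N) hΘ htT (by omega : T < t₀ + 1 + Θ * m) hH
      (fun r hr r' hr' h v hv => (hwake v).ne_none_mono hr.1 h (Nat.lt_succ_of_le hr'.2) hv)
      ⟨u, ?_⟩ (W := fun r => samplingWake (cfg r)) (fun _ => 0) (fun v _ => hwake v)
      (fun v w hwT hjoin => (hwake v).eq_some_self hjoin.le (Nat.lt_succ_of_le hwT) hjoin.mem
        fun r hr hrw => not_not.1 (hjoin.notMem r hr hrw))
      (fun v r hr hrT _ hfire x hvx => awake_of_onlyFires inp G ω (hns r hr hrT.le) hfire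
        (hHG r x v hvx.symm))
      hprogress (s := awake ×ˢ Finset.univ) (fun v i hvi r hr hrT => ?_) ?_
    · rw [Set.mem_ofPred_eq, sampling_succ_of_sel inp G ω hs]
      simp [hu]
    · by_contra hne
      exact hvi (Finset.mem_product.2 ⟨(hawake v).2
        ((hwake v).ne_none_mono hr (Nat.lt_succ_iff.1 hrT) T.lt_succ_self hne),
        Finset.mem_univ i⟩)
    · rwa [Finset.card_product, Finset.card_univ, Fintype.card_fin, mul_one,
        Nat.add_sub_add_right]
  exact Finset.eq_univ_of_forall fun v =>
    (hawake v).2 (hall ▸ Set.mem_univ v : v ∈ {v | (cfg T v).st.act ≠ none})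

theorem min_le_ncard_coveredBy_of_long_window {H : SimpleGraph (Fin n)} (hH : H.Connected)
    (hHG : ∀ r u v, H.Adj u v → (G r).Adj u v) (hΘ : 0 < Θ) (hsel : ∀ r, P ∣ r → sel r)
    {t₀ T m : ℕ} (hs : sel t₀) (hns : ∀ r, t₀ < r → r ≤ T → ¬ sel r) (htT : t₀ < T)
    (hTm : T ≤ t₀ + Θ * m) {X : Set M} {u : Fin n} (hu : IsLoneSource c P E X (cfg t₀) (ω t₀) u)
    (hprogress : ∀ v, ¬ Starves Θ (t₀ + 1) (T + 1) (fun r => samplingWake (cfg r)) ω v 0)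
    {k : ℕ} (hlong : 4 * (k * (Θ * (harmonic m : ℚ))) < ((T - t₀ : ℕ) : ℝ)) :
    min (k + 1) n ≤ (coveredBy P E X (cfg T)).ncard := by
  classical
  let awake : Finset (Fin n) := {v | (cfg T v).st.act ≠ none}
  have hawake (v : Fin n) : v ∈ awake ↔ (cfg T v).st.act ≠ none := by simp [awake]
  have hcovered : (awake : Set (Fin n)) ⊆ coveredBy P E X (cfg T) := fun v hv => by
    rw [coveredBy, Set.mem_ofPred_eq,
      sampling_currentPool_of_not_dvd inp G ω fun h => hns T htT le_rfl (hsel T h)]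
    exact (carries_of_awake inp G ω hs htT (fun r h h' => hns r h h'.le) hu ((hawake v).1 hv)).pool
  refine le_trans ?_ (Set.ncard_le_ncard hcovered (Set.toFinite _))
  rw [Set.ncard_coe_finset]
  by_contra! hlt
  rw [lt_min_iff, Nat.lt_succ_iff] at hlt
  have hharmonic : (0 : ℝ) ≤ (harmonic m : ℚ) := by
    rw [harmonic]
    push_cast
    positivity
  have huniv := forall_awake_of_long_window inp G ω hH hHG hΘ hs hns htT hTm hu.selected hprogress
    hawake (lt_of_le_of_lt (by gcongr; exact hlt.1) hlong)
  rw [huniv, Finset.card_univ, Fintype.card_fin] at hlt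
  exact lt_irrefl _ hlt.2

end SingleBroadcast

section Selection

variable {n c g P E N Θ : ℕ} {sel : ℕ → Prop} {M : Type}

/-- The nodes with a chunk that covers `X`. -/
def chunkCoveredBy (c g P E : ℕ) (X : Set M) (conf : Fin n → NodeConfig SamplingState M) :
    Set (Fin n) :=
  {v | ∃ j : Fin (g + 1), Covers (conf v).known (chunk c j ((conf v).st.currentPool P E)) X}

theorem ncard_div_le_roundProb_isLoneSource [NeZero N] (X : Set M)
    (conf : Fin n → NodeConfig SamplingState M) :
    ((chunkCoveredBy c g P E X conf).ncard : ℝ) / (2 * (2 * n + 1) * (g + 1)) ≤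
      roundProb (PMF.uniformOfFintype (SlotCoin 1 N (SelectionCoin n g))) n
        {x | ∃ u, IsLoneSource c P E X conf x u} := by
  classical
  have hchoice (v : Fin n) : ∃ j : Fin (g + 1), v ∈ chunkCoveredBy c g P E X conf →
      Covers (conf v).known (chunk c j ((conf v).st.currentPool P E)) X := by
    by_cases hv : v ∈ chunkCoveredBy c g P E X conf
    exacts [hv.imp fun _ hj _ => hj, ⟨0, fun h => absurd h hv⟩]
  choose j hj using hchoice
  rw [Set.ncard_eq_toFinset_card']
  refine (le_roundProb_lone_source n g _ j).trans (roundProb_mono _ _ ?_)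
  rintro x ⟨v, hv, hx, hsole⟩
  exact ⟨v, congrArg Prod.fst hx, hsole,
    (congrArg Prod.snd hx : (x v).2.2 = j v) ▸ hj v (Set.mem_toFinset.1 hv)⟩

open Classical in
/-- No lone source covers `X` in the selection rounds of `[R, T)`, although the lower bounds of
`ncard_div_le_roundProb_isLoneSource` for these rounds add up to `lam`. -/
def SelectionFails (c P E : ℕ) (sel : ℕ → Prop) (X : Set M) (lam : ℝ) (R T : ℕ)
    (conf : ℕ → Fin n → NodeConfig SamplingState M)
    (ω : ℕ → Fin n → SlotCoin 1 N (SelectionCoin n g)) : Prop :=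
  (∀ r ∈ Finset.Ico R T, sel r → ∀ u, ¬ IsLoneSource c P E X (conf r) (ω r) u) ∧
    lam ≤ ∑ r ∈ Finset.Ico R T with sel r,
      ((chunkCoveredBy c g P E X (conf r)).ncard : ℝ) / (2 * (2 * n + 1) * (g + 1))

theorem coinMeasure_selectionFails_le [NeZero N] [DecidableEq M] (inp : Fin n → List M)
    {adv : (ℕ → Fin n → SlotCoin 1 N (SelectionCoin n g)) → ℕ → SimpleGraph (Fin n)}
    (hadv : IsOblivious adv 0) (R T : ℕ) (X : Set M) (lam : ℝ) :
    coinMeasure (samplingBroadcast n c g P E N Θ sel)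
        {ω | SelectionFails c P E sel X lam R T
          (run (samplingBroadcast n c g P E N Θ sel) inp (adv ω) ω) ω} ≤
      ENNReal.ofReal (Real.exp (-lam)) := by
  classical
  let A := samplingBroadcast n c g P E N Θ sel
  have hdep := run_dependsOn A inp hadv
  let q (ω : ℕ → Fin n → SlotCoin 1 N (SelectionCoin n g)) (r : ℕ) : ℝ :=
    if R ≤ r ∧ sel r then
      ((chunkCoveredBy c g P E X (run A inp (adv ω) ω r)).ncard : ℝ) /
        (2 * (2 * n + 1) * (g + 1)) else 0
  let S (ω : ℕ → Fin n → SlotCoin 1 N (SelectionCoin n g)) (r : ℕ) : Prop :=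
    (R ≤ r ∧ sel r) ∧ ∃ u, IsLoneSource c P E X (run A inp (adv ω) ω r) (ω r) u
  refine (measure_mono fun ω hω => ?_).trans
    (coinMeasure_no_success_le A (q := q) (S := S) (fun r ω ω' h => ?_) (fun r ω ω' h => ?_)
      (fun ω r => ?_) (fun ω r => ?_) lam T)
  · refine ⟨T, le_rfl, fun r hr hS => ?_, hω.2.trans_eq ?_⟩
    · exact hS.2.elim (hω.1 r (Finset.mem_Ico.2 ⟨hS.1.1, hr⟩) hS.1.2)
    · rw [← Finset.sum_filter]
      congr 1
      ext r
      simp only [Finset.mem_filter, Finset.mem_Ico, Finset.mem_range]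
      tauto
  · have hrun : run A inp (adv ω) ω r = run A inp (adv ω') ω' r := hdep r h
    simp only [q, hrun]
  · have hrun : run A inp (adv ω) ω r = run A inp (adv ω') ω' r :=
      hdep r fun i hi => h i (Set.mem_Iic.2 (Set.mem_Iio.1 hi).le)
    simp only [S, hrun, h r (Set.mem_Iic.2 le_rfl)]
  · simp only [q]
    split_ifs <;> positivity
  · have hrun (x : Fin n → SlotCoin 1 N (SelectionCoin n g)) :
        run A inp (adv (Function.update ω r x)) (Function.update ω r x) r =
          run A inp (adv ω) ω r :=
      hdep r fun i hi => Function.update_of_ne (Set.mem_Iio.1 hi).ne _ _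
    simp only [q, S, hrun, Function.update_self]
    split_ifs with hround
    · simp only [hround, true_and, and_self]
      exact ncard_div_le_roundProb_isLoneSource X _
    · exact roundProb_nonneg _ _ _

theorem exists_isLoneSource_of_not_selectionFails {X : Set M} {lam : ℝ} {R T a : ℕ}
    {conf : ℕ → Fin n → NodeConfig SamplingState M}
    {ω : ℕ → Fin n → SlotCoin 1 N (SelectionCoin n g)}
    (h : ¬ SelectionFails c P E sel X lam R T conf ω) {s : Finset ℕ}
    (hs : ∀ r ∈ s, r ∈ Finset.Ico R T ∧ sel r ∧ a ≤ (chunkCoveredBy c g P E X (conf r)).ncard)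
    (hlam : lam * (2 * (2 * n + 1) * (g + 1)) ≤ s.card * a) :
    ∃ r ∈ Finset.Ico R T, sel r ∧ ∃ u, IsLoneSource c P E X (conf r) (ω r) u := by
  classical
  by_contra! hno
  refine h ⟨hno, ?_⟩
  calc lam ≤ s.card • ((a : ℝ) / (2 * (2 * n + 1) * (g + 1))) := by
        rwa [nsmul_eq_mul, ← mul_div_assoc, le_div_iff₀ (by positivity)]
    _ ≤ ∑ r ∈ s, ((chunkCoveredBy c g P E X (conf r)).ncard : ℝ) / (2 * (2 * n + 1) * (g + 1)) :=
        Finset.card_nsmul_le_sum _ _ _ fun r hr => by gcongr; exact (hs r hr).2.2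
    _ ≤ _ := Finset.sum_le_sum_of_subset_of_nonneg
        (fun r hr => Finset.mem_filter.2 ⟨(hs r hr).1, (hs r hr).2.1⟩) fun _ _ _ => by positivity

end Selection

section Stage

variable {n c g P E N Θ : ℕ} [NeZero N] {sel : ℕ → Prop} {M : Type} [DecidableEq M]
  (inp : Fin n → List M) (G : ℕ → SimpleGraph (Fin n))
  (ω : ℕ → Fin n → SlotCoin 1 N (SelectionCoin n g))

local notation "cfg" => run (samplingBroadcast n c g P E N Θ sel) inp G ω

theorem coveredBy_subset_chunkCoveredBy (hsel : ∀ r, P ∣ r → sel r) (hinp : ∀ v, (inp v).Nodup)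
    {r : ℕ} (hload : (epochMessages E inp (r / P)).encard ≤ (c * (g + 1) : ℕ))
    {X : Set M} (hX : g = 0 ∨ X.Subsingleton) :
    coveredBy P E X (cfg r) ⊆ chunkCoveredBy c g P E X (cfg r) := fun v hv =>
  Covers.exists_chunk hv (Nat.cast_le.1
    ((sampling_currentPool_length_le inp G ω hsel hinp r v).trans hload)) hX

theorem ncard_coveredBy_mono (hsel : ∀ r, P ∣ r → sel r) {r r' : ℕ} (hrr : r ≤ r')
    (hr : ∀ a, r < a → a ≤ r' → ¬ P ∣ a) (X : Set M) :
    (coveredBy P E X (cfg r)).ncard ≤ (coveredBy P E X (cfg r')).ncard :=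
  Set.ncard_le_ncard (sampling_coveredBy_mono inp G ω hsel hrr hr X) (Set.toFinite _)

theorem div_eq_div_of_forall_not_dvd {P R r : ℕ} (hRr : R ≤ r)
    (h : ∀ x, R < x → x ≤ r → ¬ P ∣ x) : r / P = R / P := by
  induction r, hRr using Nat.le_induction with
  | base => rfl
  | succ r hr ih =>
    rw [Nat.succ_div, if_neg (h _ (by omega) le_rfl), add_zero]
    exact ih fun x hRx hxr => h x hRx (by omega)

theorem exists_isLoneSource_in_stage (hsel : ∀ r, P ∣ r → sel r) (hinp : ∀ v, (inp v).Nodup)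
    {R k len a : ℕ} {X : Set M} {lam : ℝ}
    (hload : (epochMessages E inp (R / P)).encard ≤ (c * (g + 1) : ℕ))
    (hX : g = 0 ∨ X.Subsingleton) (hlen : 0 < len) (hstage : ∀ j < k, sel (R + j * len))
    (hP : ∀ r, R < r → r < R + k * len → ¬ P ∣ r)
    (hlam : lam * (2 * (2 * n + 1) * (g + 1)) ≤ k * a)
    (hfail : ¬ SelectionFails c P E sel X lam R (R + k * len) cfg ω)
    (ha : a ≤ (coveredBy P E X (cfg R)).ncard) :
    ∃ r ∈ Finset.Ico R (R + k * len), sel r ∧ ∃ u, IsLoneSource c P E X (cfg r) (ω r) u := by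
  have hinj : Function.Injective fun j => R + j * len := fun i j hij =>
    Nat.eq_of_mul_eq_mul_right hlen (Nat.add_left_cancel hij)
  refine exists_isLoneSource_of_not_selectionFails (a := a) hfail
    (s := (Finset.range k).image fun j => R + j * len) (fun r hr => ?_)
    (by rwa [Finset.card_image_of_injective _ hinj, Finset.card_range])
  obtain ⟨j, hj, rfl⟩ := Finset.mem_image.1 hr
  rw [Finset.mem_range] at hj
  have hjk : R + j * len < R + k * len :=
    Nat.add_lt_add_left (Nat.mul_lt_mul_of_pos_right hj hlen) R
  have hno (x : ℕ) (hRx : R < x) (hx : x ≤ R + j * len) : ¬ P ∣ x := hP x hRx (hx.trans_lt hjk)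
  refine ⟨Finset.mem_Ico.2 ⟨Nat.le_add_right _ _, hjk⟩, hstage j hj, ?_⟩
  rw [← div_eq_div_of_forall_not_dvd (Nat.le_add_right _ _) hno] at hload
  calc a ≤ (coveredBy P E X (cfg R)).ncard := ha
    _ ≤ (coveredBy P E X (cfg (R + j * len))).ncard :=
        ncard_coveredBy_mono inp G ω hsel (Nat.le_add_right _ _) hno X
    _ ≤ _ := Set.ncard_le_ncard (coveredBy_subset_chunkCoveredBy inp G ω hsel hinp hload hX)
        (Set.toFinite _)

theorem min_le_ncard_coveredBy_of_stage {H : SimpleGraph (Fin n)} (hH : H.Connected)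
    (hHG : ∀ r u v, H.Adj u v → (G r).Adj u v) (hΘ : 0 < Θ) (hsel : ∀ r, P ∣ r → sel r)
    (hinp : ∀ v, (inp v).Nodup) {R k len a b m : ℕ} {X : Set M} {lam : ℝ}
    (hload : (epochMessages E inp (R / P)).encard ≤ (c * (g + 1) : ℕ))
    (hX : g = 0 ∨ X.Subsingleton) (hR : len ∣ R)
    (hstage : ∀ r ∈ Finset.Ico R (R + k * len), sel r ↔ len ∣ r)
    (hP : ∀ r, R < r → r < R + k * len → ¬ P ∣ r) (hlen : 1 < len) (hm : len ≤ Θ * m)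
    (hlong : 4 * (b * (Θ * (harmonic m : ℚ))) < ((len - 1 : ℕ) : ℝ))
    (hlam : lam * (2 * (2 * n + 1) * (g + 1)) ≤ k * a)
    (hfail : ¬ SelectionFails c P E sel X lam R (R + k * len) cfg ω)
    (hprogress : ∀ t₀ ∈ Finset.Ico R (R + k * len), ∀ v,
      ¬ Starves Θ (t₀ + 1) (t₀ + len) (fun r => samplingWake (cfg r)) ω v 0)
    (ha : a ≤ (coveredBy P E X (cfg R)).ncard) :
    min (b + 1) n ≤ (coveredBy P E X (cfg (R + k * len - 1))).ncard := by
  obtain ⟨r, hr, hsr, u, hu⟩ := exists_isLoneSource_in_stage inp G ω hsel hinp hload hX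
    (Nat.zero_lt_of_lt hlen)
    (fun j hj => (hstage _ (Finset.mem_Ico.2 ⟨Nat.le_add_right _ _,
      Nat.add_lt_add_left (Nat.mul_lt_mul_of_pos_right hj (Nat.zero_lt_of_lt hlen)) R⟩)).2
      (Nat.dvd_add hR (Nat.dvd_mul_left _ _))) hP hlam hfail ha
  have hlenr : len ∣ r := (hstage r hr).1 hsr
  have hRr := Finset.mem_Ico.1 hr
  have hend : r + len ≤ R + k * len := by
    have hle := Nat.le_of_dvd (Nat.sub_pos_of_lt hRr.2)
      (Nat.dvd_sub (Nat.dvd_add hR (Nat.dvd_mul_left len k)) hlenr)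
    omega
  have hns (x : ℕ) (hrx : r < x) (hx : x ≤ r + len - 1) : ¬ sel x := fun hsx => by
    have hlenx := (hstage x (Finset.mem_Ico.2 (by omega))).1 hsx
    have hle := Nat.le_of_dvd (Nat.sub_pos_of_lt hrx) (Nat.dvd_sub hlenx hlenr)
    omega
  refine (min_le_ncard_coveredBy_of_long_window inp G ω hH hHG hΘ hsel hsr hns (by omega)
    (by omega : r + len - 1 ≤ r + Θ * m) hu (fun v => ?_) ?_).trans
    (ncard_coveredBy_mono inp G ω hsel (by omega) (fun x hx hx' => hP x (by omega) (by omega)) X)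
  · rw [Nat.sub_add_cancel (by omega)]
    exact hprogress r hr v
  · rwa [show r + len - 1 - r = len - 1 by omega]

end Stage

section Schedule

/-- The length of a stage of the schedule with `ℓ` stages per epoch. -/
def stageLength (ℓ K L : ℕ) : ℕ :=
  2 ^ ℓ * K * L

/-- The length of an epoch, which consists of `ℓ` stages. -/
def epochLength (ℓ K L : ℕ) : ℕ :=
  ℓ * stageLength ℓ K L

/-- The length of the single-source broadcasts around round `r`: it is `2 ^ i * L` in stage `i` of
an epoch. -/
def windowLength (ℓ K L r : ℕ) : ℕ :=
  2 ^ (r / stageLength ℓ K L % ℓ) * L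

/-- The rounds in which a new single-source broadcast begins. -/
def IsSelectionRound (ℓ K L r : ℕ) : Prop :=
  windowLength ℓ K L r ∣ r

/-- The first round of stage `i` of epoch `e`. -/
def stageStart (ℓ K L e i : ℕ) : ℕ :=
  (e * ℓ + i) * stageLength ℓ K L

variable {ℓ K L : ℕ}

theorem stageLength_pos (hK : 0 < K) (hL : 0 < L) : 0 < stageLength ℓ K L := by
  unfold stageLength
  positivity

theorem stageStart_zero (e : ℕ) : stageStart ℓ K L e 0 = e * epochLength ℓ K L := by
  rw [stageStart, epochLength, add_zero, mul_assoc]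

theorem stageStart_add_stageLength (e i : ℕ) :
    stageStart ℓ K L e i + stageLength ℓ K L = stageStart ℓ K L e (i + 1) := by
  simp only [stageStart]
  ring

theorem stageStart_last (e : ℕ) : stageStart ℓ K L e ℓ = (e + 1) * epochLength ℓ K L := by
  simp only [stageStart, epochLength]
  ring

theorem stageStart_strictMono (hQ : 0 < stageLength ℓ K L) (e : ℕ) :
    StrictMono (stageStart ℓ K L e) := fun _ _ h =>
  Nat.mul_lt_mul_of_pos_right (Nat.add_lt_add_left h _) hQ

theorem mul_eq_stageLength {i : ℕ} (hi : i ≤ ℓ) :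
    2 ^ (ℓ - i) * K * (2 ^ i * L) = stageLength ℓ K L := by
  rw [mul_mul_mul_comm, ← mul_assoc (2 ^ (ℓ - i) * 2 ^ i), ← pow_add, Nat.sub_add_cancel hi,
    stageLength]

theorem two_pow_mul_dvd_stageLength {i : ℕ} (hi : i ≤ ℓ) : 2 ^ i * L ∣ stageLength ℓ K L :=
  mul_eq_stageLength hi ▸ Nat.dvd_mul_left _ _

theorem windowLength_dvd_stageLength (hℓ : 0 < ℓ) (r : ℕ) :
    windowLength ℓ K L r ∣ stageLength ℓ K L :=
  two_pow_mul_dvd_stageLength (Nat.mod_lt _ hℓ).le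

theorem isSelectionRound_of_epochLength_dvd (hℓ : 0 < ℓ) {r : ℕ} (hr : epochLength ℓ K L ∣ r) :
    IsSelectionRound ℓ K L r :=
  ((windowLength_dvd_stageLength hℓ r).trans (Nat.dvd_mul_left _ _)).trans hr

theorem windowLength_of_mem_stage {e i : ℕ} (hi : i < ℓ) {r : ℕ}
    (hr : r ∈ Finset.Ico (stageStart ℓ K L e i) (stageStart ℓ K L e (i + 1))) :
    windowLength ℓ K L r = 2 ^ i * L := by
  rw [Finset.mem_Ico, stageStart, stageStart, ← add_assoc] at hr
  rw [windowLength, Nat.div_eq_of_lt_le hr.1 hr.2, Nat.mul_add_mod', Nat.mod_eq_of_lt hi]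

theorem stageStart_div_epochLength {e i : ℕ} (hi : i < ℓ) (hQ : 0 < stageLength ℓ K L) :
    stageStart ℓ K L e i / epochLength ℓ K L = e := by
  rw [stageStart, epochLength, Nat.mul_div_mul_right _ _ hQ, mul_comm,
    Nat.mul_add_div (Nat.zero_lt_of_lt hi), Nat.div_eq_of_lt hi, add_zero]

theorem not_epochLength_dvd_of_mem_epoch {e r : ℕ} (hr : e * epochLength ℓ K L < r)
    (hr' : r < (e + 1) * epochLength ℓ K L) : ¬ epochLength ℓ K L ∣ r :=
  Nat.not_dvd_of_lt_of_lt_mul_succ (by rwa [mul_comm]) (by rwa [mul_comm])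

end Schedule

section Epoch

/-- Parameters of the schedule for which the number of nodes covering a class of messages doubles
in every stage: each of the `ℓ` stages offers enough selection rounds for a success up to
probability `exp (-lam)`, and its windows are long enough to inform twice as many nodes. -/
structure IsAdequate (n g Θ ℓ K L m : ℕ) (lam : ℝ) : Prop where
  threshold_pos : 0 < Θ
  stages_pos : 0 < ℓ
  repetitions_pos : 0 < K
  length_pos : 0 < L
  le_two_pow : n ≤ 2 ^ ℓ
  length_le : 2 ^ ℓ * L ≤ Θ * m
  harmonic_le : 8 * (Θ * (harmonic m : ℚ)) ≤ (L : ℝ)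
  lam_le : lam * (2 * (2 * n + 1) * (g + 1)) ≤ n * K

namespace IsAdequate

variable {n g Θ ℓ K L m : ℕ} {lam : ℝ}

theorem half_le_threshold_mul_harmonic (h : IsAdequate n g Θ ℓ K L m lam) :
    1 / 2 ≤ Θ * ((harmonic m : ℚ) : ℝ) := by
  have hm : 0 < m := Nat.pos_of_mul_pos_left
    ((Nat.mul_pos (Nat.two_pow_pos ℓ) h.length_pos).trans_le h.length_le)
  have hΘ : (1 : ℝ) ≤ Θ := by exact_mod_cast h.threshold_pos
  have hharmonic : Real.log 2 ≤ (harmonic m : ℚ) := by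
    refine le_trans (Real.log_le_log two_pos ?_) (log_add_one_le_harmonic m)
    exact_mod_cast Nat.succ_le_succ hm
  nlinarith [Real.log_two_gt_d9]

theorem one_lt_window (h : IsAdequate n g Θ ℓ K L m lam) (i : ℕ) : 1 < 2 ^ i * L := by
  have hL : (1 : ℝ) < L := by linarith [h.harmonic_le, h.half_le_threshold_mul_harmonic]
  exact (by exact_mod_cast hL : 1 < L).trans_le (Nat.le_mul_of_pos_left _ (Nat.two_pow_pos i))

theorem window_le (h : IsAdequate n g Θ ℓ K L m lam) {i : ℕ} (hi : i ≤ ℓ) :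
    2 ^ i * L ≤ Θ * m :=
  (Nat.mul_le_mul_right _ (Nat.pow_le_pow_right two_pos hi)).trans h.length_le

theorem harmonic_lt_window (h : IsAdequate n g Θ ℓ K L m lam) (i : ℕ) :
    4 * ((2 ^ (i + 1) - 1 : ℕ) * (Θ * (harmonic m : ℚ))) < ((2 ^ i * L - 1 : ℕ) : ℝ) := by
  rw [Nat.cast_sub (h.one_lt_window i).le, Nat.cast_sub Nat.one_le_two_pow]
  push_cast
  have hmul := mul_le_mul_of_nonneg_left h.harmonic_le (by positivity : (0 : ℝ) ≤ 2 ^ i)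
  rw [pow_succ]
  linarith [h.half_le_threshold_mul_harmonic]

theorem lam_le_stage (h : IsAdequate n g Θ ℓ K L m lam) {i : ℕ} (hi : i ≤ ℓ) :
    lam * (2 * (2 * n + 1) * (g + 1)) ≤ (2 ^ (ℓ - i) * K : ℕ) * (min (2 ^ i) n : ℕ) := by
  refine h.lam_le.trans ?_
  have hn : n ≤ 2 ^ (ℓ - i) * min (2 ^ i) n := by
    rw [← Nat.mul_min_mul_left, ← pow_add, Nat.sub_add_cancel hi]
    exact le_min h.le_two_pow (Nat.le_mul_of_pos_left _ (Nat.two_pow_pos _))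
  have hnK : n * K ≤ 2 ^ (ℓ - i) * K * min (2 ^ i) n := by
    rw [mul_right_comm]
    exact Nat.mul_le_mul_right K hn
  exact_mod_cast hnK

end IsAdequate

/-- In epoch `e`, no stage fails to select a source for `X`, and no node starves. -/
structure EpochSucceeds {n g N : ℕ} {M : Type} (c E Θ ℓ K L e : ℕ) (X : Set M) (lam : ℝ)
    (conf : ℕ → Fin n → NodeConfig SamplingState M)
    (ω : ℕ → Fin n → SlotCoin 1 N (SelectionCoin n g)) : Prop where
  selection : ∀ i < ℓ, ¬ SelectionFails c (epochLength ℓ K L) E (IsSelectionRound ℓ K L) X lam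
    (stageStart ℓ K L e i) (stageStart ℓ K L e (i + 1)) conf ω
  progress : ∀ t₀ < (e + 1) * epochLength ℓ K L, ∀ v,
    ¬ Starves Θ (t₀ + 1) (t₀ + windowLength ℓ K L t₀) (fun r => samplingWake (conf r)) ω v 0

variable {n c g E N Θ ℓ K L m e : ℕ} [NeZero N] {M : Type} [DecidableEq M]
  (inp : Fin n → List M) (G : ℕ → SimpleGraph (Fin n))
  (ω : ℕ → Fin n → SlotCoin 1 N (SelectionCoin n g)) {X : Set M} {lam : ℝ}

local notation "alg" => samplingBroadcast n c g (epochLength ℓ K L) E N Θ (IsSelectionRound ℓ K L)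

local notation "cfg" => run alg inp G ω

theorem ncard_coveredBy_doubles (hconn : IntervalConnected G ⊤)
    (hpar : IsAdequate n g Θ ℓ K L m lam) (hinp : ∀ v, (inp v).Nodup)
    (hload : (epochMessages E inp e).encard ≤ (c * (g + 1) : ℕ))
    (hX : g = 0 ∨ X.Subsingleton) {i : ℕ} (hi : i < ℓ)
    (hgood : EpochSucceeds c E Θ ℓ K L e X lam cfg ω)
    (hcard : min (2 ^ i) n ≤
      (coveredBy (epochLength ℓ K L) E X (cfg (stageStart ℓ K L e i))).ncard) :
    min (2 ^ (i + 1)) n ≤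
      (coveredBy (epochLength ℓ K L) E X (cfg (stageStart ℓ K L e (i + 1) - 1))).ncard := by
  have hQ : 0 < stageLength ℓ K L := stageLength_pos hpar.repetitions_pos hpar.length_pos
  have hwindow {r : ℕ} (hr : r ∈ Finset.Ico (stageStart ℓ K L e i) (stageStart ℓ K L e (i + 1))) :=
    windowLength_of_mem_stage hi hr
  have hend : stageStart ℓ K L e (i + 1) ≤ (e + 1) * epochLength ℓ K L :=
    stageStart_last (ℓ := ℓ) (K := K) (L := L) e ▸ (stageStart_strictMono hQ e).monotone hi
  have hbegin : e * epochLength ℓ K L ≤ stageStart ℓ K L e i :=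
    stageStart_zero (ℓ := ℓ) (K := K) (L := L) e ▸ (stageStart_strictMono hQ e).monotone i.zero_le
  have hstageEnd : stageStart ℓ K L e i + 2 ^ (ℓ - i) * K * (2 ^ i * L) =
      stageStart ℓ K L e (i + 1) := by
    rw [mul_eq_stageLength hi.le, stageStart_add_stageLength]
  have hstage := min_le_ncard_coveredBy_of_stage inp G ω (hconn 0)
    (fun r _ _ h => stableGraph_adj h r) hpar.threshold_pos
    (fun _ => isSelectionRound_of_epochLength_dvd hpar.stages_pos) hinp
    (R := stageStart ℓ K L e i) (by rwa [stageStart_div_epochLength hi hQ]) hX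
    (Dvd.dvd.mul_left (two_pow_mul_dvd_stageLength hi.le) _)
    (fun r hr => by rw [IsSelectionRound, hwindow (hstageEnd ▸ hr)])
    (fun r hr hr' => not_epochLength_dvd_of_mem_epoch (hbegin.trans_lt hr)
      ((hstageEnd ▸ hr').trans_le hend))
    (hpar.one_lt_window i) (hpar.window_le hi.le) (hpar.harmonic_lt_window i)
    (hpar.lam_le_stage hi.le) (hstageEnd ▸ hgood.selection i hi)
    (fun t₀ ht v => hwindow (hstageEnd ▸ ht) ▸
      hgood.progress t₀ ((Finset.mem_Ico.1 (hstageEnd ▸ ht)).2.trans_le hend) v) hcard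
  rwa [hstageEnd, Nat.sub_add_cancel Nat.one_le_two_pow] at hstage

theorem min_two_pow_le_ncard_coveredBy (hconn : IntervalConnected G ⊤)
    (hpar : IsAdequate n g Θ ℓ K L m lam) (hinp : ∀ v, (inp v).Nodup)
    (hload : (epochMessages E inp e).encard ≤ (c * (g + 1) : ℕ))
    (hX : g = 0 ∨ X.Subsingleton) {u : Fin n}
    (hu : ∀ m ∈ X, ∃ j, (inp u)[j]? = some m ∧ j % E = e)
    (hgood : EpochSucceeds c E Θ ℓ K L e X lam cfg ω) {i : ℕ} (hi : i < ℓ) :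
    min (2 ^ i) n ≤ (coveredBy (epochLength ℓ K L) E X (cfg (stageStart ℓ K L e i))).ncard := by
  have hQ : 0 < stageLength ℓ K L := stageLength_pos hpar.repetitions_pos hpar.length_pos
  induction i with
  | zero =>
    rw [stageStart_zero, pow_zero]
    exact (min_le_left _ _).trans ((Set.ncard_pos (Set.toFinite _)).2
      ⟨u, mem_coveredBy_epoch_start inp G ω (Nat.mul_pos hpar.stages_pos hQ) hu⟩)
  | succ i ih =>
    refine (ncard_coveredBy_doubles inp G ω hconn hpar hinp hload hX (Nat.lt_of_succ_lt hi)
      hgood (ih (Nat.lt_of_succ_lt hi))).trans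
      (ncard_coveredBy_mono inp G ω (fun _ => isSelectionRound_of_epochLength_dvd hpar.stages_pos)
        (Nat.sub_le _ _) (fun x hx hx' => ?_) X)
    obtain rfl : x = stageStart ℓ K L e (i + 1) := by omega
    refine not_epochLength_dvd_of_mem_epoch (e := e) ?_ ?_
    · rw [← stageStart_zero]
      exact stageStart_strictMono hQ e i.succ_pos
    · rw [← stageStart_last]
      exact stageStart_strictMono hQ e hi

theorem coveredBy_epoch_end (hconn : IntervalConnected G ⊤)
    (hpar : IsAdequate n g Θ ℓ K L m lam) (hinp : ∀ v, (inp v).Nodup)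
    (hload : (epochMessages E inp e).encard ≤ (c * (g + 1) : ℕ))
    (hX : g = 0 ∨ X.Subsingleton) {u : Fin n}
    (hu : ∀ m ∈ X, ∃ j, (inp u)[j]? = some m ∧ j % E = e)
    (hgood : EpochSucceeds c E Θ ℓ K L e X lam cfg ω) :
    coveredBy (epochLength ℓ K L) E X (cfg ((e + 1) * epochLength ℓ K L - 1)) = Set.univ := by
  obtain ⟨i, rfl⟩ : ∃ i, ℓ = i + 1 := Nat.exists_eq_succ_of_ne_zero hpar.stages_pos.ne'
  have hcard := ncard_coveredBy_doubles inp G ω hconn hpar hinp hload hX i.lt_succ_self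
    hgood (min_two_pow_le_ncard_coveredBy inp G ω hconn hpar hinp hload hX hu hgood i.lt_succ_self)
  rw [stageStart_last, min_eq_right hpar.le_two_pow] at hcard
  refine Set.eq_of_subset_of_ncard_le (Set.subset_univ _) ?_ (Set.toFinite _)
  rwa [Set.ncard_univ, Nat.card_eq_fintype_card, Fintype.card_fin]

end Epoch

section Classes

variable {n : ℕ} {M : Type}

/-- A family of pairs of an epoch `e < E` and a set of messages that one node introduces in epoch
`e`, which covers the input. An epoch has at most `c * (g + 1)` messages, which fit in `g + 1`
packets, and the classes are single messages unless one packet suffices. -/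
structure IsClassification (c g E : ℕ) (inp : Fin n → List M)
    (classes : Finset (Fin E × Set M)) : Prop where
  load : ∀ e < E, (epochMessages E inp e).encard ≤ (c * (g + 1) : ℕ)
  subsingleton : ∀ p ∈ classes, g = 0 ∨ p.2.Subsingleton
  origin : ∀ p ∈ classes, ∃ u, ∀ m ∈ p.2, ∃ j, (inp u)[j]? = some m ∧ j % E = p.1
  cover : ∀ u, ∀ m ∈ inp u, ∃ p ∈ classes, m ∈ p.2

theorem encard_epochMessages_le_sum_count (E e : ℕ) (inp : Fin n → List M) :
    (epochMessages E inp e).encard ≤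
      (∑ u, Nat.count (fun j => j % E = e) (inp u).length : ℕ) := by
  classical
  let positions : Finset (Σ _ : Fin n, ℕ) :=
    Finset.univ.sigma fun u => {j ∈ Finset.range (inp u).length | j % E = e}
  have himage : some '' epochMessages E inp e ⊆
      (fun p : Σ _ : Fin n, ℕ => (inp p.1)[p.2]?) '' positions := by
    rintro _ ⟨m, ⟨u, j, hj, hje⟩, rfl⟩
    exact ⟨⟨u, j⟩, Finset.mem_sigma.2 ⟨Finset.mem_univ u, Finset.mem_filter.2
      ⟨Finset.mem_range.2 (List.getElem?_eq_some_iff.1 hj).1, hje⟩⟩, hj⟩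
  calc (epochMessages E inp e).encard
      = (some '' epochMessages E inp e).encard := ((Option.some_injective M).encard_image _).symm
    _ ≤ (positions : Set (Σ _ : Fin n, ℕ)).encard :=
        (Set.encard_le_encard himage).trans (Set.encard_image_le _ _)
    _ = _ := by
        rw [Set.encard_coe_eq_coe_finsetCard, Finset.card_sigma]
        simp only [Nat.count_eq_card_filter_range]

theorem encard_epochMessages_le {s : ℕ} {inp : Fin n → List M} (hinp : IsInput inp s) (E e : ℕ) :
    (epochMessages E inp e).encard ≤ s := by
  rw [← hinp.card]
  exact (encard_epochMessages_le_sum_count E e inp).trans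
    (Nat.cast_le.2 (Finset.sum_le_sum fun _ _ => Nat.count_le _))

theorem encard_epochMessages_le_div_add {s : ℕ} {inp : Fin n → List M} (hinp : IsInput inp s)
    {E e : ℕ} (he : e < E) : (epochMessages E inp e).encard ≤ (s / E + n : ℕ) := by
  have hE : 0 < E := Nat.zero_lt_of_lt he
  have hcount (k : ℕ) : Nat.count (fun j => j % E = e) k ≤ k / E + 1 := by
    have hmod := Nat.count_modEq_card k hE e
    simp only [Nat.ModEq, Nat.mod_eq_of_lt he] at hmod
    rw [hmod]
    split_ifs <;> omega
  refine (encard_epochMessages_le_sum_count E e inp).trans (Nat.cast_le.2 ?_)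
  calc ∑ u, Nat.count (fun j => j % E = e) (inp u).length
      ≤ ∑ u : Fin n, ((inp u).length / E + 1) := Finset.sum_le_sum fun u _ => hcount _
    _ = ∑ u, (inp u).length / E + n := by simp [Finset.sum_add_distrib]
    _ ≤ s / E + n := by
        gcongr
        rw [Nat.le_div_iff_mul_le hE, Finset.sum_mul, ← hinp.card]
        exact Finset.sum_le_sum fun u _ => Nat.div_mul_le_self _ _

theorem exists_isClassification_singletons {s c g : ℕ} {inp : Fin n → List M}
    (hinp : IsInput inp s) (hs : s ≤ c * (g + 1)) :
    ∃ classes, IsClassification c g 1 inp classes ∧ classes.card ≤ s := by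
  classical
  let messages : Finset M := Finset.univ.biUnion fun u => (inp u).toFinset
  have hmem (m : M) : m ∈ messages ↔ ∃ u, m ∈ inp u := by simp [messages]
  refine ⟨messages.image fun m => (0, {m}), ⟨fun e _ => ?_, ?_, ?_, fun u m hm => ?_⟩, ?_⟩
  · exact (encard_epochMessages_le hinp 1 e).trans (Nat.cast_le.2 hs)
  · exact Finset.forall_mem_image.2 fun m _ => Or.inr Set.subsingleton_singleton
  · refine Finset.forall_mem_image.2 fun m hm => ?_
    obtain ⟨u, hu⟩ := (hmem m).1 hm
    obtain ⟨j, hj⟩ := List.mem_iff_getElem?.1 hu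
    exact ⟨u, fun _ hm' => ⟨j, hm' ▸ hj, Nat.mod_one j⟩⟩
  · exact ⟨_, Finset.mem_image_of_mem _ ((hmem m).2 ⟨u, hm⟩), Set.mem_singleton m⟩
  · rw [← hinp.card]
    exact Finset.card_image_le.trans (Finset.card_biUnion_le.trans
      (Finset.sum_le_sum fun u _ => List.toFinset_card_le _))

theorem exists_isClassification_origins {s c E : ℕ} {inp : Fin n → List M}
    (hinp : IsInput inp s) (hE : 0 < E) (hs : s / E + n ≤ c) :
    ∃ classes, IsClassification c 0 E inp classes ∧ classes.card ≤ n * E := by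
  classical
  let originClass (p : Fin n × Fin E) : Fin E × Set M :=
    (p.2, {m | ∃ j, (inp p.1)[j]? = some m ∧ j % E = p.2})
  refine ⟨Finset.univ.image originClass, ⟨fun e he => ?_, fun _ _ => Or.inl rfl, ?_,
    fun u m hm => ?_⟩, ?_⟩
  · exact (encard_epochMessages_le_div_add hinp he).trans (Nat.cast_le.2 (by omega))
  · exact Finset.forall_mem_image.2 fun p _ => ⟨p.1, fun m hm => hm⟩
  · obtain ⟨j, hj⟩ := List.mem_iff_getElem?.1 hm
    exact ⟨_, Finset.mem_image_of_mem _ (Finset.mem_univ (u, ⟨j % E, Nat.mod_lt j hE⟩)), j, hj, rfl⟩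
  · exact Finset.card_image_le.trans_eq (by simp)

end Classes

section SamplingSolves

variable {n c g E N Θ ℓ K L m : ℕ} [NeZero N] {lam : ℝ}

local notation "alg" => samplingBroadcast n c g (epochLength ℓ K L) E N Θ (IsSelectionRound ℓ K L)

theorem sampling_disseminated {M : Type} [DecidableEq M] (inp : Fin n → List M)
    (G : ℕ → SimpleGraph (Fin n)) (ω : ℕ → Fin n → SlotCoin 1 N (SelectionCoin n g))
    (hconn : IntervalConnected G ⊤) (hpar : IsAdequate n g Θ ℓ K L m lam)
    (hinp : ∀ v, (inp v).Nodup) {classes : Finset (Fin E × Set M)}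
    (hclass : IsClassification c g E inp classes)
    (hgood : ∀ p ∈ classes, EpochSucceeds c E Θ ℓ K L p.1 p.2 lam (run alg inp G ω) ω) :
    Disseminated inp (run alg inp G ω (E * epochLength ℓ K L)) := by
  intro u v msg hmsg
  obtain ⟨p, hp, hmp⟩ := hclass.cover u msg hmsg
  obtain ⟨w, hw⟩ := hclass.origin p hp
  have huniv := coveredBy_epoch_end inp G ω hconn hpar hinp (hclass.load _ p.1.2)
    (hclass.subsingleton p hp) hw (hgood p hp)
  obtain ⟨i, -, hi⟩ := (huniv ▸ Set.mem_univ v : v ∈ coveredBy _ E p.2 _) msg hmp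
  have hend : (p.1 + 1) * epochLength ℓ K L - 1 ≤ E * epochLength ℓ K L :=
    (Nat.sub_le _ _).trans (Nat.mul_le_mul_right _ p.1.2)
  exact (run_known_prefix alg inp G ω hend v).subset (List.mem_of_getElem? hi)

theorem coinMeasure_iUnion_starves_le {M : Type} [DecidableEq M] (inp : Fin n → List M)
    (hℓ : 0 < ℓ) (hQ : 0 < stageLength ℓ K L)
    (hdvd : ∀ j, 1 ≤ j → j ≤ E * epochLength ℓ K L + stageLength ℓ K L → j ∣ N)
    {adv : (ℕ → Fin n → SlotCoin 1 N (SelectionCoin n g)) → ℕ → SimpleGraph (Fin n)}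
    (hadv : IsOblivious adv 0) :
    coinMeasure alg (⋃ p : Fin (E * epochLength ℓ K L) × Fin n,
        {ω | Starves Θ (p.1 + 1) (p.1 + windowLength ℓ K L p.1)
          (fun r => samplingWake (run alg inp (adv ω) ω r)) ω p.2 0}) ≤
      ENNReal.ofReal (E * epochLength ℓ K L * n * Real.exp (-(Θ / 8))) := by
  refine measure_iUnion_le_ofReal (δ := Real.exp (-(Θ / 8))) (fun p => ?_)
    (le_of_eq (by simp [Fintype.card_prod]))
  refine coinMeasure_starves_le Θ _ (fun j hj hjT => hdvd j hj (hjT.trans ?_)) (fun r ω ω' h => ?_)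
    _ _
  · exact Nat.add_le_add p.1.2.le (Nat.le_of_dvd hQ (windowLength_dvd_stageLength hℓ _))
  · have hrun : run alg inp (adv ω) ω r = run alg inp (adv ω') ω' r :=
      run_dependsOn alg inp hadv r h
    simp only [hrun]

theorem samplingBroadcast_solves {s B κ : ℕ} {ε : ℝ} (hpar : IsAdequate n g Θ ℓ K L m lam)
    (hdvd : ∀ j, 1 ≤ j → j ≤ E * epochLength ℓ K L + stageLength ℓ K L → j ∣ N)
    (hclass : ∀ inp : Fin n → List (BitVec B), IsInput inp s →
      ∃ classes, IsClassification c g E inp classes ∧ classes.card ≤ κ)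
    (hε : E * epochLength ℓ K L * n * Real.exp (-(Θ / 8)) + κ * ℓ * Real.exp (-lam) ≤ ε) :
    Solves alg ⊤ 0 s B (E * epochLength ℓ K L) (1 - ε) := by
  intro inp adv hinp hadv hconn
  obtain ⟨classes, hclasses, hcard⟩ := hclass inp hinp
  let starving := ⋃ p : Fin (E * epochLength ℓ K L) × Fin n,
    {ω | Starves Θ (p.1 + 1) (p.1 + windowLength ℓ K L p.1)
      (fun r => samplingWake (run alg inp (adv ω) ω r)) ω p.2 0}
  let unselected := ⋃ p : classes × Fin ℓ,
    {ω | SelectionFails c (epochLength ℓ K L) E (IsSelectionRound ℓ K L) p.1.1.2 lam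
      (stageStart ℓ K L p.1.1.1 p.2) (stageStart ℓ K L p.1.1.1 (p.2 + 1))
      (run alg inp (adv ω) ω) ω}
  refine le_coinMeasure_of_compl_subset _ (le_trans (by positivity) hε)
    (bad := starving ∪ unselected) (fun ω hω => ?_) ?_
  · refine sampling_disseminated inp (adv ω) ω (hconn ω) hpar hinp.nodup hclasses fun p hp =>
      ⟨fun i hi hfail => hω (Or.inr (Set.mem_iUnion.2 ⟨(⟨p, hp⟩, ⟨i, hi⟩), hfail⟩)),
        fun t₀ ht v hstarves => hω (Or.inl (Set.mem_iUnion.2 ⟨(⟨t₀, ?_⟩, v), hstarves⟩))⟩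
    exact ht.trans_le (Nat.mul_le_mul_right _ p.1.2)
  · refine (measure_union_le _ _).trans ((add_le_add (coinMeasure_iUnion_starves_le inp
      hpar.stages_pos (stageLength_pos hpar.repetitions_pos hpar.length_pos) hdvd hadv)
      (measure_iUnion_le_ofReal (ε := κ * ℓ * Real.exp (-lam))
        (fun p => coinMeasure_selectionFails_le inp hadv _ _ _ _) ?_)).trans ?_)
    · rw [Fintype.card_prod, Fintype.card_coe, Fintype.card_fin]
      push_cast
      gcongr
    · rw [← ENNReal.ofReal_add (by positivity) (by positivity)]
      exact ENNReal.ofReal_le_ofReal hε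

end SamplingSolves

section Logarithms

variable {n : ℕ}

theorem two_pow_clog_le (hn : 2 ≤ n) : 2 ^ Nat.clog 2 n ≤ 2 * n := by
  have hlt : 2 ^ (Nat.clog 2 n - 1) < n := Nat.pow_pred_clog_lt_self (by norm_num) hn
  rw [← Nat.sub_add_cancel (Nat.clog_pos one_lt_two hn), pow_succ']
  exact Nat.mul_le_mul_left 2 hlt.le

theorem one_half_le_log (hn : 2 ≤ n) : 1 / 2 ≤ Real.log n := by
  have hlog : Real.log 2 ≤ Real.log n := Real.log_le_log two_pos (by exact_mod_cast hn)
  linarith [Real.log_two_gt_d9]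

theorem log_le_clog (hn : 0 < n) : Real.log n ≤ Nat.clog 2 n :=
  calc Real.log n ≤ Real.log (2 ^ Nat.clog 2 n) :=
        Real.log_le_log (by exact_mod_cast hn) (by exact_mod_cast Nat.le_pow_clog one_lt_two n)
    _ = Nat.clog 2 n * Real.log 2 := Real.log_pow _ _
    _ ≤ Nat.clog 2 n := mul_le_of_le_one_right (Nat.cast_nonneg _) (by
        linarith [Real.log_two_lt_d9])

theorem clog_le_three_mul_log (hn : 2 ≤ n) : (Nat.clog 2 n : ℝ) ≤ 3 * Real.log n := by
  have hpred : ((Nat.clog 2 n - 1 : ℕ) : ℝ) * Real.log 2 ≤ Real.log n := by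
    rw [← Real.log_pow]
    exact Real.log_le_log (by positivity)
      (by exact_mod_cast (Nat.pow_pred_clog_lt_self one_lt_two hn).le)
  rw [Nat.cast_pred (Nat.clog_pos one_lt_two hn)] at hpred
  have hlog : Real.log 2 ≤ Real.log n := Real.log_le_log two_pos (by exact_mod_cast hn)
  have hclog : (Nat.clog 2 n : ℝ) * (2 / 3) ≤ Nat.clog 2 n * Real.log 2 := by
    gcongr
    linarith [Real.log_two_gt_d9]
  linarith

theorem exp_neg_mul_clog_le_rpow (hn : 0 < n) {γ : ℝ} (hγ : 0 ≤ γ) :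
    Real.exp (-(γ * Nat.clog 2 n)) ≤ (n : ℝ) ^ (-γ) := by
  rw [Real.rpow_def_of_pos (by exact_mod_cast hn), Real.exp_le_exp, mul_neg, neg_le_neg_iff,
    mul_comm]
  exact mul_le_mul_of_nonneg_left (log_le_clog hn) hγ

-- Half of `D` absorbs the factor `D ^ 2`, and the summand `25` absorbs the other factors.
theorem mul_exp_neg_mul_le_exp_neg {x l a D : ℝ} (hx : 0 ≤ x) (hxl : x ≤ Real.exp l) (hl : 1 ≤ l)
    (hD : 0 ≤ D) (ha : 2 * (a + 25) ≤ D) :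
    2 ^ 15 * D ^ 2 * x ^ 3 * l ^ 4 * Real.exp (-(D * l)) ≤ Real.exp (-(a * l)) := by
  have hle : l + 1 ≤ Real.exp l := Real.add_one_le_exp l
  have htwo : (2 : ℝ) ≤ Real.exp l := by linarith
  have hsq : D ^ 2 ≤ 2 ^ 3 * Real.exp (D / 2 * l) := by
    have hquad := Real.quadratic_le_exp_of_nonneg (div_nonneg hD zero_le_two)
    have hmono : Real.exp (D / 2) ≤ Real.exp (D / 2 * l) := Real.exp_le_exp.2 (by nlinarith)
    nlinarith
  calc 2 ^ 15 * D ^ 2 * x ^ 3 * l ^ 4 * Real.exp (-(D * l))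
      ≤ 2 ^ 15 * (2 ^ 3 * Real.exp (D / 2 * l)) * x ^ 3 * l ^ 4 * Real.exp (-(D * l)) := by gcongr
    _ = 2 ^ 18 * x ^ 3 * l ^ 4 * Real.exp (D / 2 * l + -(D * l)) := by rw [Real.exp_add]; ring
    _ ≤ Real.exp l ^ 18 * Real.exp l ^ 3 * Real.exp l ^ 4 *
          Real.exp (D / 2 * l + -(D * l)) := by
        gcongr
        linarith
    _ = Real.exp (25 * l + (D / 2 * l + -(D * l))) := by
        rw [Real.exp_add (25 * l), ← pow_add, ← pow_add, ← Real.exp_nat_mul]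
        norm_num
    _ ≤ Real.exp (-(a * l)) := Real.exp_le_exp.2 (by nlinarith)

theorem mul_exp_neg_mul_clog_le_rpow {D : ℕ} {γ : ℝ} (hn : 2 ≤ n) (hγ : 0 ≤ γ)
    (hD : 2 * (γ + 25) ≤ D) :
    2 ^ 15 * D ^ 2 * n ^ 3 * Nat.clog 2 n ^ 4 * Real.exp (-(D * Nat.clog 2 n)) ≤
      (n : ℝ) ^ (-γ) := by
  refine (mul_exp_neg_mul_le_exp_neg n.cast_nonneg ?_ ?_ D.cast_nonneg hD).trans
    (exp_neg_mul_clog_le_rpow (by omega) hγ)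
  · rw [← Real.log_le_iff_le_exp (by exact_mod_cast (by omega : 0 < n))]
    exact log_le_clog (by omega)
  · exact_mod_cast Nat.clog_pos one_lt_two hn

theorem harmonic_two_pow_mul_clog_le {k q : ℕ} (hn : 2 ≤ n) (hq : 0 < q) (hqn : q ≤ 2 * n ^ 2) :
    ((harmonic (2 ^ k * q * Nat.clog 2 n) : ℚ) : ℝ) ≤ (5 + k) * Nat.clog 2 n := by
  have hl : (1 : ℝ) ≤ Nat.clog 2 n := by exact_mod_cast Nat.clog_pos one_lt_two hn
  have hq0 : (0 : ℝ) < q := by exact_mod_cast hq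
  have hlogq : Real.log q ≤ Real.log 2 + 2 * Real.log n := by
    refine (Real.log_le_log hq0 (by exact_mod_cast hqn : (q : ℝ) ≤ 2 * n ^ 2)).trans_eq ?_
    rw [Real.log_mul (by norm_num) (by positivity), Real.log_pow, Nat.cast_ofNat]
  have hloglog := Real.log_le_sub_one_of_pos (zero_lt_one.trans_le hl)
  have hlog2 : Real.log 2 ≤ Nat.clog 2 n := by linarith [Real.log_two_lt_d9]
  have hk := mul_le_mul_of_nonneg_left hlog2 (Nat.cast_nonneg (α := ℝ) k)
  refine (harmonic_le_one_add_log _).trans ?_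
  push_cast
  rw [Real.log_mul (by positivity) (by positivity), Real.log_mul (by positivity) (by positivity),
    Real.log_pow]
  linarith [log_le_clog (by omega : 0 < n)]

end Logarithms

section Parameters

variable {n : ℕ} {ε : ℝ}

theorem exists_neZero_forall_dvd (T : ℕ) : ∃ N, NeZero N ∧ ∀ j, 1 ≤ j → j ≤ T → j ∣ N :=
  ⟨T.factorial, ⟨T.factorial_ne_zero⟩, fun _ => Nat.dvd_factorial⟩

theorem exists_harmonicMulti_solves {D s : ℕ} (B b : ℕ) (hn : 2 ≤ n) (hD : 0 < D) (hs : 1 ≤ s)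
    (hsn : s ≤ n)
    (hε : 2 ^ 15 * D ^ 2 * n ^ 3 * Nat.clog 2 n ^ 4 * Real.exp (-(D * Nat.clog 2 n)) ≤ ε) :
    ∃ A : Algorithm n, A.HasCapacity 1 b ∧
      Solves A ⊤ 0 s B (8 * D * Nat.clog 2 n * (2 ^ 6 * (n * s) * Nat.clog 2 n)) (1 - ε) := by
  have hl : 0 < Nat.clog 2 n := Nat.clog_pos one_lt_two hn
  have hns : 0 < n * s := Nat.mul_pos (by omega) hs
  have hharmonic := harmonic_two_pow_mul_clog_le (k := 6) hn hns (by nlinarith)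
  generalize Nat.clog 2 n = l at *
  obtain ⟨N, _, hdvd⟩ := exists_neZero_forall_dvd (8 * D * l * (2 ^ 6 * (n * s) * l))
  refine ⟨_, harmonicMulti_hasCapacity n s N _ b,
    harmonicMulti_solves (by positivity) (by positivity) hdvd ?_ ?_⟩
  · have hnsl : (0 : ℝ) < n * s * l := by exact_mod_cast Nat.mul_pos hns hl
    calc 4 * ((n : ℝ) * s * (harmonic (2 ^ 6 * (n * s) * l) : ℚ))
        ≤ 4 * (n * s * ((5 + (6 : ℕ)) * l)) := by gcongr
      _ < ((2 ^ 6 * (n * s) * l : ℕ) : ℝ) := by push_cast; linarith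
  · have hexp : -(((8 * D * l : ℕ) : ℝ) / 8) = -(D * (l : ℝ)) := by push_cast; ring
    rw [hexp]
    refine (mul_le_mul_of_nonneg_right ?_ (Real.exp_pos _).le).trans hε
    have hcount : n * s ≤ 2 ^ 15 * D ^ 2 * n ^ 3 * l ^ 4 :=
      calc n * s ≤ n * n := Nat.mul_le_mul_left n hsn
        _ ≤ n ^ 3 := by rw [← pow_two]; exact Nat.pow_le_pow_right (by omega) (by norm_num)
        _ ≤ 2 ^ 15 * D ^ 2 * n ^ 3 * l ^ 4 := by
            rw [mul_right_comm]
            exact Nat.le_mul_of_pos_left _ (by positivity)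
    exact_mod_cast hcount

theorem isAdequate_clog {D : ℕ} (g : ℕ) (hn : 2 ≤ n) (hD : 0 < D) :
    IsAdequate n g (8 * D * Nat.clog 2 n) (Nat.clog 2 n) (6 * (g + 1) * D * Nat.clog 2 n)
      (1024 * D * Nat.clog 2 n ^ 2) (2 ^ 7 * 2 ^ Nat.clog 2 n * Nat.clog 2 n)
      (D * Nat.clog 2 n) where
  threshold_pos := by have := Nat.clog_pos one_lt_two hn; positivity
  stages_pos := Nat.clog_pos one_lt_two hn
  repetitions_pos := by have := Nat.clog_pos one_lt_two hn; positivity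
  length_pos := by have := Nat.clog_pos one_lt_two hn; positivity
  le_two_pow := Nat.le_pow_clog one_lt_two n
  length_le := le_of_eq (by ring)
  harmonic_le := by
    have hharmonic := harmonic_two_pow_mul_clog_le (k := 7) (q := 2 ^ Nat.clog 2 n) hn
      (by positivity) ((two_pow_clog_le hn).trans (by nlinarith))
    have hDl : (0 : ℝ) ≤ D * (Nat.clog 2 n : ℝ) ^ 2 := by positivity
    calc 8 * (((8 * D * Nat.clog 2 n : ℕ) : ℝ) *
          (harmonic (2 ^ 7 * 2 ^ Nat.clog 2 n * Nat.clog 2 n) : ℚ))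
        ≤ 8 * (((8 * D * Nat.clog 2 n : ℕ) : ℝ) * ((5 + (7 : ℕ)) * Nat.clog 2 n)) := by gcongr
      _ = 768 * (D * (Nat.clog 2 n : ℝ) ^ 2) := by push_cast; ring
      _ ≤ ((1024 * D * Nat.clog 2 n ^ 2 : ℕ) : ℝ) := by push_cast; linarith
  lam_le := by
    have hcast : (1 : ℝ) ≤ n := by exact_mod_cast (by omega : 1 ≤ n)
    have hpos : (0 : ℝ) ≤ (g + 1) * D * Nat.clog 2 n := by positivity
    push_cast
    nlinarith

theorem mul_epochLength_clog_le {D : ℕ} (E g : ℕ) (hn : 2 ≤ n) :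
    E * epochLength (Nat.clog 2 n) (6 * (g + 1) * D * Nat.clog 2 n)
        (1024 * D * Nat.clog 2 n ^ 2) ≤
      12288 * D ^ 2 * (E * (g + 1)) * n * Nat.clog 2 n ^ 4 :=
  calc _ = 6144 * D ^ 2 * (E * (g + 1)) * 2 ^ Nat.clog 2 n * Nat.clog 2 n ^ 4 := by
        rw [epochLength, stageLength]
        ring
    _ ≤ 6144 * D ^ 2 * (E * (g + 1)) * (2 * n) * Nat.clog 2 n ^ 4 := by
        gcongr
        exact two_pow_clog_le hn
    _ = _ := by ring

theorem mul_add_mul_le_of_le_two_mul {D w κ l t : ℕ} (hn : 0 < n) (hD : 0 < D)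
    (hw : w ≤ 2 * n) (hκ : κ ≤ 2 * n ^ 2) (ht : t ≤ 12288 * D ^ 2 * w * n * l ^ 4) :
    t * n + κ * l ≤ 2 ^ 15 * D ^ 2 * n ^ 3 * l ^ 4 := by
  have hcube : n ^ 2 ≤ D ^ 2 * n ^ 3 :=
    (Nat.pow_le_pow_right hn (by norm_num)).trans (Nat.le_mul_of_pos_left _ (by positivity))
  have hl : l ≤ l ^ 4 := Nat.le_self_pow (by norm_num) l
  calc t * n + κ * l
      ≤ 12288 * D ^ 2 * (2 * n) * n * l ^ 4 * n + 2 * (D ^ 2 * n ^ 3) * l ^ 4 := by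
        gcongr
        · exact ht.trans (by gcongr)
        · exact hκ.trans (by gcongr)
    _ = 24578 * (D ^ 2 * n ^ 3 * l ^ 4) := by ring
    _ ≤ 2 ^ 15 * (D ^ 2 * n ^ 3 * l ^ 4) := by gcongr; norm_num
    _ = 2 ^ 15 * D ^ 2 * n ^ 3 * l ^ 4 := by ring

theorem exists_samplingBroadcast_solves {D s c g E B κ : ℕ} (b : ℕ) (hn : 2 ≤ n) (hD : 0 < D)
    (hEg : E * (g + 1) ≤ 2 * n) (hκ : κ ≤ 2 * n ^ 2)
    (hclass : ∀ inp : Fin n → List (BitVec B), IsInput inp s →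
      ∃ classes, IsClassification c g E inp classes ∧ classes.card ≤ κ)
    (hε : 2 ^ 15 * D ^ 2 * n ^ 3 * Nat.clog 2 n ^ 4 * Real.exp (-(D * Nat.clog 2 n)) ≤ ε) :
    ∃ (A : Algorithm n) (t : ℕ), A.HasCapacity c b ∧
      t ≤ 12288 * D ^ 2 * (E * (g + 1)) * n * Nat.clog 2 n ^ 4 ∧
      Solves A ⊤ 0 s B t (1 - ε) := by
  have hpar := isAdequate_clog g hn hD
  have htime := mul_epochLength_clog_le (D := D) E g hn
  have hcount := mul_add_mul_le_of_le_two_mul (by omega) hD hEg hκ htime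
  generalize Nat.clog 2 n = l at *
  obtain ⟨N, _, hdvd⟩ := exists_neZero_forall_dvd
    (E * epochLength l (6 * (g + 1) * D * l) (1024 * D * l ^ 2) +
      stageLength l (6 * (g + 1) * D * l) (1024 * D * l ^ 2))
  refine ⟨_, _, samplingBroadcast_hasCapacity _ _ _ _ _ N _ _ _, htime,
    samplingBroadcast_solves hpar hdvd hclass (le_trans ?_ hε)⟩
  have hexp : -(((8 * D * l : ℕ) : ℝ) / 8) = -(D * (l : ℝ)) := by push_cast; ring
  rw [hexp, ← add_mul]
  gcongr
  exact_mod_cast hcount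

end Parameters

section Capacity

variable {n D s c B b : ℕ} {ε : ℝ}

theorem solves_zero (A : Algorithm n) (T : ℕ∞) (τ s B t : ℕ) : Solves A T τ s B t 0 :=
  fun _ _ _ _ _ => ENNReal.toReal_nonneg

theorem exists_unit_capacity_solves (hn : 2 ≤ n) (hD : 0 < D) (hs : 1 ≤ s)
    (hε : 2 ^ 15 * D ^ 2 * n ^ 3 * Nat.clog 2 n ^ 4 * Real.exp (-(D * Nat.clog 2 n)) ≤ ε) :
    ∃ (A : Algorithm n) (t : ℕ), A.HasCapacity 1 b ∧
      (t : ℝ) ≤ 4608 * D * (n * s * Real.log n ^ 2) ∧ Solves A ⊤ 0 s B t (1 - ε) := by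
  rcases le_or_gt s n with hsn | hns
  · obtain ⟨A, hA, hsol⟩ := exists_harmonicMulti_solves B b hn hD hs hsn hε
    refine ⟨A, _, hA, ?_, hsol⟩
    push_cast
    calc (8 : ℝ) * D * Nat.clog 2 n * (64 * (n * s) * Nat.clog 2 n)
        = 512 * D * (n * s * (Nat.clog 2 n : ℝ) ^ 2) := by ring
      _ ≤ 512 * D * (n * s * (3 * Real.log n) ^ 2) := by
          gcongr
          exact clog_le_three_mul_log hn
      _ = 4608 * D * (n * s * Real.log n ^ 2) := by ring
  · refine ⟨pipeline n 1, n * (n + s / 1), pipeline_hasCapacity n 1 b, ?_,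
      pipeline_solves le_rfl (by linarith [le_trans (by positivity) hε])⟩
    have hD' : (1 : ℝ) ≤ D := by exact_mod_cast hD
    rw [Nat.div_one]
    push_cast
    calc (n : ℝ) * (n + s) ≤ n * (s + s) := by gcongr
      _ = 8 * (n * s * (1 / 2) ^ 2) := by ring
      _ ≤ 4608 * D * (n * s * Real.log n ^ 2) := by
          gcongr
          · linarith
          · exact one_half_le_log hn

theorem pipeline_time_le (hn : 2 ≤ n) (hD : 0 < D) (hc : 1 ≤ c) (hcs : c * n ≤ s) :
    ((n * (n + s / c) : ℕ) : ℝ) ≤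
      1990656 * D ^ 2 * ((1 + (s : ℝ) / c) * n * Real.log n ^ 4) := by
  have hdiv : ((s / c : ℕ) : ℝ) ≤ (s : ℝ) / c := Nat.cast_div_le
  have hnsc : (n : ℝ) ≤ (s / c : ℕ) := by
    exact_mod_cast (Nat.le_div_iff_mul_le hc).2 (by rwa [mul_comm])
  have hD' : (1 : ℝ) ≤ D ^ 2 := by exact_mod_cast Nat.one_le_pow _ _ hD
  rw [Nat.cast_mul, Nat.cast_add]
  calc (n : ℝ) * (n + (s / c : ℕ)) ≤ n * (2 * (1 + (s : ℝ) / c)) := by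
        gcongr
        linarith
    _ = 32 * ((1 + (s : ℝ) / c) * n * (1 / 2) ^ 4) := by ring
    _ ≤ 1990656 * D ^ 2 * ((1 + (s : ℝ) / c) * n * Real.log n ^ 4) := by
        gcongr
        · linarith
        · exact one_half_le_log hn

theorem sampling_time_le {t w : ℕ} (hn : 2 ≤ n) (hw : w ≤ 2 * (s / c + 1))
    (ht : t ≤ 12288 * D ^ 2 * w * n * Nat.clog 2 n ^ 4) :
    (t : ℝ) ≤ 1990656 * D ^ 2 * ((1 + (s : ℝ) / c) * n * Real.log n ^ 4) := by
  have hw' : (w : ℝ) ≤ 2 * (1 + (s : ℝ) / c) :=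
    calc (w : ℝ) ≤ 2 * ((s / c : ℕ) + 1) := by exact_mod_cast hw
      _ ≤ 2 * (1 + (s : ℝ) / c) := by linarith [Nat.cast_div_le (α := ℝ) (m := s) (n := c)]
  calc (t : ℝ) ≤ 12288 * D ^ 2 * w * n * (Nat.clog 2 n : ℝ) ^ 4 := by exact_mod_cast ht
    _ ≤ 12288 * D ^ 2 * (2 * (1 + (s : ℝ) / c)) * n * (3 * Real.log n) ^ 4 := by
        gcongr
        exact clog_le_three_mul_log hn
    _ = 1990656 * D ^ 2 * ((1 + (s : ℝ) / c) * n * Real.log n ^ 4) := by ring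

theorem div_two_mul_div_add_one_le (s : ℕ) (hc : 0 < c) : s / (2 * (s / c + 1)) ≤ c / 2 := by
  rw [Nat.le_div_iff_mul_le two_pos]
  refine Nat.le_of_mul_le_mul_right (c := s / c + 1) ?_ (Nat.succ_pos _)
  rw [mul_assoc]
  exact (Nat.div_mul_le_self _ _).trans (Nat.lt_mul_div_succ s hc).le

theorem exists_capacity_solves (hn : 2 ≤ n) (hD : 0 < D) (hc : 1 ≤ c)
    (hε : 2 ^ 15 * D ^ 2 * n ^ 3 * Nat.clog 2 n ^ 4 * Real.exp (-(D * Nat.clog 2 n)) ≤ ε) :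
    ∃ (A : Algorithm n) (t : ℕ), A.HasCapacity c b ∧
      (t : ℝ) ≤ 1990656 * D ^ 2 * ((1 + (s : ℝ) / c) * n * Real.log n ^ 4) ∧
      Solves A ⊤ 0 s B t (1 - ε) := by
  rcases le_or_gt (c * n) s with hcs | hcs
  · exact ⟨pipeline n c, _, pipeline_hasCapacity n c b, pipeline_time_le hn hD hc hcs,
      pipeline_solves hc (by linarith [le_trans (by positivity) hε])⟩
  have hscn : s / c < n := (Nat.div_lt_iff_lt_mul hc).2 (by rwa [mul_comm])
  rcases le_or_gt (2 * n) c with hnc | hnc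
  · have hload : s / (2 * (s / c + 1)) + n ≤ c := by
      have := div_two_mul_div_add_one_le s hc
      omega
    obtain ⟨A, t, hA, ht, hsol⟩ := exists_samplingBroadcast_solves b hn hD (by omega)
      (by nlinarith) (fun inp hinp => exists_isClassification_origins hinp (by positivity) hload) hε
    exact ⟨A, t, hA, sampling_time_le hn (by omega) ht, hsol⟩
  · obtain ⟨A, t, hA, ht, hsol⟩ := exists_samplingBroadcast_solves b hn hD (by omega)
      (by nlinarith) (fun inp hinp => exists_isClassification_singletons hinp
        (Nat.lt_mul_div_succ s hc).le) hε
    exact ⟨A, t, hA, sampling_time_le hn (by omega) ht, hsol⟩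

end Capacity

end RadioNetwork

open RadioNetwork in
theorem theorem1 :
    ∃ K : ℕ, ∀ γ : ℝ, 0 < γ → ∃ C : ℝ, 0 < C ∧
      ∀ n s B : ℕ, 1 ≤ n → 1 ≤ s → 1 ≤ B →
        (∃ (A : Algorithm n) (t : ℕ), A.HasCapacity 1 (K * B) ∧
          (t : ℝ) ≤ C * (n * s * Real.log n ^ 2) ∧
          Solves A ⊤ 0 s B t (1 - (n : ℝ) ^ (-γ))) ∧
        (∀ c : ℕ, 1 ≤ c →
          ∃ (A : Algorithm n) (t : ℕ), A.HasCapacity c (K * (c * B)) ∧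
            (t : ℝ) ≤ C * ((1 + (s : ℝ) / c) * n * Real.log n ^ 4) ∧
            Solves A ⊤ 0 s B t (1 - (n : ℝ) ^ (-γ))) := by
  refine ⟨0, fun γ hγ => ?_⟩
  obtain ⟨D, hD⟩ := exists_nat_ge (2 * (γ + 25))
  have hD1 : (1 : ℝ) ≤ D := by linarith
  have hD0 : 0 < D := by exact_mod_cast hD1
  refine ⟨1990656 * D ^ 2, by positivity, fun n s B hn hs _ => ?_⟩
  rcases eq_or_lt_of_le hn with rfl | hn
  · have hp : 1 - ((1 : ℕ) : ℝ) ^ (-γ) = 0 := by simp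
    rw [hp]
    exact ⟨⟨pipeline 1 1, 0, pipeline_hasCapacity 1 1 _, by simp, solves_zero _ _ _ _ _ _⟩,
      fun c _ => ⟨pipeline 1 c, 0, pipeline_hasCapacity 1 c _, by simp, solves_zero _ _ _ _ _ _⟩⟩
  · have hfail := mul_exp_neg_mul_clog_le_rpow hn hγ.le hD
    refine ⟨?_, fun c hc => exists_capacity_solves hn hD0 hc hfail⟩
    obtain ⟨A, t, hA, ht, hsol⟩ := exists_unit_capacity_solves hn hD0 hs hfail
    refine ⟨A, t, hA, ht.trans ?_, hsol⟩
    gcongr ?_ * _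
    nlinarith
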